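/- Let $M$ be a smooth manifold (Hausdorff, second countable) and $n\ge 0$. An *$n$-coalgebra bundle* over $M$ is a graded smooth vector bundle $\mathbf E=\bigoplus_{i=1}^{n}E_{-i}\to M$ of finite rank with a smooth bundle map $\mu:\mathbf E\to\mathbf E\otimes\mathbf E$ over the identity that preserves degrees, is coassociative, $(\mu\otimes\mathrm{id})\mu=(\mathrm{id}\otimes\mu)\mu$, and is graded cocommutative, $\tau\mu=\mu$ for $\tau(e\otimes e')=(-1)^{|e||e'|}e'\otimes e$. Put $\mu^0=\mathrm{id}$, $\mu^{k+1}=(\mathrm{id}\otimes\mu^k)\mu:\mathbf E\to\mathbf E^{\otimes(k+2)}$, and let $\mathbf K^\mu\subseteq\mathbf E\otimes\mathbf E$ be the space of all $e$ with $\tau\cdot(\mu^k\otimes\mu^l)(e)=\tau'\cdot(\mu^{k'}\otimes\mu^{l'})(e)$ for all $k+l=k'+l'$ and all permutations $\tau,\tau'$ of the $k+l+2$ tensor factors, acting with Koszul signs. The bundle is *admissible* if in every fibre $\mu(E_{-i})$ is the degree $-i$ part $K^\mu_{-i}$ of $\mathbf K^\mu$, for $i=2,\dots,n$. Let $\mu^*:\Gamma(E_{-i}^*)\times\Gamma(E_{-j}^*)\to\Gamma(E_{-(i+j)}^*)$,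 $\mu^*(\eta,\zeta)=(\eta\otimes\zeta)\circ\mu$, for $i,j\ge 1$, $i+j\le n$, be the dual product. Let $\mathcal M=\mathcal F(\mathbf E,\mu)$ be the associated graded manifold: its body is $M$ and its structure sheaf $C_{\mathcal M}$ is the sheaf $\Gamma_{\mathrm{Sym}\,\mathbf E^*}/I_\mu$ of graded commutative algebras, where sections of $E_{-i}^*$ have degree $i$ and $I_\mu$ is the ideal generated by all $\eta\zeta-\mu^*(\eta,\zeta)$ with $\eta\in\Gamma(E_{-i}^*)$, $\zeta\in\Gamma(E_{-j}^*)$, $i+j\le n$. A vector field of degree $k$ over $U$ is a graded derivation of degree $k$ of $C_{\mathcal M}(U)$; a vector field $X$ has the tangent vector $X_x:f\mapsto X(f)^0(x)$ at $x\in U$, where $(\cdot)^0$ is the degree $0$ component. A *distribution* of rank $d_0|d_1|\cdots|d_n$ is a graded $C_{\mathcal M}$-submodule sheaf $\mathcal D$ of the sheaf of vector fields which near every point of $M$ is generated by $d_k$ vector fields of degree $-k$, $k=0,\dots,n$, whose tangent vectors are linearly independent at each point; it is *involutive* if it is closed under the graded commutator. For an involutive subbundle $F\subseteq TM$, a flat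 $F$-connection on a vector bundle $B\to M$ is a map $\nabla:\Gamma(F)\times\Gamma(B)\to\Gamma(B)$ which is biadditive, $C^\infty(M)$-linear in the first argument, and satisfies $\nabla_X(fb)=f\nabla_Xb+X(f)b$ and $\nabla_X\nabla_Y-\nabla_Y\nabla_X=\nabla_{[X,Y]}$. **Proposition.** Let $(\mathbf E\to M,\mu)$ be an admissible $n$-coalgebra bundle, $\mathcal M=\mathcal F(\mathbf E,\mu)$, and $d_0\ge 0$. There is a bijection between 1. involutive distributions $\mathcal D$ on $\mathcal M$ of rank $d_0|0|\cdots|0$, and 2. tuples $(F,\nabla^1,\dots,\nabla^n)$ of an involutive subbundle $F\subseteq TM$ of rank $d_0$ and flat $F$-connections $\nabla^i$ on $E_{-i}^*$ such that $$\nabla^{i+j}_X(\mu^*(e,e'))=\mu^*(\nabla^i_Xe,e')+\mu^*(e,\nabla^j_Xe')$$ for all $i,j\ge 1$ with $i+j\le n$, all $e\in\Gamma(E_{-i}^*)$, $e'\in\Gamma(E_{-j}^*)$ and $X\in\Gamma(F)$, under which $\mathcal D$ corresponds to $(F,\nabla^i)$ when the degree $0$ vector fields in $\mathcal D$ are exactly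 those which locally are of the form $\nabla_Y$ for some $Y\in\Gamma(F)$, that is, which locally act on smooth functions by $Y$ and on sections of $E_{-i}^*$ by $\nabla^i_Y$. -/

import Mathlib

open Bundle TopologicalSpace
open scoped Manifold ContDiff TensorProduct

noncomputable section

/-! ### Graded vector spaces and graded coalgebras

A family `W : Fin n → Type*` of vector spaces is regarded as the graded vector space
`⊕ W i`, where `W i` sits in degree `-(i + 1)`.  The total space is `∀ i, W i`. -/

namespace NMan

/-- The absolute value of the degree of the component with index `i`, a number in `1, …, n`. -/
def deg {n : ℕ} (i : Fin n) : ℕ := (i : ℕ) + 1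

section LinearAlgebra

variable {n : ℕ} {W : Fin n → Type*} [∀ i, AddCommGroup (W i)] [∀ i, Module ℝ (W i)]

variable (W) in
/-- The inclusion of the homogeneous component with index `i` in the total space. -/
def incl (i : Fin n) : W i →ₗ[ℝ] (∀ i, W i) := LinearMap.single ℝ W i

variable (W) in
/-- The projection of the total space onto its homogeneous component with index `i`,
as an endomorphism. -/
def homProj (i : Fin n) : (∀ i, W i) →ₗ[ℝ] (∀ i, W i) :=
  incl W i ∘ₗ LinearMap.proj i

variable (W) in
/-- The part of degree `-d` of the tensor square of the total space. -/
def tensorDegree (d : ℕ) : Submodule ℝ ((∀ i, W i) ⊗[ℝ] (∀ i, W i)) :=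
  ⨆ (i : Fin n) (j : Fin n) (_ : deg i + deg j = d),
    LinearMap.range (TensorProduct.map (incl W i) (incl W j))

variable (W) in
/-- The graded flip `e ⊗ e' ↦ (-1) ^ (|e| |e'|) e' ⊗ e`. -/
def gradedFlip : ((∀ i, W i) ⊗[ℝ] (∀ i, W i)) →ₗ[ℝ] ((∀ i, W i) ⊗[ℝ] (∀ i, W i)) :=
  ∑ i : Fin n, ∑ j : Fin n, ((-1 : ℝ) ^ (deg i * deg j)) •
    ((TensorProduct.comm ℝ (∀ i, W i) (∀ i, W i)).toLinearMap ∘ₗ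
      TensorProduct.map (homProj W i) (homProj W j))

/-- The Koszul sign of rearranging homogeneous `v₀ ⊗ ⋯ ⊗ v_{N-1}` as
`v_{τ 0} ⊗ ⋯ ⊗ v_{τ (N-1)}`, where `v_a` has index `c a`. -/
def koszulSign {N : ℕ} (c : Fin N → Fin n) (τ : Equiv.Perm (Fin N)) : ℝ :=
  ∏ a : Fin N, ∏ b : Fin N,
    if a < b ∧ τ b < τ a then (-1 : ℝ) ^ (deg (c (τ a)) * deg (c (τ b))) else 1

variable (W) in
/-- The braiding action of a permutation on the `N`-th tensor power: on homogeneous elements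
`v₀ ⊗ ⋯ ⊗ v_{N-1} ↦ ± v_{τ 0} ⊗ ⋯ ⊗ v_{τ (N-1)}` with the Koszul sign. -/
def braid {N : ℕ} (τ : Equiv.Perm (Fin N)) :
    (⨂[ℝ]^N (∀ i, W i)) →ₗ[ℝ] (⨂[ℝ]^N (∀ i, W i)) :=
  ∑ c : Fin N → Fin n, koszulSign c τ •
    ((PiTensorProduct.reindex ℝ (fun _ : Fin N => (∀ i, W i)) τ.symm).toLinearMap ∘ₗ
      PiTensorProduct.map (fun a => homProj W (c a)))

/-- The iterated comultiplication `μ^k : E → E^{⊗ (k+1)}`, with `μ^0 = id` and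
`μ^{k+1} = (id ⊗ μ^k) ∘ μ`. -/
def iterComul (μ : (∀ i, W i) →ₗ[ℝ] (∀ i, W i) ⊗[ℝ] (∀ i, W i)) :
    (k : ℕ) → (∀ i, W i) →ₗ[ℝ] (⨂[ℝ]^(k + 1) (∀ i, W i))
  | 0 => (PiTensorProduct.subsingletonEquiv (R := ℝ) (s := fun _ : Fin 1 => ∀ i, W i) 0).symm
  | k + 1 =>
      (TensorPower.cast ℝ (∀ i, W i) (Nat.add_comm 1 (k + 1))).toLinearMap ∘ₗ
        (TensorPower.mulEquiv (n := 1) (m := k + 1)).toLinearMap ∘ₗ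
          TensorProduct.map
            (PiTensorProduct.subsingletonEquiv (R := ℝ)
              (s := fun _ : Fin 1 => ∀ i, W i) 0).symm.toLinearMap (iterComul μ k) ∘ₗ μ

/-- The map `μ^k ⊗ μ^l` from the tensor square to the tensor power with `N = k + l + 2` factors. -/
def tensorIter (μ : (∀ i, W i) →ₗ[ℝ] (∀ i, W i) ⊗[ℝ] (∀ i, W i)) {N : ℕ} (k l : ℕ)
    (h : (k + 1) + (l + 1) = N) :
    ((∀ i, W i) ⊗[ℝ] (∀ i, W i)) →ₗ[ℝ] (⨂[ℝ]^N (∀ i, W i)) :=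
  (TensorPower.cast ℝ (∀ i, W i) h).toLinearMap ∘ₗ
    (TensorPower.mulEquiv (n := k + 1) (m := l + 1)).toLinearMap ∘ₗ
      TensorProduct.map (iterComul μ k) (iterComul μ l)

/-- The space `K^μ ⊆ E ⊗ E` of all `e` with
`τ · (μ^k ⊗ μ^l)(e) = τ' · (μ^{k'} ⊗ μ^{l'})(e)` whenever `k + l = k' + l'`
and `τ, τ'` are permutations of the `k + l + 2` factors. -/
def kSpace (μ : (∀ i, W i) →ₗ[ℝ] (∀ i, W i) ⊗[ℝ] (∀ i, W i)) :
    Set ((∀ i, W i) ⊗[ℝ] (∀ i, W i)) :=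
  {e | ∀ (N k l k' l' : ℕ) (h : (k + 1) + (l + 1) = N) (h' : (k' + 1) + (l' + 1) = N)
      (τ τ' : Equiv.Perm (Fin N)),
      braid W τ (tensorIter μ k l h e) = braid W τ' (tensorIter μ k' l' h' e)}

/-- A degree preserving, coassociative and graded cocommutative comultiplication. -/
structure IsGradedCoalgebra (μ : (∀ i, W i) →ₗ[ℝ] (∀ i, W i) ⊗[ℝ] (∀ i, W i)) : Prop where
  degree : ∀ (i : Fin n) (v : W i), μ (incl W i v) ∈ tensorDegree W (deg i)
  coassoc : (TensorProduct.assoc ℝ (∀ i, W i) (∀ i, W i) (∀ i, W i)).toLinearMap ∘ₗ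
      TensorProduct.map μ LinearMap.id ∘ₗ μ = TensorProduct.map LinearMap.id μ ∘ₗ μ
  cocomm : gradedFlip W ∘ₗ μ = μ

/-- The admissibility condition `im μ_{-i} = K^μ_{-i}` for `i = 2, …, n`. -/
def IsAdmissibleComul (μ : (∀ i, W i) →ₗ[ℝ] (∀ i, W i) ⊗[ℝ] (∀ i, W i)) : Prop :=
  ∀ i : Fin n, 2 ≤ deg i →
    Set.range (fun v : W i => μ (incl W i v)) = kSpace μ ∩ tensorDegree W (deg i)

end LinearAlgebra

/-! ### Local sections of the dual bundles -/

section Sections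

variable {m n : ℕ} {M : Type*} [TopologicalSpace M] [ChartedSpace (EuclideanSpace ℝ (Fin m)) M]

variable (m) in
/-- The algebra of smooth functions on an open subset. -/
abbrev SmoothFun (U : Opens M) := C^∞⟮𝓡 m, U; 𝓘(ℝ, ℝ), ℝ⟯

/-- Restriction of smooth functions. -/
def SmoothFun.res {U V : Opens M} (h : V ≤ U) (f : SmoothFun m U) : SmoothFun m V :=
  ContMDiffMap.restrictRingHom (𝓡 m) 𝓘(ℝ, ℝ) ℝ h f

variable (Fib : Type*) [NormedAddCommGroup Fib] [NormedSpace ℝ Fib]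
  (E : M → Type*) [TopologicalSpace (TotalSpace Fib E)]
  [∀ x, AddCommGroup (E x)] [∀ x, Module ℝ (E x)] [∀ x, TopologicalSpace (E x)]
  [FiberBundle Fib E] [VectorBundle ℝ Fib E]

variable (m) in
/-- Smoothness of a section, over an open set `U`, of the dual of the bundle `E`. -/
def IsSmoothDual (U : Opens M) (η : ∀ x : U, E x →L[ℝ] ℝ) : Prop :=
  ContMDiff (𝓡 m) ((𝓡 m).prod 𝓘(ℝ, Fib →L[ℝ] ℝ)) ∞
    (fun x : U => TotalSpace.mk' (Fib →L[ℝ] ℝ)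
      (E := fun y : M => E y →L[ℝ] Bundle.Trivial M ℝ y) (x : M) (η x))

variable {Fib E} in
lemma isSmoothDual_iff {U : Opens M} {η : ∀ x : U, E x →L[ℝ] ℝ} :
    IsSmoothDual m Fib E U η ↔ ∀ x₀ : U, ContMDiffAt (𝓡 m) 𝓘(ℝ, Fib →L[ℝ] ℝ) ∞
      (fun x : U => (trivializationAt (Fib →L[ℝ] ℝ)
        (fun y : M => E y →L[ℝ] Bundle.Trivial M ℝ y) (x₀ : M)
          (TotalSpace.mk' (Fib →L[ℝ] ℝ)
            (E := fun y : M => E y →L[ℝ] Bundle.Trivial M ℝ y) (x : M) (η x))).2) x₀ := by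
  refine forall_congr' fun x₀ => ?_
  rw [contMDiffAt_totalSpace]
  exact and_iff_right (contMDiff_subtype_val x₀)

variable {Fib E} in
lemma trivializationAt_linear (x₀ : M) :
    (trivializationAt (Fib →L[ℝ] ℝ)
      (fun y : M => E y →L[ℝ] Bundle.Trivial M ℝ y) x₀).IsLinear ℝ := inferInstance

variable {Fib E} in
lemma eventually_mem_baseSet {U : Opens M} (x₀ : U) :
    ∀ᶠ x : U in nhds x₀, (x : M) ∈ (trivializationAt (Fib →L[ℝ] ℝ)
      (fun y : M => E y →L[ℝ] Bundle.Trivial M ℝ y) (x₀ : M)).baseSet :=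
  continuous_subtype_val.continuousAt.eventually_mem
    ((trivializationAt (Fib →L[ℝ] ℝ)
      (fun y : M => E y →L[ℝ] Bundle.Trivial M ℝ y) (x₀ : M)).open_baseSet.mem_nhds
      (FiberBundle.mem_baseSet_trivializationAt' _))

variable {Fib E} in
lemma IsSmoothDual.add {U : Opens M} {η ζ : ∀ x : U, E x →L[ℝ] ℝ}
    (hη : IsSmoothDual m Fib E U η) (hζ : IsSmoothDual m Fib E U ζ) :
    IsSmoothDual m Fib E U (η + ζ) := by
  rw [isSmoothDual_iff] at *
  intro x₀
  refine ((hη x₀).add (hζ x₀)).congr_of_eventuallyEq ?_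
  filter_upwards [eventually_mem_baseSet (Fib := Fib) (E := E) x₀] with x hx
  exact ((trivializationAt_linear (x₀ : M)).linear x hx).1 (η x) (ζ x)

variable {Fib E} in
lemma IsSmoothDual.fsmul {U : Opens M} {η : ∀ x : U, E x →L[ℝ] ℝ}
    (f : SmoothFun m U) (hη : IsSmoothDual m Fib E U η) :
    IsSmoothDual m Fib E U (fun x => f x • η x) := by
  rw [isSmoothDual_iff] at *
  intro x₀
  refine ((f.contMDiff x₀).smul (hη x₀)).congr_of_eventuallyEq ?_
  filter_upwards [eventually_mem_baseSet (Fib := Fib) (E := E) x₀] with x hx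
  exact ((trivializationAt_linear (x₀ : M)).linear x hx).2 (f x) (η x)

variable {Fib E} in
lemma IsSmoothDual.zero {U : Opens M} : IsSmoothDual m Fib E U 0 := by
  rw [isSmoothDual_iff]
  intro x₀
  refine (contMDiffAt_const (c := (0 : Fib →L[ℝ] ℝ))).congr_of_eventuallyEq ?_
  filter_upwards [eventually_mem_baseSet (Fib := Fib) (E := E) x₀] with x hx
  exact ((trivializationAt_linear (Fib := Fib) (E := E) (x₀ : M)).linear x hx).map_zero

variable (m) in
/-- The space `Γ(U, E^*)` of smooth sections over `U` of the dual bundle. -/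
def DualSec (U : Opens M) : Submodule ℝ (∀ x : U, E x →L[ℝ] ℝ) where
  carrier := {η | IsSmoothDual m Fib E U η}
  add_mem' hη hζ := hη.add hζ
  zero_mem' := IsSmoothDual.zero
  smul_mem' c _ hη := hη.fsmul (ContMDiffMap.const c)

variable {Fib E} in
/-- Multiplication of a section by a smooth function. -/
def DualSec.fsmul {U : Opens M} (f : SmoothFun m U) (η : DualSec m Fib E U) :
    DualSec m Fib E U :=
  ⟨fun x => f x • η.1 x, IsSmoothDual.fsmul f η.2⟩

variable {Fib E} in
/-- Restriction of sections. -/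
def DualSec.res {U V : Opens M} (h : V ≤ U) (η : DualSec m Fib E U) : DualSec m Fib E V :=
  ⟨fun x => η.1 ⟨x, h x.2⟩, ContMDiff.comp η.2 (contMDiff_inclusion h)⟩

variable {E} in
lemma continuous_of_fiber [FiniteDimensional ℝ Fib] (x : M) (φ : E x →ₗ[ℝ] ℝ) :
    Continuous φ := by
  have hx := FiberBundle.mem_baseSet_trivializationAt Fib E x
  let e := (trivializationAt Fib E x).continuousLinearEquivAt ℝ x hx
  have h : Continuous (φ ∘ₗ e.symm.toLinearEquiv.toLinearMap) :=
    LinearMap.continuous_of_finiteDimensional _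
  have h2 := h.comp e.continuous
  refine h2.congr fun v => ?_
  simp

end Sections

/-! ### Coalgebra bundles and the sheaf of functions of the associated graded manifold -/

section Bundles

variable {m n : ℕ} {M : Type*} [TopologicalSpace M] [ChartedSpace (EuclideanSpace ℝ (Fin m)) M]
  {Fib : Fin n → Type*} [∀ i, NormedAddCommGroup (Fib i)] [∀ i, NormedSpace ℝ (Fib i)]
  [∀ i, FiniteDimensional ℝ (Fib i)]
  {E : Fin n → M → Type*} [∀ i, TopologicalSpace (TotalSpace (Fib i) (E i))]
  [∀ i x, AddCommGroup (E i x)] [∀ i x, Module ℝ (E i x)] [∀ i x, TopologicalSpace (E i x)]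
  [∀ i, FiberBundle (Fib i) (E i)] [∀ i, VectorBundle ℝ (Fib i) (E i)]

variable (Fib) in
/-- The pointwise dual product: `(η, ζ) ↦ (η ⊗ ζ) ∘ μ`, restricted to the component `E l` at `x`. -/
def dualMul (μ : ∀ x : M, (∀ i, E i x) →ₗ[ℝ] (∀ i, E i x) ⊗[ℝ] (∀ i, E i x))
    (x : M) {i j : Fin n} (l : Fin n) (η : E i x →L[ℝ] ℝ) (ζ : E j x →L[ℝ] ℝ) :
    E l x →L[ℝ] ℝ :=
  let φ : E l x →ₗ[ℝ] ℝ :=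
    (TensorProduct.lid ℝ ℝ).toLinearMap ∘ₗ
      TensorProduct.map (η.toLinearMap ∘ₗ LinearMap.proj i) (ζ.toLinearMap ∘ₗ LinearMap.proj j) ∘ₗ
        μ x ∘ₗ incl (fun i => E i x) l
  ⟨φ, continuous_of_fiber (Fib := Fib l) x φ⟩

variable (m Fib E) in
/-- An `n`-coalgebra bundle structure on the graded vector bundle `⊕ E i` (with `E i` in degree
`-(i + 1)`): a smooth bundle map `μ : E → E ⊗ E` over the identity which is fibrewise a degree
preserving, coassociative and graded cocommutative comultiplication.  Smoothness of `μ` is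
expressed by saying that the dual product `μ^*` of smooth local sections is smooth. -/
structure CoalgebraBundle where
  comul : ∀ x : M, (∀ i, E i x) →ₗ[ℝ] (∀ i, E i x) ⊗[ℝ] (∀ i, E i x)
  isCoalgebra : ∀ x, IsGradedCoalgebra (comul x)
  smooth : ∀ (U : Opens M) (i j l : Fin n), deg i + deg j = deg l →
    ∀ (η : DualSec m (Fib i) (E i) U) (ζ : DualSec m (Fib j) (E j) U),
      IsSmoothDual m (Fib l) (E l) U (fun x => dualMul Fib comul x l (η.1 x) (ζ.1 x))

namespace CoalgebraBundle

variable (μ : CoalgebraBundle m Fib E)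

/-- Admissibility: `im μ_{-i} = K^μ_{-i}` in every fibre, for `i = 2, …, n`. -/
def IsAdmissible : Prop := ∀ x, IsAdmissibleComul (μ.comul x)

/-- The dual product `μ^* : Γ(U, E_{-i}^*) × Γ(U, E_{-j}^*) → Γ(U, E_{-(i+j)}^*)`. -/
def mul {U : Opens M} {i j l : Fin n} (h : deg i + deg j = deg l)
    (η : DualSec m (Fib i) (E i) U) (ζ : DualSec m (Fib j) (E j) U) :
    DualSec m (Fib l) (E l) U :=
  ⟨fun x => dualMul Fib μ.comul x l (η.1 x) (ζ.1 x), μ.smooth U i j l h η ζ⟩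

/-- Generators of the algebra of functions over `U`: smooth functions and smooth sections of the
bundles `E_{-i}^*`. -/
inductive Gen (_ : CoalgebraBundle m Fib E) (U : Opens M)
  | fn (f : SmoothFun m U)
  | sec (i : Fin n) (η : DualSec m (Fib i) (E i) U)

/-- The degree of a generator. -/
def Gen.degree {μ : CoalgebraBundle m Fib E} {U : Opens M} : μ.Gen U → ℕ
  | .fn _ => 0
  | .sec i _ => deg i

open FreeAlgebra in
/-- The relations presenting the graded symmetric algebra of the graded `C^∞(U)`-module
`Γ(U, E^*) = ⊕ Γ(U, E_{-i}^*)`. -/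
inductive SymRel (U : Opens M) : FreeAlgebra ℝ (μ.Gen U) → FreeAlgebra ℝ (μ.Gen U) → Prop
  | fn_add (f g : SmoothFun m U) :
      SymRel U (ι ℝ (.fn (f + g))) (ι ℝ (.fn f) + ι ℝ (.fn g))
  | fn_mul (f g : SmoothFun m U) :
      SymRel U (ι ℝ (.fn (f * g))) (ι ℝ (.fn f) * ι ℝ (.fn g))
  | fn_const (c : ℝ) :
      SymRel U (ι ℝ (.fn (algebraMap ℝ (SmoothFun m U) c))) (algebraMap ℝ _ c)
  | sec_add (i : Fin n) (η ζ : DualSec m (Fib i) (E i) U) :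
      SymRel U (ι ℝ (.sec i (η + ζ))) (ι ℝ (.sec i η) + ι ℝ (.sec i ζ))
  | sec_fsmul (i : Fin n) (f : SmoothFun m U) (η : DualSec m (Fib i) (E i) U) :
      SymRel U (ι ℝ (.sec i (DualSec.fsmul f η))) (ι ℝ (.fn f) * ι ℝ (.sec i η))
  | comm (a b : μ.Gen U) :
      SymRel U (ι ℝ a * ι ℝ b) ((-1 : ℝ) ^ (a.degree * b.degree) • (ι ℝ b * ι ℝ a))

open FreeAlgebra in
/-- The relations of the graded symmetric algebra together with the generators
`η ζ - μ^*(η, ζ)`, for `|η| + |ζ| ≤ n`, of the ideal `I_μ(U)`. -/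
inductive FunRel (U : Opens M) : FreeAlgebra ℝ (μ.Gen U) → FreeAlgebra ℝ (μ.Gen U) → Prop
  | sym {a b : FreeAlgebra ℝ (μ.Gen U)} (h : μ.SymRel U a b) : FunRel U a b
  | mul {i j l : Fin n} (h : deg i + deg j = deg l)
      (η : DualSec m (Fib i) (E i) U) (ζ : DualSec m (Fib j) (E j) U) :
      FunRel U (ι ℝ (.sec i η) * ι ℝ (.sec j ζ)) (ι ℝ (.sec l (μ.mul h η ζ)))

/-- The algebra `Sym_{C^∞(U)} Γ(U, E^*) / I_μ(U)`. -/
def PreFun (U : Opens M) : Type _ := RingQuot (μ.FunRel U)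

instance (U : Opens M) : Ring (μ.PreFun U) := inferInstanceAs (Ring (RingQuot (μ.FunRel U)))

instance (U : Opens M) : Algebra ℝ (μ.PreFun U) :=
  inferInstanceAs (Algebra ℝ (RingQuot (μ.FunRel U)))

/-- The class of a generator in `PreFun U`. -/
def gen {U : Opens M} (a : μ.Gen U) : μ.PreFun U :=
  RingQuot.mkAlgHom ℝ (μ.FunRel U) (FreeAlgebra.ι ℝ a)

/-- The universal property of `PreFun U`. -/
def PreFun.lift {U : Opens M} {A : Type*} [Ring A] [Algebra ℝ A] (φ : μ.Gen U → A)
    (h : ∀ a b, μ.FunRel U a b → FreeAlgebra.lift ℝ φ a = FreeAlgebra.lift ℝ φ b) :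
    μ.PreFun U →ₐ[ℝ] A :=
  RingQuot.liftAlgHom ℝ ⟨FreeAlgebra.lift ℝ φ, fun a b hab => h a b hab⟩

lemma PreFun.lift_gen {U : Opens M} {A : Type*} [Ring A] [Algebra ℝ A] (φ : μ.Gen U → A)
    (h : ∀ a b, μ.FunRel U a b → FreeAlgebra.lift ℝ φ a = FreeAlgebra.lift ℝ φ b)
    (a : μ.Gen U) : PreFun.lift μ φ h (μ.gen a) = φ a := by
  unfold PreFun.lift gen
  exact (RingQuot.liftAlgHom_mkAlgHom_apply ℝ _ _ _).trans (FreeAlgebra.lift_ι_apply _ _)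

lemma PreFun.hom_ext {U : Opens M} {A : Type*} [Ring A] [Algebra ℝ A]
    {φ ψ : μ.PreFun U →ₐ[ℝ] A} (h : ∀ a, φ (μ.gen a) = ψ (μ.gen a)) : φ = ψ := by
  refine RingQuot.ringQuot_ext' ℝ _ _ (FreeAlgebra.hom_ext (funext fun a => h a))

lemma gen_rel {U : Opens M} {a b : FreeAlgebra ℝ (μ.Gen U)} (h : μ.FunRel U a b) :
    FreeAlgebra.lift ℝ μ.gen a = FreeAlgebra.lift ℝ μ.gen b := by
  have key : FreeAlgebra.lift ℝ μ.gen = RingQuot.mkAlgHom ℝ (μ.FunRel U) :=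
    FreeAlgebra.hom_ext (funext fun a => FreeAlgebra.lift_ι_apply _ _)
  rw [key]
  exact RingQuot.mkAlgHom_rel ℝ h

/-- Restriction of generators. -/
def Gen.res {μ : CoalgebraBundle m Fib E} {U V : Opens M} (h : V ≤ U) : μ.Gen U → μ.Gen V
  | .fn f => .fn (f.res h)
  | .sec i η => .sec i (DualSec.res h η)

lemma Gen.degree_res {μ : CoalgebraBundle m Fib E} {U V : Opens M} (h : V ≤ U) (a : μ.Gen U) :
    (a.res h).degree = a.degree := by
  cases a <;> rfl

/-- Restriction maps of the presheaf `PreFun`. -/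
def PreFun.res {U V : Opens M} (h : V ≤ U) : μ.PreFun U →ₐ[ℝ] μ.PreFun V :=
  PreFun.lift μ (fun a => μ.gen (a.res h)) (by
    intro a b hab
    have key : ∀ {c d : FreeAlgebra ℝ (μ.Gen V)}, μ.FunRel V c d →
        FreeAlgebra.lift ℝ μ.gen c = FreeAlgebra.lift ℝ μ.gen d := fun h => μ.gen_rel h
    cases hab with
    | sym hab =>
      cases hab with
      | fn_add f g => simpa using! key (.sym (.fn_add (f.res h) (g.res h)))
      | fn_mul f g => simpa using! key (.sym (.fn_mul (f.res h) (g.res h)))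
      | fn_const c => simpa using! key (.sym (.fn_const c))
      | sec_add i η ζ => simpa using! key (.sym (.sec_add i (DualSec.res h η) (DualSec.res h ζ)))
      | sec_fsmul i f η => simpa using! key (.sym (.sec_fsmul i (f.res h) (DualSec.res h η)))
      | comm a b =>
        have := key (.sym (.comm (a.res h) (b.res h)))
        simp only [Gen.degree_res] at this
        simpa using! this
    | mul hd η ζ => simpa using! key (.mul hd (DualSec.res h η) (DualSec.res h ζ)))

lemma PreFun.res_gen {U V : Opens M} (h : V ≤ U) (a : μ.Gen U) :
    PreFun.res μ h (μ.gen a) = μ.gen (a.res h) :=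
  PreFun.lift_gen μ _ _ a

lemma PreFun.res_self {U : Opens M} (h : U ≤ U) (a : μ.PreFun U) : PreFun.res μ h a = a := by
  have : PreFun.res μ h = AlgHom.id ℝ _ := by
    refine PreFun.hom_ext μ fun a => ?_
    rw [PreFun.res_gen]
    cases a <;> rfl
  rw [this]; rfl

lemma PreFun.res_res {U V W : Opens M} (h : V ≤ U) (h' : W ≤ V) (a : μ.PreFun U) :
    PreFun.res μ h' (PreFun.res μ h a) = PreFun.res μ (h'.trans h) a := by
  have : (PreFun.res μ h').comp (PreFun.res μ h) = PreFun.res μ (h'.trans h) := by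
    refine PreFun.hom_ext μ fun a => ?_
    rw [AlgHom.comp_apply, PreFun.res_gen, PreFun.res_gen, PreFun.res_gen]
    cases a <;> rfl
  rw [← this]; rfl

/-- The homogeneous elements of degree `k` of `PreFun U`: linear combinations of products of
generators of total degree `k`.  (Zero if `k < 0`.) -/
def PreFun.homog (U : Opens M) (k : ℤ) : Submodule ℝ (μ.PreFun U) :=
  Submodule.span ℝ {p | ∃ L : List (μ.Gen U),
    ((L.map Gen.degree).sum : ℕ) = k ∧ p = (L.map μ.gen).prod}

/-- The value at `x` of the degree zero component, on `PreFun U`. -/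
def PreFun.eval {U : Opens M} {x : M} (hx : x ∈ U) : μ.PreFun U →ₐ[ℝ] ℝ :=
  PreFun.lift μ (fun a => match a with
    | .fn f => f ⟨x, hx⟩
    | .sec _ _ => 0) (by
    intro a b hab
    cases hab with
    | sym hab =>
      cases hab with
      | fn_add f g => simp
      | fn_mul f g => simp
      | fn_const c => simp; rfl
      | sec_add i η ζ => simp
      | sec_fsmul i f η => simp
      | comm a b => cases a <;> cases b <;> simp [Gen.degree, mul_comm]
    | mul hd η ζ => simp)

lemma PreFun.eval_res {U V : Opens M} (h : V ≤ U) {x : M} (hx : x ∈ V) (a : μ.PreFun U) :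
    PreFun.eval μ hx (PreFun.res μ h a) = PreFun.eval μ (h hx) a := by
  have : (PreFun.eval μ hx).comp (PreFun.res μ h) = PreFun.eval μ (h hx) := by
    refine PreFun.hom_ext μ fun a => ?_
    rw [AlgHom.comp_apply, PreFun.res_gen]
    unfold PreFun.eval
    rw [PreFun.lift_gen, PreFun.lift_gen]
    cases a <;> rfl
  rw [← this]; rfl

/-! The sheaf of functions is the sheaf associated with the presheaf `PreFun`. -/

instance (x : M) : IsDirectedOrder (OpenNhdsOf x)ᵒᵈ :=
  ⟨fun a b => ⟨OrderDual.toDual (OrderDual.ofDual a ⊓ OrderDual.ofDual b),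
    (inf_le_left : OrderDual.ofDual a ⊓ OrderDual.ofDual b ≤ OrderDual.ofDual a),
    (inf_le_right : OrderDual.ofDual a ⊓ OrderDual.ofDual b ≤ OrderDual.ofDual b)⟩⟩

instance (x : M) : Nonempty (OpenNhdsOf x)ᵒᵈ := ⟨OrderDual.toDual ⊤⟩

/-- The restriction maps between the algebras `PreFun` of the neighbourhoods of a point. -/
def nhdsRes (x : M) (U V : (OpenNhdsOf x)ᵒᵈ) (h : U ≤ V) :
    μ.PreFun (OrderDual.ofDual U).toOpens →ₐ[ℝ] μ.PreFun (OrderDual.ofDual V).toOpens :=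
  PreFun.res μ (show (OrderDual.ofDual V).toOpens ≤ (OrderDual.ofDual U).toOpens from h)

instance (x : M) : DirectedSystem
    (fun U : (OpenNhdsOf x)ᵒᵈ => μ.PreFun (OrderDual.ofDual U).toOpens)
    (fun U V h => μ.nhdsRes x U V h) where
  map_self _ a := PreFun.res_self μ _ a
  map_map _ _ _ _ _ a := PreFun.res_res μ _ _ a

/-- The stalk at `x` of the presheaf `PreFun`. -/
def Stalk (x : M) : Type _ :=
  DirectLimit (fun U : (OpenNhdsOf x)ᵒᵈ => μ.PreFun (OrderDual.ofDual U).toOpens) (μ.nhdsRes x)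

instance (x : M) : Ring (μ.Stalk x) := inferInstanceAs (Ring (DirectLimit
  (fun U : (OpenNhdsOf x)ᵒᵈ => μ.PreFun (OrderDual.ofDual U).toOpens) (μ.nhdsRes x)))

instance (x : M) : Algebra ℝ (μ.Stalk x) := inferInstanceAs (Algebra ℝ (DirectLimit
  (fun U : (OpenNhdsOf x)ᵒᵈ => μ.PreFun (OrderDual.ofDual U).toOpens) (μ.nhdsRes x)))

/-- The germ at `x`. -/
def germ {U : Opens M} {x : M} (hx : x ∈ U) : μ.PreFun U →ₐ[ℝ] μ.Stalk x :=
  DirectLimit.Algebra.of _ (μ.nhdsRes x) (OrderDual.toDual (⟨U, hx⟩ : OpenNhdsOf x))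

lemma germ_res {U V : Opens M} (h : V ≤ U) {x : M} (hx : x ∈ V) (a : μ.PreFun U) :
    μ.germ hx (PreFun.res μ h a) = μ.germ (h hx) a :=
  DirectLimit.Algebra.of_f (f := μ.nhdsRes x)
    (i := OrderDual.toDual (⟨U, h hx⟩ : OpenNhdsOf x))
    (j := OrderDual.toDual (⟨V, hx⟩ : OpenNhdsOf x)) h a

/-- The value at `x` of the degree zero component, on the stalk at `x`. -/
def Stalk.eval (x : M) : μ.Stalk x →ₐ[ℝ] ℝ :=
  DirectLimit.Algebra.lift _ (μ.nhdsRes x) ℝ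
    (fun U => PreFun.eval μ (OrderDual.ofDual U).mem)
    (fun _ _ h a => PreFun.eval_res μ h _ a)

/-- The homogeneous elements of degree `k` of the stalk at `x`. -/
def Stalk.homog (x : M) (k : ℤ) : Submodule ℝ (μ.Stalk x) :=
  ⨆ (U : Opens M) (hx : x ∈ U), (PreFun.homog μ U k).map (μ.germ hx).toLinearMap

/-- The sections over `U` of the structure sheaf `C_𝓜` of the graded manifold `𝓜 = 𝓕(E, μ)`:
families of germs which are locally given by elements of `Sym_{C^∞} Γ_{E^*} / I_μ`. -/
def funSubalgebra (U : Opens M) : Subalgebra ℝ (∀ x : U, μ.Stalk (x : M)) where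
  carrier := {s | ∀ x : U, ∃ (V : Opens M) (h : V ≤ U) (a : μ.PreFun V), (x : M) ∈ V ∧
    ∀ (y : M) (hy : y ∈ V), s ⟨y, h hy⟩ = μ.germ hy a}
  mul_mem' := by
    intro s t hs ht x
    obtain ⟨V, hV, a, hxV, ha⟩ := hs x
    obtain ⟨W, hW, b, hxW, hb⟩ := ht x
    refine ⟨V ⊓ W, inf_le_left.trans hV,
      PreFun.res μ inf_le_left a * PreFun.res μ inf_le_right b, ⟨hxV, hxW⟩, fun y hy => ?_⟩
    rw [map_mul, germ_res, germ_res, ← ha y hy.1, ← hb y hy.2]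
    rfl
  add_mem' := by
    intro s t hs ht x
    obtain ⟨V, hV, a, hxV, ha⟩ := hs x
    obtain ⟨W, hW, b, hxW, hb⟩ := ht x
    refine ⟨V ⊓ W, inf_le_left.trans hV,
      PreFun.res μ inf_le_left a + PreFun.res μ inf_le_right b, ⟨hxV, hxW⟩, fun y hy => ?_⟩
    rw [map_add, germ_res, germ_res, ← ha y hy.1, ← hb y hy.2]
    rfl
  algebraMap_mem' c x :=
    ⟨U, le_rfl, algebraMap ℝ _ c, x.2, fun y hy => ((μ.germ hy).commutes c).symm⟩

/-- The algebra `C_𝓜(U)` of functions over `U` on the graded manifold. -/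
def Fun (U : Opens M) : Type _ := μ.funSubalgebra U

instance (U : Opens M) : Ring (μ.Fun U) := inferInstanceAs (Ring (μ.funSubalgebra U))

instance (U : Opens M) : Algebra ℝ (μ.Fun U) :=
  inferInstanceAs (Algebra ℝ (μ.funSubalgebra U))

/-- Restriction maps of the structure sheaf. -/
def Fun.res {U V : Opens M} (h : V ≤ U) (s : μ.Fun U) : μ.Fun V :=
  ⟨fun x => s.1 ⟨x, h x.2⟩, fun x => by
    obtain ⟨W, hW, a, hxW, ha⟩ := s.2 ⟨x, h x.2⟩
    refine ⟨W ⊓ V, inf_le_right, PreFun.res μ inf_le_left a, ⟨hxW, x.2⟩, fun y hy => ?_⟩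
    rw [germ_res, ← ha y hy.1]⟩

/-- The section of the structure sheaf defined by an element of `PreFun U`. -/
def toFun {U : Opens M} (a : μ.PreFun U) : μ.Fun U :=
  ⟨fun x => μ.germ x.2 a, fun x => ⟨U, le_rfl, a, x.2, fun _ _ => rfl⟩⟩

/-- A smooth function, regarded as a function of degree `0` on the graded manifold. -/
def ofFn {U : Opens M} (f : SmoothFun m U) : μ.Fun U := μ.toFun (μ.gen (.fn f))

/-- A section of `E_{-i}^*`, regarded as a function of degree `i` on the graded manifold. -/
def ofSec {U : Opens M} (i : Fin n) (η : DualSec m (Fib i) (E i) U) : μ.Fun U :=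
  μ.toFun (μ.gen (.sec i η))

/-- The homogeneous functions of degree `k` over `U`. -/
def homog (U : Opens M) (k : ℤ) : Submodule ℝ (μ.Fun U) where
  carrier := {s | ∀ x : U, s.1 x ∈ Stalk.homog μ (x : M) k}
  add_mem' hs ht x := add_mem (hs x) (ht x)
  zero_mem' _ := zero_mem _
  smul_mem' c _ hs x := Submodule.smul_mem _ c (hs x)

/-- The value `f^0(x)` at `x` of the degree zero component of a function `f`. -/
def bodyVal {U : Opens M} (x : U) : μ.Fun U →ₗ[ℝ] ℝ :=
  (Stalk.eval μ (x : M)).toLinearMap ∘ₗ LinearMap.proj x ∘ₗ (μ.funSubalgebra U).val.toLinearMap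

/-! ### Vector fields and distributions -/

/-- The sign `(-1) ^ k`. -/
def _root_.NMan.sgn (k : ℤ) : ℝ := (-1 : ℝ) ^ k

/-- Vector fields of degree `k` over `U`: graded derivations of degree `k` of `C_𝓜(U)`. -/
def vectorFields (U : Opens M) (k : ℤ) : Submodule ℝ (Module.End ℝ (μ.Fun U)) where
  carrier := {X | (∀ l : ℤ, ∀ f ∈ μ.homog U l, X f ∈ μ.homog U (l + k)) ∧
    ∀ l : ℤ, ∀ f ∈ μ.homog U l, ∀ g : μ.Fun U,
      X (f * g) = X f * g + sgn (l * k) • (f * X g)}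
  add_mem' := by
    rintro X Y ⟨hX, hX'⟩ ⟨hY, hY'⟩
    refine ⟨fun l f hf => add_mem (hX l f hf) (hY l f hf), fun l f hf g => ?_⟩
    simp only [LinearMap.add_apply, hX' l f hf g, hY' l f hf g, add_mul, mul_add, smul_add]
    abel
  zero_mem' := ⟨fun l f _ => zero_mem _, fun l f _ g => by simp⟩
  smul_mem' := by
    rintro c X ⟨hX, hX'⟩
    refine ⟨fun l f hf => Submodule.smul_mem _ c (hX l f hf), fun l f hf g => ?_⟩
    simp only [LinearMap.smul_apply, hX' l f hf g, smul_add, smul_mul_assoc, mul_smul_comm]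
    rw [smul_comm c]

/-- The module structure: `(f X)(g) = f X(g)`. -/
def fmul {U : Opens M} (f : μ.Fun U) (X : Module.End ℝ (μ.Fun U)) : Module.End ℝ (μ.Fun U) :=
  LinearMap.mulLeft ℝ f ∘ₗ X

/-- The graded commutator of operators of degrees `k` and `l`. -/
def gradedBracket {U : Opens M} (k l : ℤ) (X Y : Module.End ℝ (μ.Fun U)) :
    Module.End ℝ (μ.Fun U) :=
  X ∘ₗ Y - sgn (k * l) • (Y ∘ₗ X)

/-- `Y` is the restriction to `V` of the operator `X` over `U`. -/
def IsRestriction {U V : Opens M} (h : V ≤ U) (X : Module.End ℝ (μ.Fun U))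
    (Y : Module.End ℝ (μ.Fun V)) : Prop :=
  ∀ f : μ.Fun U, Y (Fun.res μ h f) = Fun.res μ h (X f)

/-- The tangent vector `X_x : f ↦ X(f)^0(x)` of a vector field `X` at `x`. -/
def tangentVector {U : Opens M} (X : Module.End ℝ (μ.Fun U)) (x : U) : μ.Fun U →ₗ[ℝ] ℝ :=
  μ.bodyVal x ∘ₗ X

/-- A graded subsheaf of `C_𝓜`-modules of the sheaf of vector fields, given by its homogeneous
components `carrier U k` of degree `k ∈ ℤ`. -/
@[ext]
structure GradedSubsheaf where
  carrier : (U : Opens M) → ℤ → Submodule ℝ (Module.End ℝ (μ.Fun U))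
  le : ∀ U k, carrier U k ≤ μ.vectorFields U k
  fmul_mem : ∀ (U : Opens M) (l k : ℤ), ∀ f ∈ μ.homog U l, ∀ X ∈ carrier U k,
    μ.fmul f X ∈ carrier U (l + k)
  res_mem : ∀ (U V : Opens M) (h : V ≤ U) (k : ℤ), ∀ X ∈ carrier U k,
    ∀ Y ∈ μ.vectorFields V k, μ.IsRestriction h X Y → Y ∈ carrier V k
  glue_mem : ∀ (U : Opens M) (k : ℤ), ∀ X ∈ μ.vectorFields U k,
    (∀ x ∈ U, ∃ (V : Opens M) (h : V ≤ U), x ∈ V ∧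
      ∃ Y ∈ carrier V k, μ.IsRestriction h X Y) → X ∈ carrier U k

variable {μ} in
/-- The graded subsheaf is a distribution of rank `d 0 | d 1 | ⋯ | d n`: every point has an open
neighbourhood over which it is generated by vector fields `X ⟨k, a⟩` of degree `-k`, for
`k = 0, …, n` and `a = 1, …, d k`, whose tangent vectors are linearly independent at each point. -/
def GradedSubsheaf.HasRank (D : μ.GradedSubsheaf) (d : Fin (n + 1) → ℕ) : Prop :=
  ∀ x : M, ∃ U : Opens M, x ∈ U ∧
    ∃ X : (Σ k : Fin (n + 1), Fin (d k)) → Module.End ℝ (μ.Fun U),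
      (∀ p, X p ∈ μ.vectorFields U (-(p.1 : ℕ))) ∧
      (∀ y : U, LinearIndependent ℝ (fun p => μ.tangentVector (X p) y)) ∧
      ∀ (k : ℤ) (Y : Module.End ℝ (μ.Fun U)), Y ∈ D.carrier U k ↔
        ∃ f : (Σ k : Fin (n + 1), Fin (d k)) → μ.Fun U,
          (∀ p, f p ∈ μ.homog U (k + (p.1 : ℕ))) ∧ Y = ∑ p, μ.fmul (f p) (X p)

variable {μ} in
/-- Involutivity: closedness under the graded Lie bracket of vector fields. -/
def GradedSubsheaf.IsInvolutive (D : μ.GradedSubsheaf) : Prop :=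
  ∀ (U : Opens M) (k l : ℤ), ∀ X ∈ D.carrier U k, ∀ Y ∈ D.carrier U l,
    μ.gradedBracket k l X Y ∈ D.carrier U (k + l)

/-- Involutive distributions of rank `d 0 | d 1 | ⋯ | d n` on the graded manifold. -/
def InvolutiveDistribution (d : Fin (n + 1) → ℕ) : Type _ :=
  {D : μ.GradedSubsheaf // D.HasRank d ∧ D.IsInvolutive}

end CoalgebraBundle

end Bundles

/-! ### Involutive subbundles of the tangent bundle and partial connections -/

section Connections

variable {m : ℕ} {M : Type*} [TopologicalSpace M] [ChartedSpace (EuclideanSpace ℝ (Fin m)) M]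
  [IsManifold (𝓡 m) ∞ M]

variable (m M) in
/-- A smooth subbundle of rank `d` of the tangent bundle of `M`. -/
@[ext]
structure TangentSubbundle (d : ℕ) where
  fiber : ∀ x : M, Submodule ℝ (TangentSpace (𝓡 m) x)
  exists_frame : ∀ x : M, ∃ U : Opens M, x ∈ U ∧
    ∃ Z : Fin d → ∀ y : M, TangentSpace (𝓡 m) y,
      (∀ a, ContMDiffOn (𝓡 m) ((𝓡 m).prod 𝓘(ℝ, EuclideanSpace ℝ (Fin m))) ∞
        (fun y => (⟨y, Z a y⟩ : TangentBundle (𝓡 m) M)) U) ∧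
      ∀ y ∈ U, LinearIndependent ℝ (fun a => Z a y) ∧
        Submodule.span ℝ (Set.range fun a => Z a y) = fiber y

namespace TangentSubbundle

variable {d : ℕ} (S : TangentSubbundle m M d)

/-- Global smooth vector fields tangent to the subbundle. -/
def sections : Submodule ℝ (∀ x : M, TangentSpace (𝓡 m) x) where
  carrier := {X | ContMDiff (𝓡 m) ((𝓡 m).prod 𝓘(ℝ, EuclideanSpace ℝ (Fin m))) ∞
      (fun y => (⟨y, X y⟩ : TangentBundle (𝓡 m) M)) ∧ ∀ x, X x ∈ S.fiber x}
  add_mem' hX hY := ⟨hX.1.add_section hY.1, fun x => add_mem (hX.2 x) (hY.2 x)⟩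
  zero_mem' := ⟨contMDiff_zeroSection ℝ (TangentSpace (𝓡 m) : M → Type _), fun _ => zero_mem _⟩
  smul_mem' c _ hX := ⟨hX.1.const_smul_section (a := c), fun x => Submodule.smul_mem _ c (hX.2 x)⟩

/-- The value at a point of a smooth function on `M`. -/
def _root_.NMan.SmoothFun.val (f : SmoothFun m (⊤ : Opens M)) (x : M) : ℝ := f ⟨x, Opens.mem_top x⟩

lemma _root_.NMan.SmoothFun.contMDiff_val (f : SmoothFun m (⊤ : Opens M)) :
    ContMDiff (𝓡 m) 𝓘(ℝ, ℝ) ∞ f.val := by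
  have h : ContMDiff (𝓡 m) (𝓡 m) ∞ (fun x : M => (⟨x, Opens.mem_top x⟩ : (⊤ : Opens M))) :=
    (ContMDiff.subtypeVal_comp_iff _ _).mp contMDiff_id
  exact f.contMDiff.comp h

/-- The derivative `X(f)` of a smooth function along a section of the subbundle. -/
def lieDeriv (X : S.sections) (f : SmoothFun m (⊤ : Opens M)) : SmoothFun m (⊤ : Opens M) :=
  ⟨fun x => mfderiv (𝓡 m) 𝓘(ℝ, ℝ) f.val (x : M) (X.1 x), by
    have h1 := f.contMDiff_val.contMDiff_tangentMap (m := ∞) (by simp)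
    have h2 := h1.comp X.2.1
    have h3 : ContMDiff (𝓡 m) 𝓘(ℝ, ℝ) ∞
        (fun x : M => (mfderiv (𝓡 m) 𝓘(ℝ, ℝ) f.val x (X.1 x) : ℝ)) :=
      (contMDiff_snd_tangentBundle_modelSpace ℝ 𝓘(ℝ, ℝ)).comp h2
    exact h3.comp contMDiff_subtype_val⟩

/-- Multiplication of a section of the subbundle by a smooth function. -/
def fsmul (f : SmoothFun m (⊤ : Opens M)) (X : S.sections) : S.sections :=
  ⟨fun x => f.val x • X.1 x, f.contMDiff_val.smul_section X.2.1,
    fun x => Submodule.smul_mem _ _ (X.2.2 x)⟩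

/-- Involutivity: closedness under the Lie bracket of vector fields. -/
def IsInvolutive : Prop :=
  ∀ X Y : S.sections, ∀ x : M, VectorField.mlieBracket (𝓡 m) X.1 Y.1 x ∈ S.fiber x

variable {S} in
/-- The Lie bracket of two sections of an involutive subbundle. -/
def IsInvolutive.bracket (h : S.IsInvolutive) (X Y : S.sections) : S.sections :=
  ⟨VectorField.mlieBracket (𝓡 m) X.1 Y.1, by
    refine ⟨fun x => ?_, h X Y⟩
    have : IsManifold (𝓡 m) ((∞ : ℕ∞ω) + 1) M := by simpa using ‹IsManifold (𝓡 m) ∞ M›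
    have : IsManifold (𝓡 m) (minSmoothness ℝ 2) M := by
      rw [minSmoothness_of_isRCLikeNormedField]
      exact IsManifold.of_le (n := ∞) ENat.LEInfty.out
    exact ContMDiffAt.mlieBracket_vectorField (m := ⊤) (n := ⊤) (X.2.1 x) (Y.2.1 x) (by simp)⟩

end TangentSubbundle

variable {d : ℕ} (S : TangentSubbundle m M d)
  (Fib : Type*) [NormedAddCommGroup Fib] [NormedSpace ℝ Fib]
  (E : M → Type*) [TopologicalSpace (TotalSpace Fib E)]
  [∀ x, AddCommGroup (E x)] [∀ x, Module ℝ (E x)] [∀ x, TopologicalSpace (E x)]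
  [FiberBundle Fib E] [VectorBundle ℝ Fib E]

/-- An `S`-connection on the dual `E^*` of the vector bundle `E`, for a subbundle `S ⊆ TM`. -/
@[ext]
structure PartialConnection where
  nabla : S.sections → DualSec m Fib E (⊤ : Opens M) → DualSec m Fib E (⊤ : Opens M)
  add_left : ∀ X Y η, nabla (X + Y) η = nabla X η + nabla Y η
  fsmul_left : ∀ f X η, nabla (S.fsmul f X) η = DualSec.fsmul f (nabla X η)
  add_right : ∀ X η ζ, nabla X (η + ζ) = nabla X η + nabla X ζ
  leibniz : ∀ X f η, nabla X (DualSec.fsmul f η) =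
    DualSec.fsmul f (nabla X η) + DualSec.fsmul (S.lieDeriv X f) η

variable {S Fib E} in
/-- Flatness of an `S`-connection, for `S` involutive:
`∇_X ∇_Y - ∇_Y ∇_X = ∇_{[X, Y]}`. -/
def PartialConnection.IsFlat (D : PartialConnection S Fib E) (hS : S.IsInvolutive) : Prop :=
  ∀ X Y η, D.nabla X (D.nabla Y η) - D.nabla Y (D.nabla X η) = D.nabla (hS.bracket X Y) η

end Connections

section Data

variable {m n : ℕ} {M : Type*} [TopologicalSpace M] [ChartedSpace (EuclideanSpace ℝ (Fin m)) M]
  [IsManifold (𝓡 m) ∞ M]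
  {Fib : Fin n → Type*} [∀ i, NormedAddCommGroup (Fib i)] [∀ i, NormedSpace ℝ (Fib i)]
  [∀ i, FiniteDimensional ℝ (Fib i)]
  {E : Fin n → M → Type*} [∀ i, TopologicalSpace (TotalSpace (Fib i) (E i))]
  [∀ i x, AddCommGroup (E i x)] [∀ i x, Module ℝ (E i x)] [∀ i x, TopologicalSpace (E i x)]
  [∀ i, FiberBundle (Fib i) (E i)] [∀ i, VectorBundle ℝ (Fib i) (E i)]

namespace CoalgebraBundle

variable (μ : CoalgebraBundle m Fib E)

/-- An involutive subbundle `S ⊆ TM` of rank `d` together with flat `S`-connections on the bundles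
`E_{-i}^*`, for `i = 1, …, n`, which are compatible with the dual product `μ^*`. -/
structure CompatibleFlatConnections (d : ℕ) where
  subbundle : TangentSubbundle m M d
  involutive : subbundle.IsInvolutive
  conn : ∀ i : Fin n, PartialConnection subbundle (Fib i) (E i)
  flat : ∀ i, (conn i).IsFlat involutive
  compatible : ∀ (i j l : Fin n) (h : deg i + deg j = deg l) (X : subbundle.sections)
    (η : DualSec m (Fib i) (E i) (⊤ : Opens M)) (ζ : DualSec m (Fib j) (E j) (⊤ : Opens M)),
    (conn l).nabla X (μ.mul h η ζ) =
      μ.mul h ((conn i).nabla X η) ζ + μ.mul h η ((conn j).nabla X ζ)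

/-- Over `V ⊆ U`, the operator `X` over `U` is the derivation given on functions by a section `Y` of
the subbundle and on sections of `E_{-i}^*` by the operator `∇^i_Y`. -/
def ActsAsNabla {d : ℕ} (P : μ.CompatibleFlatConnections d) {U V : Opens M} (h : V ≤ U)
    (X : Module.End ℝ (μ.Fun U)) (Y : P.subbundle.sections) : Prop :=
  (∀ f : SmoothFun m (⊤ : Opens M),
    Fun.res μ h (X (μ.ofFn (f.res le_top))) = μ.ofFn ((P.subbundle.lieDeriv Y f).res le_top)) ∧
  ∀ (i : Fin n) (η : DualSec m (Fib i) (E i) (⊤ : Opens M)),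
    Fun.res μ h (X (μ.ofSec i (DualSec.res le_top η))) =
      μ.ofSec i (DualSec.res le_top ((P.conn i).nabla Y η))

/-- The involutive distribution `D` and the data `P = (S, ∇)` correspond to each other: the vector
fields of degree `0` in `D` are precisely those which are locally of the form `∇_Y`, with `Y` a
section of `S`. -/
def Corresponds {d : ℕ} (D : μ.GradedSubsheaf) (P : μ.CompatibleFlatConnections d) : Prop :=
  ∀ (U : Opens M) (X : Module.End ℝ (μ.Fun U)),
    X ∈ D.carrier U 0 ↔ X ∈ μ.vectorFields U 0 ∧
      ∀ x ∈ U, ∃ (V : Opens M) (h : V ≤ U), x ∈ V ∧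
        ∃ Y : P.subbundle.sections, μ.ActsAsNabla P h X Y

end CoalgebraBundle

end Data
end NMan
end

/-! Through degree `n` the structure sheaf is explicit: its part of degree 0 is `C^∞`, and its part
of degree `i` is `Γ(E_{-i}^*)`. Nothing else occurs there, because the relations `η ζ = μ^*(η, ζ)`
contract every product of total degree at most `n` to a single generator (`PreFun.prod_eq_gen`) and
local representatives glue (`exists_ofFn`, `exists_ofSec`). Nothing is lost either: by
coassociativity the algebra acts on `ℝ ⊕ E_x`, sections acting by convolution, and this action
recovers each section (`convAct_mul`, `ofSec_injective`).

A vector field of degree 0 therefore consists of an ordinary vector field on `M`, its symbol, and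
operators on the `Γ(E_{-i}^*)` obeying the Leibniz rule and compatible with `μ^*`. Conversely, `∇_Y`
extends to such a vector field. A derivation is the `ε`-part of a homomorphism into dual numbers, so
the presentation of the algebra reduces the construction to checking relations; the relation `η ζ =
μ^*(η, ζ)` is the compatibility condition (`dualGen_sec_mul`).

From `D` to `(F, ∇)`: let `F` consist of the symbols of the degree 0 fields in `D`. All generators
of `D` have degree 0, so a degree 0 field in `D` has smooth functions as coefficients, and
independence of the symbols of the generators forces it to vanish when its symbol does
(`stalkOp_eq_zero`). Hence each section `Y` of `F` has exactly one lift to `D` (`exists_lift`,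
`eq_lift`), and the action of the lift on `Γ(E_{-i}^*)` is `∇^i_Y`. Uniqueness of lifts gives
linearity over functions in `Y`, and turns closedness of `D` under brackets into involutivity of `F`
and flatness of `∇`.

From `(F, ∇)` to `D`: take everything generated by the fields `∇_Y`; flatness gives closedness under
brackets (`field_bracket`, `gradedBracket_fmul`). For the rank one picks functions `u_b` such that
the matrix `Z_a(u_b)` of a local frame has an inverse `N`; the coefficients of a field `X` are then
`∑ X(u_b) N_{bc}`, defined on the whole neighbourhood (`hasRank_distribution`).

The two maps are mutually inverse because `Corresponds` determines either side from the other: `D`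
is generated by its degree 0 part, and `Y` is the symbol of `∇_Y`.

The arguments run on stalks. Bump functions show that vector fields are local operators
(`stalkAt_eq_zero_of_vectorField`) and that every germ is global (`Stalk.exists_global_homog`). A
vector field is thus a family of stalk derivations carrying sections to sections, and identities may
be checked on germs of global generators. -/

set_option linter.unusedSectionVars false

noncomputable section

namespace NMan

/-! ### Hadamard's lemma on a finite-dimensional space. -/

section Hadamard

variable {H V : Type} [NormedAddCommGroup H] [NormedSpace ℝ H] [NormedAddCommGroup V]
  [NormedSpace ℝ V] [FiniteDimensional ℝ H]

lemma hasFDerivAt_intervalIntegral_of_contDiff {F : H × ℝ → V} (hF : ContDiff ℝ 1 F) (x₀ : H) :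
    HasFDerivAt (fun x => ∫ t in (0 : ℝ)..1, F (x, t))
      (∫ t in (0 : ℝ)..1, (fderiv ℝ F (x₀, t)).comp (ContinuousLinearMap.inl ℝ H ℝ)) x₀ := by
  have hc : Continuous fun p : H × ℝ => (fderiv ℝ F p).comp (ContinuousLinearMap.inl ℝ H ℝ) :=
    (hF.continuous_fderiv (by norm_num)).clm_comp continuous_const
  -- The partial derivative is bounded on a compact product, and the constant bound is integrable
  -- over the unit interval, so it serves as the dominating function.
  obtain ⟨C, hC⟩ := ((isCompact_closedBall x₀ 1).prod (isCompact_Icc (a := (0 : ℝ)) (b := 1))).exists_bound_of_continuousOn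
    hc.continuousOn
  refine (intervalIntegral.hasFDerivAt_integral_of_dominated_of_fderiv_le
    (μ := MeasureTheory.volume) (F := fun x t => F (x, t))
    (F' := fun x t => (fderiv ℝ F (x, t)).comp (ContinuousLinearMap.inl ℝ H ℝ))
    (bound := fun _ => C) (s := Metric.ball x₀ 1) (Metric.ball_mem_nhds x₀ one_pos) ?_ ?_ ?_ ?_ ?_ ?_)
  · refine Filter.Eventually.of_forall fun x => ?_
    exact (hF.continuous.comp (by fun_prop : Continuous fun t : ℝ => (x, t))).aestronglyMeasurable
  · exact (hF.continuous.comp (by fun_prop : Continuous fun t : ℝ => (x₀, t))).intervalIntegrable _ _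
  · exact (hc.comp (by fun_prop : Continuous fun t : ℝ => (x₀, t))).aestronglyMeasurable
  · refine Filter.Eventually.of_forall fun t ht x hx => hC (x, t) ⟨Metric.ball_subset_closedBall hx, ?_⟩
    rw [Set.uIoc_of_le zero_le_one] at ht
    exact ⟨ht.1.le, ht.2⟩
  · exact intervalIntegrable_const
  · refine Filter.Eventually.of_forall fun t _ x _ => ?_
    have h1 : HasFDerivAt F (fderiv ℝ F (x, t)) (x, t) :=
      (hF.differentiable (by norm_num) _).hasFDerivAt
    exact h1.comp x (hasFDerivAt_prodMk_left x t)

/-- The derivative of the integral is again the integral of a smooth family, with values in a space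
of linear maps. The induction therefore needs the target space to vary. -/
lemma contDiff_intervalIntegral (n : ℕ) {V : Type} [NormedAddCommGroup V] [NormedSpace ℝ V]
    {F : H × ℝ → V} (hF : ContDiff ℝ ∞ F) :
    ContDiff ℝ n (fun x => ∫ t in (0 : ℝ)..1, F (x, t)) := by
  induction n generalizing V with
  | zero =>
    rw [Nat.cast_zero, contDiff_zero]
    exact continuous_iff_continuousAt.2 fun x =>
      (hasFDerivAt_intervalIntegral_of_contDiff (hF.of_le (by exact_mod_cast le_top)) x).continuousAt
  | succ n ih =>
    have h1 := fun x => hasFDerivAt_intervalIntegral_of_contDiff (hF.of_le (by exact_mod_cast le_top)) x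
    rw [Nat.cast_add, Nat.cast_one, contDiff_succ_iff_fderiv]
    refine ⟨fun x => (h1 x).differentiableAt, by simp, ?_⟩
    have h2 : fderiv ℝ (fun x => ∫ t in (0 : ℝ)..1, F (x, t)) = fun x =>
        ∫ t in (0 : ℝ)..1, (fderiv ℝ F (x, t)).comp (ContinuousLinearMap.inl ℝ H ℝ) :=
      funext fun x => (h1 x).fderiv
    rw [h2]
    refine ih (F := fun p => (fderiv ℝ F p).comp (ContinuousLinearMap.inl ℝ H ℝ)) ?_
    exact (hF.fderiv_right (m := ∞) (by simp)).clm_comp contDiff_const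

/-- Hadamard's lemma. -/
lemma exists_hadamard {f : H → ℝ} (hf : ContDiff ℝ ∞ f) (p : H) :
    ∃ g : H → H →L[ℝ] ℝ, ContDiff ℝ ∞ g ∧ ∀ x, f x = f p + g x (x - p) := by
  have hF : ContDiff ℝ ∞ fun q : H × ℝ => fderiv ℝ f (p + q.2 • (q.1 - p)) :=
    (hf.fderiv_right (m := ∞) (by simp)).comp (by fun_prop)
  -- The witness is the mean of the derivative over the segment from `p` to `x`.
  refine ⟨fun x => ∫ t in (0 : ℝ)..1, fderiv ℝ f (p + t • (x - p)),
    contDiff_infty.2 fun n => contDiff_intervalIntegral n hF, fun x => ?_⟩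
  have hcont : Continuous fun t : ℝ => fderiv ℝ f (p + t • (x - p)) :=
    hF.continuous.comp (by fun_prop : Continuous fun t : ℝ => (x, t))
  have h1 : ∀ t : ℝ, HasDerivAt (fun t : ℝ => f (p + t • (x - p)))
      (fderiv ℝ f (p + t • (x - p)) (x - p)) t := fun t => by
    have h2 : HasDerivAt (fun t : ℝ => p + t • (x - p)) (x - p) t := by
      simpa using ((hasDerivAt_id t).smul_const (x - p)).const_add p
    exact ((hf.differentiable (by simp) _).hasFDerivAt).comp_hasDerivAt t h2
  have h3 := intervalIntegral.integral_eq_sub_of_hasDerivAt (a := 0) (b := 1) (fun t _ => h1 t)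
    ((hcont.clm_apply continuous_const).intervalIntegrable _ _)
  rw [← ContinuousLinearMap.intervalIntegral_apply (hcont.intervalIntegrable _ _)] at h3
  rw [h3]
  simp

end Hadamard

/-! ### Smooth functions, directional derivatives and bump functions on `M`. -/

section Functions

variable {m : ℕ} {M : Type*} [TopologicalSpace M] [ChartedSpace (EuclideanSpace ℝ (Fin m)) M]

/-- A smooth function on `M`, regarded as a smooth function on an open subset. -/
def SmoothFun.ofGlobal (f : M → ℝ) (hf : ContMDiff (𝓡 m) 𝓘(ℝ, ℝ) ∞ f) (U : Opens M) :
    SmoothFun m U :=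
  ⟨fun x => f x, hf.comp contMDiff_subtype_val⟩

@[simp] lemma SmoothFun.val_ofGlobal (f : M → ℝ) (hf : ContMDiff (𝓡 m) 𝓘(ℝ, ℝ) ∞ f) :
    (SmoothFun.ofGlobal f hf ⊤).val = f := rfl

lemma SmoothFun.val_injective {f g : SmoothFun m (⊤ : Opens M)} (h : f.val = g.val) : f = g :=
  ContMDiffMap.ext fun x => congrFun h x

lemma SmoothFun.val_mul (f g : SmoothFun m (⊤ : Opens M)) : (f * g).val = f.val * g.val := rfl

lemma SmoothFun.val_add (f g : SmoothFun m (⊤ : Opens M)) : (f + g).val = f.val + g.val := rfl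

lemma SmoothFun.contMDiff_val' (f : SmoothFun m (⊤ : Opens M)) :
    ContMDiff (𝓡 m) 𝓘(ℝ, ℝ) ∞ f.val := by
  have h : ContMDiff (𝓡 m) (𝓡 m) ∞ (fun x : M => (⟨x, Opens.mem_top x⟩ : (⊤ : Opens M))) :=
    (ContMDiff.subtypeVal_comp_iff _ _).mp contMDiff_id
  exact f.contMDiff.comp h

lemma SmoothFun.mdifferentiableAt_val (f : SmoothFun m (⊤ : Opens M)) (x : M) :
    MDifferentiableAt (𝓡 m) 𝓘(ℝ, ℝ) f.val x :=
  (f.contMDiff_val' x).mdifferentiableAt (by simp)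

/-- The derivative of a function in the direction of a tangent vector. -/
def dirDeriv (f : M → ℝ) (x : M) (v : TangentSpace (𝓡 m) x) : ℝ := mfderiv (𝓡 m) 𝓘(ℝ, ℝ) f x v

lemma dirDeriv_add_vec (f : M → ℝ) (x : M) (v w : TangentSpace (𝓡 m) x) :
    dirDeriv f x (v + w) = dirDeriv f x v + dirDeriv f x w := map_add _ _ _

lemma dirDeriv_smul_vec (f : M → ℝ) (x : M) (c : ℝ) (v : TangentSpace (𝓡 m) x) :
    dirDeriv f x (c • v) = c * dirDeriv f x v := map_smul (mfderiv (𝓡 m) 𝓘(ℝ, ℝ) f x) c v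

lemma dirDeriv_zero_vec (f : M → ℝ) (x : M) :
    dirDeriv f x (0 : TangentSpace (𝓡 m) x) = 0 := map_zero (mfderiv (𝓡 m) 𝓘(ℝ, ℝ) f x)

lemma dirDeriv_sum_vec {ι : Type*} (s : Finset ι) (f : M → ℝ) (x : M)
    (v : ι → TangentSpace (𝓡 m) x) :
    dirDeriv f x (∑ a ∈ s, v a) = ∑ a ∈ s, dirDeriv f x (v a) := by
  classical
  induction s using Finset.induction_on with
  | empty => simp [dirDeriv_zero_vec]
  | insert a s ha ih => rw [Finset.sum_insert ha, Finset.sum_insert ha, dirDeriv_add_vec, ih]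

lemma dirDeriv_sub_vec (f : M → ℝ) (x : M) (v w : TangentSpace (𝓡 m) x) :
    dirDeriv f x (v - w) = dirDeriv f x v - dirDeriv f x w :=
  map_sub (mfderiv (𝓡 m) 𝓘(ℝ, ℝ) f x) v w

lemma dirDeriv_congr {f g : M → ℝ} {x : M} (h : f =ᶠ[nhds x] g) (v : TangentSpace (𝓡 m) x) :
    dirDeriv f x v = dirDeriv g x v := by
  unfold dirDeriv
  exact congrArg (fun L : EuclideanSpace ℝ (Fin m) →L[ℝ] ℝ => L v) h.mfderiv_eq

lemma dirDeriv_const (c : ℝ) (x : M) (v : TangentSpace (𝓡 m) x) :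
    dirDeriv (fun _ => c) x v = 0 := by
  unfold dirDeriv
  rw [mfderiv_const]
  rfl

lemma dirDeriv_add {f g : M → ℝ} {x : M} (hf : MDifferentiableAt (𝓡 m) 𝓘(ℝ, ℝ) f x)
    (hg : MDifferentiableAt (𝓡 m) 𝓘(ℝ, ℝ) g x) (v : TangentSpace (𝓡 m) x) :
    dirDeriv (f + g) x v = dirDeriv f x v + dirDeriv g x v := by
  unfold dirDeriv
  exact congrArg (fun L : EuclideanSpace ℝ (Fin m) →L[ℝ] ℝ => L v) (hf.hasMFDerivAt.add hg.hasMFDerivAt).mfderiv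

lemma dirDeriv_mul {f g : M → ℝ} {x : M} (hf : MDifferentiableAt (𝓡 m) 𝓘(ℝ, ℝ) f x)
    (hg : MDifferentiableAt (𝓡 m) 𝓘(ℝ, ℝ) g x) (v : TangentSpace (𝓡 m) x) :
    dirDeriv (f * g) x v = f x * dirDeriv g x v + g x * dirDeriv f x v := by
  unfold dirDeriv
  exact congrArg (fun L : EuclideanSpace ℝ (Fin m) →L[ℝ] ℝ => L v) (hf.hasMFDerivAt.mul hg.hasMFDerivAt).mfderiv

section Bump

variable [T2Space M] [IsManifold (𝓡 m) ∞ M]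

variable (m) in
-- The support condition serves the extensions by zero; compactness of the support is needed only in
-- `exists_contDiff_chart`.
lemma exists_bump {U : Opens M} {x : M} (hx : x ∈ U) :
    ∃ ρ : M → ℝ, ContMDiff (𝓡 m) 𝓘(ℝ, ℝ) ∞ ρ ∧ ρ =ᶠ[nhds x] 1 ∧ tsupport ρ ⊆ U ∧
      IsCompact (tsupport ρ) := by
  obtain ⟨ρ, -, h⟩ := (SmoothBumpFunction.nhds_basis_tsupport (I := 𝓡 m) x).mem_iff.1
    (U.isOpen.mem_nhds hx)
  exact ⟨ρ, ρ.contMDiff, ρ.eventuallyEq_one, h, ρ.hasCompactSupport⟩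

lemma exists_open_nhds {p : M → Prop} {x : M} (h : ∀ᶠ y in nhds x, p y) :
    ∃ W : Opens M, x ∈ W ∧ ∀ y ∈ W, p y := by
  obtain ⟨t, ht, ho, hx⟩ := eventually_nhds_iff.1 h
  exact ⟨⟨t, ho⟩, hx, ht⟩

/-- Multiplication by a bump function keeps the germ at `x` and makes the function global. This
allows the later arguments to use global functions throughout. -/
lemma exists_contMDiff_eventuallyEq {f : M → ℝ} {U : Opens M} {x : M} (hx : x ∈ U)
    (hf : ContMDiffOn (𝓡 m) 𝓘(ℝ, ℝ) ∞ f U) :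
    ∃ g : M → ℝ, ContMDiff (𝓡 m) 𝓘(ℝ, ℝ) ∞ g ∧ g =ᶠ[nhds x] f := by
  obtain ⟨ρ, hρ, h1, h2, -⟩ := exists_bump m hx
  refine ⟨ρ * f, contMDiff_of_tsupport fun y hy => ?_, ?_⟩
  · have hy : y ∈ U := h2 (tsupport_mul_subset_left hy)
    exact (hρ y).mul ((hf y hy).contMDiffAt (U.isOpen.mem_nhds hy))
  · filter_upwards [h1] with y hy
    simp [hy]

lemma contMDiffOn_of_smoothFun {U : Opens M} (f : SmoothFun m U) {g : M → ℝ}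
    (hg : ∀ x : U, g x = f x) : ContMDiffOn (𝓡 m) 𝓘(ℝ, ℝ) ∞ g U := by
  intro x hx
  refine ContMDiffAt.contMDiffWithinAt ?_
  refine (contMDiffAt_subtype_iff (U := U) (x := ⟨x, hx⟩)).1 ?_
  exact (f.contMDiff ⟨x, hx⟩).congr_of_eventuallyEq (Filter.Eventually.of_forall hg)

lemma SmoothFun.exists_extension {U : Opens M} (f : SmoothFun m U) {x : M} (hx : x ∈ U) :
    ∃ (g : SmoothFun m (⊤ : Opens M)) (W : Opens M), x ∈ W ∧ ∃ h : W ≤ U,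
      g.res le_top = f.res h := by
  classical
  let f' : M → ℝ := fun y => if h : y ∈ U then f ⟨y, h⟩ else 0
  have hf' : ContMDiffOn (𝓡 m) 𝓘(ℝ, ℝ) ∞ f' U :=
    contMDiffOn_of_smoothFun f fun x => dif_pos x.2
  obtain ⟨g, hg, hgf⟩ := exists_contMDiff_eventuallyEq hx hf'
  obtain ⟨W, hxW, hW⟩ := exists_open_nhds (hgf.and (U.isOpen.mem_nhds hx))
  refine ⟨SmoothFun.ofGlobal g hg ⊤, W, hxW, fun y hy => (hW y hy).2, ContMDiffMap.ext fun y => ?_⟩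
  exact (hW y y.2).1.trans (dif_pos (hW y y.2).2)

/-- The smooth coordinate functions near a point, extended to the manifold. -/
lemma exists_coordinates (x₀ : M) : ∃ ξ : Fin m → M → ℝ,
    (∀ i, ContMDiff (𝓡 m) 𝓘(ℝ, ℝ) ∞ (ξ i)) ∧
    ∀ᶠ y in nhds x₀, ∀ i, ξ i y = (extChartAt (𝓡 m) x₀ y) i := by
  have h : ∀ i : Fin m, ∃ g : M → ℝ, ContMDiff (𝓡 m) 𝓘(ℝ, ℝ) ∞ g ∧
      g =ᶠ[nhds x₀] fun y => (extChartAt (𝓡 m) x₀ y) i := fun i => by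
    refine exists_contMDiff_eventuallyEq (U := ⟨(chartAt (EuclideanSpace ℝ (Fin m)) x₀).source,
      (chartAt (EuclideanSpace ℝ (Fin m)) x₀).open_source⟩)
      (mem_chart_source _ x₀) ?_
    have h1 : ContMDiff 𝓘(ℝ, EuclideanSpace ℝ (Fin m)) 𝓘(ℝ, ℝ) ∞
        (EuclideanSpace.proj i : EuclideanSpace ℝ (Fin m) →L[ℝ] ℝ) :=
      (ContinuousLinearMap.contDiff _).contMDiff
    exact h1.comp_contMDiffOn contMDiffOn_extChartAt
  choose ξ h1 h2 using h
  exact ⟨ξ, h1, Filter.eventually_all.2 h2⟩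

/-- Chart domains need not be convex, while Hadamard's lemma uses whole segments. Cutting off first
yields a coordinate expression that is smooth on the entire model space. -/
lemma exists_contDiff_chart (f : M → ℝ) (hf : ContMDiff (𝓡 m) 𝓘(ℝ, ℝ) ∞ f) (x₀ : M) :
    ∃ F : EuclideanSpace ℝ (Fin m) → ℝ, ContDiff ℝ ∞ F ∧
      ∀ᶠ y in nhds x₀, f y = F (extChartAt (𝓡 m) x₀ y) := by
  classical
  obtain ⟨σ, hσ, h1, h2, h3⟩ := exists_bump m
    (U := ⟨(extChartAt (𝓡 m) x₀).source, isOpen_extChartAt_source x₀⟩) (mem_extChartAt_source x₀)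
  let φ := extChartAt (𝓡 m) x₀
  let F : EuclideanSpace ℝ (Fin m) → ℝ := fun e => if e ∈ φ.target then (σ * f) (φ.symm e) else 0
  refine ⟨F, contDiff_iff_contDiffAt.2 fun e => ?_, ?_⟩
  · by_cases he : e ∈ φ.target
    · have ht : φ.target ∈ nhds e := (isOpen_extChartAt_target x₀).mem_nhds he
      have h4 : ContMDiffAt 𝓘(ℝ, EuclideanSpace ℝ (Fin m)) 𝓘(ℝ, ℝ) ∞ (fun e => (σ * f) (φ.symm e)) e :=
        ((hσ.mul hf) _).comp e ((contMDiffOn_extChartAt_symm x₀).contMDiffAt ht)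
      refine h4.contDiffAt.congr_of_eventuallyEq ?_
      filter_upwards [ht] with y hy using if_pos hy
    -- A compact support has closed image in the whole model space, so the extension by zero
    -- vanishes near each point outside the chart's target.
    · have hK : IsClosed (φ '' tsupport σ) :=
        (h3.image_of_continuousOn ((continuousOn_extChartAt x₀).mono h2)).isClosed
      have heK : e ∉ φ '' tsupport σ := by
        rintro ⟨y, hy, rfl⟩
        exact he (φ.map_source (h2 hy))
      refine (contDiffAt_const (c := (0 : ℝ))).congr_of_eventuallyEq ?_
      filter_upwards [hK.isOpen_compl.mem_nhds heK] with y hy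
      by_cases hyt : y ∈ φ.target
      · have : φ.symm y ∉ tsupport σ := fun h => hy ⟨_, h, φ.right_inv hyt⟩
        simp [F, hyt, image_eq_zero_of_notMem_tsupport this]
      · exact if_neg hyt
  · filter_upwards [h1, (isOpen_extChartAt_source (I := 𝓡 m) x₀).mem_nhds (mem_extChartAt_source x₀)]
      with y hy hys
    have h4 : F (φ y) = (σ * f) (φ.symm (φ y)) := if_pos (φ.map_source hys)
    rw [φ.left_inv hys, Pi.mul_apply, hy, Pi.one_apply, one_mul] at h4
    exact h4.symm

/-- First order expansion of a smooth function in coordinates. -/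
lemma exists_expansion (f : SmoothFun m (⊤ : Opens M)) (x₀ : M) (ξ : Fin m → M → ℝ)
    (hξ' : ∀ᶠ y in nhds x₀, ∀ i, ξ i y = (extChartAt (𝓡 m) x₀ y) i) :
    ∃ g : Fin m → M → ℝ, (∀ i, ContMDiff (𝓡 m) 𝓘(ℝ, ℝ) ∞ (g i)) ∧
      ∀ᶠ y in nhds x₀, f.val y = f.val x₀ + ∑ i, (ξ i y - ξ i x₀) * g i y := by
  obtain ⟨F, hF, hfF⟩ := exists_contDiff_chart f.val f.contMDiff_val' x₀
  obtain ⟨G, hG, hGF⟩ := exists_hadamard hF (extChartAt (𝓡 m) x₀ x₀)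
  have h : ∀ i : Fin m, ∃ g : M → ℝ, ContMDiff (𝓡 m) 𝓘(ℝ, ℝ) ∞ g ∧
      g =ᶠ[nhds x₀] fun y => G (extChartAt (𝓡 m) x₀ y) (EuclideanSpace.single i 1) := fun i => by
    refine exists_contMDiff_eventuallyEq (U := ⟨(chartAt (EuclideanSpace ℝ (Fin m)) x₀).source,
      (chartAt (EuclideanSpace ℝ (Fin m)) x₀).open_source⟩)
      (mem_chart_source _ x₀) ?_
    have h1 : ContMDiff 𝓘(ℝ, EuclideanSpace ℝ (Fin m)) 𝓘(ℝ, ℝ) ∞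
        (fun e => G e (EuclideanSpace.single i 1)) := (hG.clm_apply contDiff_const).contMDiff
    exact h1.comp_contMDiffOn contMDiffOn_extChartAt
  choose g h1 h2 using h
  refine ⟨g, h1, ?_⟩
  filter_upwards [Filter.eventually_all.2 h2, hξ', hfF] with y hg hξy hfy
  rw [hfy, hGF, hfF.self_of_nhds]
  congr 1
  have h3 : extChartAt (𝓡 m) x₀ y - extChartAt (𝓡 m) x₀ x₀ =
      ∑ i, (ξ i y - ξ i x₀) • EuclideanSpace.single i (1 : ℝ) := by
    ext j
    simp [hξy, hξ'.self_of_nhds, Pi.single_apply]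
  conv_lhs => rw [h3, map_sum]
  refine Finset.sum_congr rfl fun i _ => ?_
  rw [map_smul, hg i, smul_eq_mul]

end Bump

end Functions

/-! ### Tangent vectors as point derivations. -/

section Tangent

variable {m : ℕ} {M : Type*} [TopologicalSpace M] [ChartedSpace (EuclideanSpace ℝ (Fin m)) M]
  [IsManifold (𝓡 m) ∞ M]

/-- The differential at `x` of the chart at `x₀`. -/
def chartDeriv (x₀ x : M) : TangentSpace (𝓡 m) x →L[ℝ] EuclideanSpace ℝ (Fin m) :=
  mfderiv (𝓡 m) 𝓘(ℝ, EuclideanSpace ℝ (Fin m)) (extChartAt (𝓡 m) x₀) x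

lemma isManifold_one : IsManifold (𝓡 m) 1 M := IsManifold.of_le (n := ∞) (by exact_mod_cast le_top)

lemma isManifold_two : IsManifold (𝓡 m) 2 M := IsManifold.of_le (n := ∞) ENat.LEInfty.out

lemma chartDeriv_bijective (x₀ : M) {x : M}
    (hx : x ∈ (chartAt (EuclideanSpace ℝ (Fin m)) x₀).source) :
    Function.Bijective (chartDeriv (m := m) x₀ x) := by
  have := isManifold_one (m := m) (M := M)
  obtain ⟨e, he⟩ := isInvertible_mfderiv_extChartAt (I := 𝓡 m) (x := x₀) (y := x) (by simpa using hx)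
  have : ⇑(chartDeriv (m := m) x₀ x) = e := by
    unfold chartDeriv
    rw [← he]
    rfl
  rw [this]
  exact e.bijective

lemma dirDeriv_eq_fderiv {f : M → ℝ} {F : EuclideanSpace ℝ (Fin m) → ℝ} {x₀ x : M}
    (hx : x ∈ (chartAt (EuclideanSpace ℝ (Fin m)) x₀).source)
    (hF : DifferentiableAt ℝ F (extChartAt (𝓡 m) x₀ x))
    (h : ∀ᶠ y in nhds x, f y = F (extChartAt (𝓡 m) x₀ y)) (v : TangentSpace (𝓡 m) x) :
    dirDeriv f x v = fderiv ℝ F (extChartAt (𝓡 m) x₀ x) (chartDeriv x₀ x v) := by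
  have := isManifold_one (m := m) (M := M)
  rw [dirDeriv_congr (g := F ∘ extChartAt (𝓡 m) x₀) h]
  unfold dirDeriv chartDeriv
  have h1 := mfderiv_comp_apply x hF.mdifferentiableAt (mdifferentiableAt_extChartAt (I := 𝓡 m) hx) v
  rw [mfderiv_eq_fderiv] at h1
  exact h1

lemma dirDeriv_eq_chartDeriv {ξ : M → ℝ} {x₀ x : M} {i : Fin m}
    (hx : x ∈ (chartAt (EuclideanSpace ℝ (Fin m)) x₀).source)
    (h : ∀ᶠ y in nhds x, ξ y = (extChartAt (𝓡 m) x₀ y) i) (v : TangentSpace (𝓡 m) x) :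
    dirDeriv ξ x v = (chartDeriv x₀ x v) i := by
  have h1 := dirDeriv_eq_fderiv (F := (EuclideanSpace.proj i : EuclideanSpace ℝ (Fin m) →L[ℝ] ℝ)) hx
    (ContinuousLinearMap.differentiableAt _) h v
  rwa [ContinuousLinearMap.fderiv] at h1

lemma contMDiffAt_dirDeriv {f : M → ℝ} (hf : ContMDiff (𝓡 m) 𝓘(ℝ, ℝ) ∞ f)
    {X : ∀ x : M, TangentSpace (𝓡 m) x} {x : M}
    (hX : ContMDiffAt (𝓡 m) ((𝓡 m).prod 𝓘(ℝ, EuclideanSpace ℝ (Fin m))) ∞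
        (fun y => (⟨y, X y⟩ : TangentBundle (𝓡 m) M)) x) :
    ContMDiffAt (𝓡 m) 𝓘(ℝ, ℝ) ∞ (fun y => dirDeriv f y (X y)) x := by
  have h1 := hf.contMDiff_tangentMap (m := ∞) (by simp)
  have h2 := (h1 _).comp x hX
  exact (contMDiff_snd_tangentBundle_modelSpace ℝ 𝓘(ℝ, ℝ) _).comp x h2

variable [T2Space M]

/-- A covector becomes a linear function in the chart at `x`, and this function is then extended
from its germ. -/
lemma exists_dirDeriv_eq (x : M) (ℓ : TangentSpace (𝓡 m) x →ₗ[ℝ] ℝ) :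
    ∃ u : M → ℝ, ContMDiff (𝓡 m) 𝓘(ℝ, ℝ) ∞ u ∧ ∀ v, dirDeriv u x v = ℓ v := by
  let e := LinearEquiv.ofBijective (chartDeriv (m := m) x x).toLinearMap
    (chartDeriv_bijective x (mem_chart_source _ x))
  let F : EuclideanSpace ℝ (Fin m) →L[ℝ] ℝ := LinearMap.toContinuousLinearMap (ℓ ∘ₗ e.symm.toLinearMap)
  obtain ⟨u, hu, h⟩ := exists_contMDiff_eventuallyEq (f := fun y => F (extChartAt (𝓡 m) x y))
    (U := ⟨(chartAt (EuclideanSpace ℝ (Fin m)) x).source,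
      (chartAt (EuclideanSpace ℝ (Fin m)) x).open_source⟩) (mem_chart_source _ x)
      (F.contDiff.contMDiff.comp_contMDiffOn contMDiffOn_extChartAt)
  refine ⟨u, hu, fun v => ?_⟩
  rw [dirDeriv_eq_fderiv (mem_chart_source _ x) F.differentiableAt h, ContinuousLinearMap.fderiv]
  exact congrArg ℓ (e.symm_apply_apply v)

lemma eq_of_dirDeriv_eq {x : M} {v w : TangentSpace (𝓡 m) x}
    (h : ∀ f : SmoothFun m (⊤ : Opens M), dirDeriv f.val x v = dirDeriv f.val x w) : v = w := by
  refine (chartDeriv_bijective x (mem_chart_source _ x)).1 ?_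
  obtain ⟨ξ, h1, h2⟩ := exists_coordinates (m := m) x
  ext i
  have h3 := h2.mono fun y hy => hy i
  rw [← dirDeriv_eq_chartDeriv (mem_chart_source _ x) h3,
    ← dirDeriv_eq_chartDeriv (mem_chart_source _ x) h3]
  exact h (SmoothFun.ofGlobal (ξ i) (h1 i) ⊤)

/-- Testing on the coordinate functions suffices: their derivatives are the components of the field
in the tangent trivialization. This later gives smoothness of symbols. -/
lemma contMDiffAt_of_dirDeriv {X : ∀ x : M, TangentSpace (𝓡 m) x} {x : M}
    (h : ∀ f : SmoothFun m (⊤ : Opens M),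
      ContMDiffAt (𝓡 m) 𝓘(ℝ, ℝ) ∞ (fun y => dirDeriv f.val y (X y)) x) :
    ContMDiffAt (𝓡 m) ((𝓡 m).prod 𝓘(ℝ, EuclideanSpace ℝ (Fin m))) ∞
        (fun y => (⟨y, X y⟩ : TangentBundle (𝓡 m) M)) x := by
  have := isManifold_one (m := m) (M := M)
  rw [contMDiffAt_section]
  have hs : (chartAt (EuclideanSpace ℝ (Fin m)) x).source ∈ nhds x :=
    (chartAt (EuclideanSpace ℝ (Fin m)) x).open_source.mem_nhds (mem_chart_source _ x)
  obtain ⟨ξ, h1, h2⟩ := exists_coordinates (m := m) x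
  have h3 : ContMDiffAt (𝓡 m) 𝓘(ℝ, EuclideanSpace ℝ (Fin m)) ∞
      (fun y => chartDeriv x y (X y)) x := by
    have h4 : ContMDiffAt (𝓡 m) 𝓘(ℝ, Fin m → ℝ) ∞ (fun y i => (chartDeriv x y (X y)) i) x := by
      refine contMDiffAt_pi_space.2 fun i => ?_
      refine (h (SmoothFun.ofGlobal (ξ i) (h1 i) ⊤)).congr_of_eventuallyEq ?_
      filter_upwards [h2.eventually_nhds, hs] with y hy hys
      exact (dirDeriv_eq_chartDeriv hys (hy.mono fun z hz => hz i) _).symm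
    exact ((EuclideanSpace.equiv (Fin m) ℝ).symm.contDiff.contMDiff.contMDiffAt).comp x h4
  refine h3.congr_of_eventuallyEq ?_
  filter_upwards [hs] with y hy
  have h5 := congrArg (fun L : EuclideanSpace ℝ (Fin m) →L[ℝ] EuclideanSpace ℝ (Fin m) => L (X y))
    (TangentBundle.continuousLinearMapAt_trivializationAt (I := 𝓡 m) hy)
  refine Eq.trans ?_ h5
  exact (congrFun ((trivializationAt (EuclideanSpace ℝ (Fin m)) (TangentSpace (𝓡 m)) x).coe_linearMapAt_of_mem
    (R := ℝ) (by simpa using hy)) (X y)).symm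

/-- Point derivations of the algebra of smooth functions are tangent vectors. -/
lemma exists_tangentVector (x : M) (δ : SmoothFun m (⊤ : Opens M) →ₗ[ℝ] ℝ)
    (hδ : ∀ f g, δ (f * g) = f.val x * δ g + g.val x * δ f) :
    ∃ v : TangentSpace (𝓡 m) x, ∀ f, δ f = dirDeriv f.val x v := by
  obtain ⟨ξ, hξ, hξ'⟩ := exists_coordinates (m := m) x
  let ξ' : Fin m → SmoothFun m (⊤ : Opens M) := fun i => SmoothFun.ofGlobal (ξ i) (hξ i) ⊤
  -- The components of `v` are the values of `δ` on the coordinates, so the difference of `δ` and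
  -- `v` is a point derivation killing every coordinate function.
  obtain ⟨v, hv⟩ := (chartDeriv_bijective x (mem_chart_source _ x)).2
    (WithLp.toLp 2 fun i => δ (ξ' i))
  refine ⟨v, fun f => ?_⟩
  let dv : SmoothFun m (⊤ : Opens M) →ₗ[ℝ] ℝ :=
    { toFun := fun f => dirDeriv f.val x v
      map_add' := fun f g => dirDeriv_add (f.mdifferentiableAt_val x) (g.mdifferentiableAt_val x) v
      map_smul' := fun c f => by
        have h := dirDeriv_mul (f := fun _ => c) (g := f.val) (x := x) mdifferentiableAt_const
          (f.mdifferentiableAt_val x) v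
        rw [dirDeriv_const, mul_zero, add_zero] at h
        exact h }
  have hdv : ∀ f g, dv (f * g) = f.val x * dv g + g.val x * dv f := fun f g =>
    dirDeriv_mul (f.mdifferentiableAt_val x) (g.mdifferentiableAt_val x) v
  suffices h : (δ - dv) f = 0 from sub_eq_zero.1 h
  have hD : ∀ f g, (δ - dv) (f * g) = f.val x * (δ - dv) g + g.val x * (δ - dv) f := fun f g => by
    simp only [LinearMap.sub_apply, hδ, hdv]
    ring
  have hDξ : ∀ i, (δ - dv) (ξ' i) = 0 := fun i => by
    have h1 : dv (ξ' i) = δ (ξ' i) := by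
      refine (dirDeriv_eq_chartDeriv (mem_chart_source _ x) (hξ'.mono fun y hy => hy i) v).trans ?_
      rw [hv]
    rw [LinearMap.sub_apply, h1, sub_self]
  generalize δ - dv = D at hD hDξ
  have hD1 : ∀ c : ℝ, D (algebraMap ℝ _ c) = 0 := fun c => by
    have h1 : D 1 = 0 := by
      have h2 := hD 1 1
      have h3 : (1 : SmoothFun m (⊤ : Opens M)).val x = 1 := rfl
      rw [one_mul, h3] at h2
      linarith
    rw [Algebra.algebraMap_eq_smul_one, map_smul, h1, smul_zero]
  -- Locality: expanding `D (ρ * (f - g)) = 0` at `x`, where `ρ` is 1 and `f - g` is 0, leaves `D (f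
  -- - g) = 0`. It is needed because the first order expansion holds only near `x`.
  have hloc : ∀ f g : SmoothFun m (⊤ : Opens M), f.val =ᶠ[nhds x] g.val → D f = D g := fun f g hfg => by
    obtain ⟨W, hxW, hW⟩ := exists_open_nhds hfg
    obtain ⟨ρ, hρ, h1, h2, -⟩ := exists_bump m hxW
    have h3 : SmoothFun.ofGlobal ρ hρ ⊤ * (f - g) = 0 := by
      refine SmoothFun.val_injective (funext fun y => ?_)
      by_cases hy : y ∈ W
      · exact mul_eq_zero_of_right _ (sub_eq_zero.2 (hW y hy))
      · exact mul_eq_zero_of_left (image_eq_zero_of_notMem_tsupport fun h => hy (h2 h)) _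
    have h4 := hD (SmoothFun.ofGlobal ρ hρ ⊤) (f - g)
    have h5 : (f - g).val x = 0 := sub_eq_zero.2 (hW x hxW)
    rw [h3, h5, map_zero, SmoothFun.val_ofGlobal, h1.self_of_nhds, zero_mul, add_zero, Pi.one_apply,
      one_mul, map_sub] at h4
    exact sub_eq_zero.1 h4.symm
  obtain ⟨g, hg, hfg⟩ := exists_expansion f x ξ hξ'
  let g' : Fin m → SmoothFun m (⊤ : Opens M) := fun i => SmoothFun.ofGlobal (g i) (hg i) ⊤
  have h6 : D f = D (algebraMap ℝ _ (f.val x) +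
      ∑ i, (ξ' i - algebraMap ℝ _ (ξ i x)) * g' i) := by
    refine hloc _ _ ?_
    filter_upwards [hfg] with y hy
    rw [hy, SmoothFun.val_add, Pi.add_apply]
    congr 1
    exact (map_sum (ContMDiffMap.evalRingHom (⟨y, Opens.mem_top y⟩ : (⊤ : Opens M)) :
      SmoothFun m (⊤ : Opens M) →+* ℝ) (fun i => (ξ' i - algebraMap ℝ _ (ξ i x)) * g' i) _).symm
  rw [h6, map_add, hD1, map_sum, zero_add]
  refine Finset.sum_eq_zero fun i _ => ?_
  have h7 : (ξ' i - algebraMap ℝ _ (ξ i x)).val x = 0 := sub_self (ξ i x)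
  rw [hD, h7, map_sub, hD1, hDξ, sub_self, mul_zero, zero_mul, add_zero]

end Tangent

/-! ### The Lie bracket acts on functions as a commutator. -/

section Bracket

variable {m : ℕ} {M : Type*} [TopologicalSpace M] [ChartedSpace (EuclideanSpace ℝ (Fin m)) M]
  [IsManifold (𝓡 m) ∞ M]

/-- A vector field in the chart at `x₀`. -/
def inChart (x₀ : M) (V : ∀ x : M, TangentSpace (𝓡 m) x) :
    EuclideanSpace ℝ (Fin m) → EuclideanSpace ℝ (Fin m) :=
  VectorField.mpullbackWithin 𝓘(ℝ, EuclideanSpace ℝ (Fin m)) (𝓡 m) (extChartAt (𝓡 m) x₀).symm V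
    (Set.range (𝓡 m))

lemma eventually_chartDeriv_eq_inChart (x₀ : M) (V : ∀ x : M, TangentSpace (𝓡 m) x) :
    ∀ᶠ y in nhds x₀, chartDeriv x₀ y (V y) = inChart x₀ V (extChartAt (𝓡 m) x₀ y) := by
  have := isManifold_one (m := m) (M := M)
  have h := VectorField.eventuallyEq_mpullback_mpullbackWithin_extChartAt (I := 𝓡 m) (s := Set.univ)
    (x := x₀) V
  rw [nhdsWithin_univ] at h
  filter_upwards [h, extChartAt_source_mem_nhds (I := 𝓡 m) x₀] with y hy hys
  rw [VectorField.mpullback_apply] at hy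
  obtain ⟨e, he⟩ := isInvertible_mfderiv_extChartAt (I := 𝓡 m) hys
  rw [hy, ← he]
  unfold chartDeriv
  rw [← he, ContinuousLinearMap.inverse_equiv]
  exact e.apply_symm_apply _

/-- The model has no boundary, so brackets and pullbacks within the range of the model are the
ordinary Euclidean ones. -/
lemma chartDeriv_mlieBracket (x₀ : M) (V W : ∀ x : M, TangentSpace (𝓡 m) x) :
    chartDeriv x₀ x₀ (VectorField.mlieBracket (𝓡 m) V W x₀) =
      VectorField.lieBracket ℝ (inChart x₀ V) (inChart x₀ W) (extChartAt (𝓡 m) x₀ x₀) := by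
  have := isManifold_one (m := m) (M := M)
  have h0 : (extChartAt (𝓡 m) x₀).symm ⁻¹' Set.univ ∩ Set.range (𝓡 m) = Set.univ := by
    rw [Set.preimage_univ, Set.univ_inter, ModelWithCorners.range_eq_univ]
  rw [← VectorField.mlieBracketWithin_univ, VectorField.mlieBracketWithin_apply]
  have hb : VectorField.lieBracketWithin ℝ (inChart x₀ V) (inChart x₀ W)
      ((extChartAt (𝓡 m) x₀).symm ⁻¹' Set.univ ∩ Set.range (𝓡 m)) (extChartAt (𝓡 m) x₀ x₀) =
      VectorField.lieBracket ℝ (inChart x₀ V) (inChart x₀ W) (extChartAt (𝓡 m) x₀ x₀) := by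
    rw [h0, VectorField.lieBracketWithin_univ]
  refine (congrArg (fun b : EuclideanSpace ℝ (Fin m) => chartDeriv x₀ x₀
    ((mfderiv (𝓡 m) 𝓘(ℝ, EuclideanSpace ℝ (Fin m)) (extChartAt (𝓡 m) x₀) x₀).inverse b)) hb).trans ?_
  obtain ⟨e, he⟩ := isInvertible_mfderiv_extChartAt (I := 𝓡 m) (mem_extChartAt_source (I := 𝓡 m) x₀)
  unfold chartDeriv
  rw [← he, ContinuousLinearMap.inverse_equiv]
  exact e.apply_symm_apply _

lemma differentiableAt_inChart (x₀ : M) {V : ∀ x : M, TangentSpace (𝓡 m) x}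
    (hV : ContMDiffAt (𝓡 m) ((𝓡 m).prod 𝓘(ℝ, EuclideanSpace ℝ (Fin m))) ∞
        (fun y => (⟨y, V y⟩ : TangentBundle (𝓡 m) M)) x₀) :
    DifferentiableAt ℝ (inChart x₀ V) (extChartAt (𝓡 m) x₀ x₀) := by
  have := isManifold_two (m := m) (M := M)
  have h := MDifferentiableWithinAt.differentiableWithinAt_mpullbackWithin_vectorField
    (I := 𝓡 m) (s := Set.univ) (x := x₀) (V := V)
    ((hV.mdifferentiableAt (by simp)).mdifferentiableWithinAt)
  have h0 : (extChartAt (𝓡 m) x₀).symm ⁻¹' Set.univ ∩ Set.range (𝓡 m) = Set.univ := by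
    rw [Set.preimage_univ, Set.univ_inter, ModelWithCorners.range_eq_univ]
  rw [h0] at h
  exact differentiableWithinAt_univ.1 h

variable [T2Space M]

/-- The derivative along the Lie bracket is the commutator of the derivatives. -/
lemma dirDeriv_mlieBracket {f : M → ℝ} (hf : ContMDiff (𝓡 m) 𝓘(ℝ, ℝ) ∞ f)
    {V W : ∀ x : M, TangentSpace (𝓡 m) x} {x₀ : M}
    (hV : ContMDiffAt (𝓡 m) ((𝓡 m).prod 𝓘(ℝ, EuclideanSpace ℝ (Fin m))) ∞
        (fun y => (⟨y, V y⟩ : TangentBundle (𝓡 m) M)) x₀)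
    (hW : ContMDiffAt (𝓡 m) ((𝓡 m).prod 𝓘(ℝ, EuclideanSpace ℝ (Fin m))) ∞
        (fun y => (⟨y, W y⟩ : TangentBundle (𝓡 m) M)) x₀) :
    dirDeriv f x₀ (VectorField.mlieBracket (𝓡 m) V W x₀) =
      dirDeriv (fun y => dirDeriv f y (W y)) x₀ (V x₀) -
        dirDeriv (fun y => dirDeriv f y (V y)) x₀ (W x₀) := by
  obtain ⟨F, hF, hfF⟩ := exists_contDiff_chart f hf x₀
  have hs := (chartAt (EuclideanSpace ℝ (Fin m)) x₀).open_source.mem_nhds (mem_chart_source _ x₀)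
  have hF1 : ∀ e, DifferentiableAt ℝ F e := fun e => hF.differentiable (by simp) e
  have hF2 : ∀ e, DifferentiableAt ℝ (fderiv ℝ F) e := fun e =>
    (hF.fderiv_right (m := ∞) (by simp)).differentiable (by simp) e
  -- In the chart, differentiating `f` along `V` is applying the derivative of `F` to the coordinate
  -- expression of `V`. The claim thus becomes the Euclidean identity, where the second derivatives
  -- of `F` cancel by symmetry.
  have key : ∀ {V : ∀ x : M, TangentSpace (𝓡 m) x}, ∀ᶠ y in nhds x₀, dirDeriv f y (V y) =
      (fun e => fderiv ℝ F e (inChart x₀ V e)) (extChartAt (𝓡 m) x₀ y) := fun {V} => by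
    filter_upwards [eventually_chartDeriv_eq_inChart x₀ V, hs, hfF.eventually_nhds] with y h1 h2 h3
    rw [dirDeriv_eq_fderiv h2 (hF1 _) h3, h1]
  have hV' := differentiableAt_inChart x₀ hV
  have hW' := differentiableAt_inChart x₀ hW
  rw [dirDeriv_eq_fderiv (mem_chart_source _ x₀) (hF1 _) hfF,
    dirDeriv_eq_fderiv (mem_chart_source _ x₀) ((hF2 _).clm_apply hW') key,
    dirDeriv_eq_fderiv (mem_chart_source _ x₀) ((hF2 _).clm_apply hV') key,
    chartDeriv_mlieBracket, (eventually_chartDeriv_eq_inChart x₀ V).self_of_nhds,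
    (eventually_chartDeriv_eq_inChart x₀ W).self_of_nhds]
  refine VectorField.fderiv_apply_lieBracket (n := ∞) hF.contDiffAt ?_ hW' hV'
  rw [minSmoothness_of_isRCLikeNormedField]
  exact ENat.LEInfty.out

end Bracket

/-! ### Functions dual to a local frame. -/

section Frame

variable {m : ℕ} {M : Type*} [TopologicalSpace M] [ChartedSpace (EuclideanSpace ℝ (Fin m)) M]
  [IsManifold (𝓡 m) ∞ M]

lemma contMDiff_det {d : ℕ} {A : M → Matrix (Fin d) (Fin d) ℝ}
    (hA : ∀ a b, ContMDiff (𝓡 m) 𝓘(ℝ, ℝ) ∞ fun y => A y a b) :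
    ContMDiff (𝓡 m) 𝓘(ℝ, ℝ) ∞ fun y => (A y).det := by
  simp only [Matrix.det_apply]
  refine contMDiff_finsetSum fun σ _ => ?_
  exact (contMDiff_const (c := ((Equiv.Perm.sign σ : ℤ) : ℝ))).mul
    (contMDiff_finsetProd (t := Finset.univ) fun i _ => hA (σ i) i) |>.congr fun y => by
      rw [Units.smul_def, zsmul_eq_mul]
      rfl

variable [T2Space M]

/-- The inverse is given by Cramer's rule where the determinant is nonzero; each entry is then
replaced by a global function with the same germ. -/
lemma exists_local_inverse {d : ℕ} {A : M → Matrix (Fin d) (Fin d) ℝ}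
    (hA : ∀ a b, ContMDiff (𝓡 m) 𝓘(ℝ, ℝ) ∞ fun y => A y a b) {x : M} (hx : (A x).det ≠ 0) :
    ∃ N : M → Matrix (Fin d) (Fin d) ℝ, (∀ a b, ContMDiff (𝓡 m) 𝓘(ℝ, ℝ) ∞ fun y => N y a b) ∧
      ∀ᶠ y in nhds x, A y * N y = 1 := by
  have hdet := contMDiff_det hA
  have hU : IsOpen {y | (A y).det ≠ 0} := isOpen_ne_fun hdet.continuous continuous_const
  have h : ∀ a b : Fin d, ∃ g : M → ℝ, ContMDiff (𝓡 m) 𝓘(ℝ, ℝ) ∞ g ∧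
      g =ᶠ[nhds x] fun y => ((A y).det)⁻¹ * (A y).adjugate a b := fun a b => by
    refine exists_contMDiff_eventuallyEq (U := ⟨_, hU⟩) hx ?_
    refine ContMDiffOn.mul (fun y hy => ?_) (ContMDiff.contMDiffOn ?_)
    · exact ((hdet y).inv₀ hy).contMDiffWithinAt
    · simp only [Matrix.adjugate_apply]
      refine contMDiff_det fun i j => ?_
      by_cases hi : i = b
      · subst hi
        simp only [Matrix.updateRow_self]
        exact contMDiff_const
      · simp only [Matrix.updateRow_ne hi]
        exact hA i j
  choose N hN hN' using h
  refine ⟨fun y => Matrix.of fun a b => N a b y, fun a b => hN a b, ?_⟩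
  filter_upwards [Filter.eventually_all.2 fun a => Filter.eventually_all.2 (hN' a), hU.mem_nhds hx]
    with y hy hdy
  have h1 : (Matrix.of fun a b => N a b y) = ((A y).det)⁻¹ • (A y).adjugate := by
    ext a b
    exact hy a b
  rw [h1, Matrix.mul_smul, Matrix.mul_adjugate, smul_smul, inv_mul_cancel₀ hdy, one_smul]

/-- Functions separating a local frame, with the inverse of the matrix of derivatives. -/
lemma exists_dual_functions {d : ℕ} {Z : Fin d → ∀ x : M, TangentSpace (𝓡 m) x}
    (hZ : ∀ a, ContMDiff (𝓡 m) ((𝓡 m).prod 𝓘(ℝ, EuclideanSpace ℝ (Fin m))) ∞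
        (fun y => (⟨y, Z a y⟩ : TangentBundle (𝓡 m) M))) {x : M}
    (hx : LinearIndependent ℝ fun a => Z a x) :
    ∃ (u : Fin d → SmoothFun m (⊤ : Opens M)) (N : Fin d → Fin d → SmoothFun m (⊤ : Opens M)),
      ∀ᶠ y in nhds x, ∀ a c, ∑ b, dirDeriv (u b).val y (Z a y) * (N b c).val y =
        if a = c then 1 else 0 := by
  have h1 : ∀ b, ∃ u : M → ℝ, ContMDiff (𝓡 m) 𝓘(ℝ, ℝ) ∞ u ∧
      ∀ a, dirDeriv u x (Z a x) = if a = b then 1 else 0 := fun b => by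
    -- The covector dual to `Z b x`, extended from the span of the frame. It makes the matrix of
    -- derivatives the identity at `x`, hence invertible nearby.
    obtain ⟨ℓ, hℓ⟩ := LinearMap.exists_extend
      ((Finsupp.lapply b : (Fin d →₀ ℝ) →ₗ[ℝ] ℝ) ∘ₗ hx.repr)
    obtain ⟨u, hu, hu'⟩ := exists_dirDeriv_eq x ℓ
    refine ⟨u, hu, fun a => ?_⟩
    have h2 := LinearMap.congr_fun hℓ ⟨Z a x, Submodule.subset_span ⟨a, rfl⟩⟩
    rw [LinearMap.comp_apply, LinearMap.comp_apply, hx.repr_eq_single a _ rfl, Finsupp.lapply_apply,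
      Finsupp.single_apply] at h2
    rw [hu']
    exact h2
  choose u hu hu' using h1
  let A : M → Matrix (Fin d) (Fin d) ℝ := fun y => Matrix.of fun a b => dirDeriv (u b) y (Z a y)
  have hA : ∀ a b, ContMDiff (𝓡 m) 𝓘(ℝ, ℝ) ∞ fun y => A y a b := fun a b y =>
    contMDiffAt_dirDeriv (hu b) (hZ a y)
  have hAx : A x = 1 := by
    ext a b
    rw [Matrix.one_apply]
    exact hu' b a
  obtain ⟨N, hN, hN'⟩ := exists_local_inverse hA (x := x) (by simp [hAx])
  refine ⟨fun b => SmoothFun.ofGlobal (u b) (hu b) ⊤,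
    fun b c => SmoothFun.ofGlobal (fun y => N y b c) (hN b c) ⊤, ?_⟩
  filter_upwards [hN'] with y hy a c
  have h3 := congrFun (congrFun hy a) c
  rw [Matrix.mul_apply, Matrix.one_apply] at h3
  exact h3

end Frame

/-! ### Functionals on a coalgebra and their convolution. -/

section Convolution

variable {V : Type*} [AddCommGroup V] [Module ℝ V]

/-- The convolution product of two functionals on a coalgebra. -/
def conv (Δ : V →ₗ[ℝ] V ⊗[ℝ] V) (η ζ : V →ₗ[ℝ] ℝ) : V →ₗ[ℝ] ℝ :=
  (TensorProduct.lid ℝ ℝ).toLinearMap ∘ₗ TensorProduct.map η ζ ∘ₗ Δ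

/-- The action of a functional on the coaugmented coalgebra `ℝ ⊕ V`. -/
def convAct (Δ : V →ₗ[ℝ] V ⊗[ℝ] V) : (V →ₗ[ℝ] ℝ) →ₗ[ℝ] Module.End ℝ (ℝ × V) where
  toFun φ := (φ.prod ((TensorProduct.rid ℝ V).toLinearMap ∘ₗ TensorProduct.map LinearMap.id φ ∘ₗ Δ)) ∘ₗ
    LinearMap.snd ℝ ℝ V
  map_add' φ ψ := by
    ext v <;> simp [TensorProduct.map_add_right]
  map_smul' c φ := by
    ext v <;> simp [TensorProduct.map_smul_right]

lemma convAct_apply (Δ : V →ₗ[ℝ] V ⊗[ℝ] V) (φ : V →ₗ[ℝ] ℝ) (p : ℝ × V) :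
    convAct Δ φ p = (φ p.2, TensorProduct.rid ℝ V (TensorProduct.map LinearMap.id φ (Δ p.2))) := rfl

/-- Coassociativity is what makes convolution the composition of operators on `ℝ ⊕ V`. The summand
`ℝ` makes the action faithful: the first component of `convAct Δ φ (0, v)` is `φ v`. -/
lemma convAct_mul (Δ : V →ₗ[ℝ] V ⊗[ℝ] V)
    (h : (TensorProduct.assoc ℝ V V V).toLinearMap ∘ₗ TensorProduct.map Δ LinearMap.id ∘ₗ Δ =
      TensorProduct.map LinearMap.id Δ ∘ₗ Δ) (η ζ : V →ₗ[ℝ] ℝ) :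
    convAct Δ η * convAct Δ ζ = convAct Δ (conv Δ η ζ) := by
  let R : V ⊗[ℝ] (V ⊗[ℝ] V) →ₗ[ℝ] V := (TensorProduct.rid ℝ V).toLinearMap ∘ₗ
    TensorProduct.map LinearMap.id ((TensorProduct.lid ℝ ℝ).toLinearMap ∘ₗ TensorProduct.map η ζ)
  have h1 : ∀ t : V ⊗[ℝ] V, η (TensorProduct.rid ℝ V (TensorProduct.map LinearMap.id ζ t)) =
      TensorProduct.lid ℝ ℝ (TensorProduct.map η ζ t) := fun t => by
    induction t with
    | zero => simp
    | add a b ha hb => simp only [map_add, ha, hb]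
    | tmul a b => simp [mul_comm]
  have h2 : ∀ t : V ⊗[ℝ] V, TensorProduct.rid ℝ V (TensorProduct.map LinearMap.id η
      (Δ (TensorProduct.rid ℝ V (TensorProduct.map LinearMap.id ζ t)))) =
      R (TensorProduct.assoc ℝ V V V (TensorProduct.map Δ LinearMap.id t)) := fun t => by
    induction t with
    | zero => simp
    | add a b ha hb => simp only [map_add, ha, hb]
    | tmul a b =>
      simp only [TensorProduct.map_tmul, LinearMap.id_apply, TensorProduct.rid_tmul, map_smul]
      generalize Δ a = s
      induction s with
      | zero => simp
      | add c d hc hd => simp only [map_add, TensorProduct.add_tmul, smul_add, hc, hd]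
      | tmul c d => simp [R, smul_smul, mul_comm]
  have h3 : ∀ t : V ⊗[ℝ] V, R (TensorProduct.map LinearMap.id Δ t) =
      TensorProduct.rid ℝ V (TensorProduct.map LinearMap.id (conv Δ η ζ) t) := fun t => by
    induction t with
    | zero => simp
    | add a b ha hb => simp only [map_add, ha, hb]
    | tmul a b => simp [R, conv]
  refine LinearMap.ext fun p => ?_
  rw [Module.End.mul_apply, convAct_apply, convAct_apply, convAct_apply]
  refine Prod.ext (h1 _) ((h2 _).trans ?_)
  rw [← h3]
  exact congrArg R (LinearMap.congr_fun h p.2)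

end Convolution

/-! ### Convolution on a graded cocommutative coalgebra. -/

section Graded

variable {n : ℕ} {W : Fin n → Type*} [∀ i, AddCommGroup (W i)] [∀ i, Module ℝ (W i)]

lemma map_gradedFlip {i j : Fin n} (η : W i →ₗ[ℝ] ℝ) (ζ : W j →ₗ[ℝ] ℝ)
    (t : (∀ i, W i) ⊗[ℝ] (∀ i, W i)) :
    TensorProduct.lid ℝ ℝ (TensorProduct.map (η ∘ₗ LinearMap.proj i) (ζ ∘ₗ LinearMap.proj j)
      (gradedFlip W t)) = (-1 : ℝ) ^ (deg i * deg j) *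
        TensorProduct.lid ℝ ℝ (TensorProduct.map (ζ ∘ₗ LinearMap.proj j) (η ∘ₗ LinearMap.proj i) t) := by
  have h : ∀ (k l : Fin n) (v : ∀ i, W i), homProj W k v l = if k = l then v l else 0 := by
    intro k l v
    by_cases hkl : k = l
    · subst hkl; simp [homProj, incl]
    · simp [homProj, incl, hkl, Ne.symm hkl]
  have h' : ∀ (k l : Fin n) (v : ∀ i, W i) (φ : W l →ₗ[ℝ] ℝ),
      φ (homProj W k v l) = if k = l then φ (v l) else 0 := by
    intro k l v φ
    rw [h]
    split_ifs <;> simp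
  induction t with
  | zero => simp
  | add a b ha hb => simp only [map_add, ha, hb, mul_add]
  | tmul a b =>
    simp only [gradedFlip, LinearMap.sum_apply, LinearMap.smul_apply, LinearMap.comp_apply, map_sum,
      map_smul, TensorProduct.map_tmul, LinearEquiv.coe_coe, TensorProduct.comm_tmul,
      TensorProduct.lid_tmul, LinearMap.proj_apply, h', smul_eq_mul]
    rw [Finset.sum_eq_single j, Finset.sum_eq_single i]
    · simp [mul_comm]
    · intro k _ hk
      simp [hk]
    · simp
    · intro k _ hk
      simp [hk]
    · simp

lemma map_eq_zero_of_mem_tensorDegree {i j : Fin n} {d : ℕ} (hd : deg i + deg j ≠ d)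
    (η : W i →ₗ[ℝ] ℝ) (ζ : W j →ₗ[ℝ] ℝ) {t : (∀ i, W i) ⊗[ℝ] (∀ i, W i)}
    (ht : t ∈ tensorDegree W d) :
    TensorProduct.lid ℝ ℝ (TensorProduct.map (η ∘ₗ LinearMap.proj i) (ζ ∘ₗ LinearMap.proj j) t) = 0 := by
  have h : tensorDegree W d ≤ LinearMap.ker ((TensorProduct.lid ℝ ℝ).toLinearMap ∘ₗ
      TensorProduct.map (η ∘ₗ LinearMap.proj i) (ζ ∘ₗ LinearMap.proj j)) := by
    refine iSup_le fun k => iSup_le fun l => iSup_le fun hkl => ?_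
    rintro _ ⟨s, rfl⟩
    rw [LinearMap.mem_ker]
    induction s with
    | zero => simp
    | add a b ha hb => rw [map_add, map_add, ha, hb, add_zero]
    | tmul a b =>
      by_cases hk : k = i
      · have hl : l ≠ j := by
          rintro rfl
          exact hd (hk ▸ hkl)
        simp [incl, Pi.single_eq_of_ne hl.symm]
      · simp [incl, Pi.single_eq_of_ne (Ne.symm hk)]
  exact h ht

variable {Δ : (∀ i, W i) →ₗ[ℝ] (∀ i, W i) ⊗[ℝ] (∀ i, W i)}

lemma IsGradedCoalgebra.conv_comm (hΔ : IsGradedCoalgebra Δ) {i j : Fin n}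
    (η : W i →ₗ[ℝ] ℝ) (ζ : W j →ₗ[ℝ] ℝ) :
    conv Δ (η ∘ₗ LinearMap.proj i) (ζ ∘ₗ LinearMap.proj j) = (-1 : ℝ) ^ (deg i * deg j) •
      conv Δ (ζ ∘ₗ LinearMap.proj j) (η ∘ₗ LinearMap.proj i) := by
  refine LinearMap.ext fun v => ?_
  have h := map_gradedFlip η ζ (Δ v)
  have h2 : gradedFlip W (Δ v) = Δ v := LinearMap.congr_fun hΔ.cocomm v
  rw [h2] at h
  exact h

/-- Since `Δ` preserves degrees, the product of functionals of degrees `i` and `j` lives on the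
component of degree `i + j` alone. This reconciles convolution on the total space with `μ^*`, which
is defined on that component. -/
lemma IsGradedCoalgebra.conv_eq (hΔ : IsGradedCoalgebra Δ) {i j l : Fin n}
    (h : deg i + deg j = deg l) (η : W i →ₗ[ℝ] ℝ) (ζ : W j →ₗ[ℝ] ℝ) :
    conv Δ (η ∘ₗ LinearMap.proj i) (ζ ∘ₗ LinearMap.proj j) =
      conv Δ (η ∘ₗ LinearMap.proj i) (ζ ∘ₗ LinearMap.proj j) ∘ₗ incl W l ∘ₗ LinearMap.proj l := by
  refine LinearMap.pi_ext fun k v => ?_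
  by_cases hk : k = l
  · subst hk
    simp [incl]
  · have h1 := map_eq_zero_of_mem_tensorDegree (d := deg k) (fun hd => hk (Fin.ext (by
      have := h.symm.trans hd
      simp only [deg] at this
      omega))) η ζ (hΔ.degree k v)
    simp only [LinearMap.comp_apply, LinearMap.proj_apply, Pi.single_eq_of_ne (Ne.symm hk), map_zero]
    exact h1

end Graded

/-! ### The presented algebra, its grading and its stalks. -/

section Stalks

variable {m n : ℕ} {M : Type*} [TopologicalSpace M] [ChartedSpace (EuclideanSpace ℝ (Fin m)) M]
  {Fib : Fin n → Type*} [∀ i, NormedAddCommGroup (Fib i)] [∀ i, NormedSpace ℝ (Fib i)]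
  [∀ i, FiniteDimensional ℝ (Fib i)]
  {E : Fin n → M → Type*} [∀ i, TopologicalSpace (TotalSpace (Fib i) (E i))]
  [∀ i x, AddCommGroup (E i x)] [∀ i x, Module ℝ (E i x)] [∀ i x, TopologicalSpace (E i x)]
  [∀ i, FiberBundle (Fib i) (E i)] [∀ i, VectorBundle ℝ (Fib i) (E i)]

namespace CoalgebraBundle

variable (μ : CoalgebraBundle m Fib E)

section Gen

variable {μ} {U : Opens M}

lemma gen_eq_of_rel {a b : FreeAlgebra ℝ (μ.Gen U)} (h : μ.FunRel U a b) :
    RingQuot.mkAlgHom ℝ (μ.FunRel U) a = RingQuot.mkAlgHom ℝ (μ.FunRel U) b :=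
  RingQuot.mkAlgHom_rel ℝ h

lemma gen_fn_add (f g : SmoothFun m U) : μ.gen (.fn (f + g)) = μ.gen (.fn f) + μ.gen (.fn g) :=
  (gen_eq_of_rel (.sym (.fn_add f g))).trans (map_add _ _ _)

lemma gen_fn_mul (f g : SmoothFun m U) : μ.gen (.fn (f * g)) = μ.gen (.fn f) * μ.gen (.fn g) :=
  (gen_eq_of_rel (.sym (.fn_mul f g))).trans (map_mul _ _ _)

lemma gen_fn_const (c : ℝ) :
    μ.gen (.fn (algebraMap ℝ (SmoothFun m U) c)) = algebraMap ℝ (μ.PreFun U) c :=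
  (gen_eq_of_rel (.sym (.fn_const c))).trans (AlgHom.commutes _ _)

lemma gen_fn_one : μ.gen (.fn (1 : SmoothFun m U)) = 1 := by
  have h := gen_fn_const (μ := μ) (U := U) 1
  rwa [map_one, map_one] at h

lemma gen_fn_zero : μ.gen (.fn (0 : SmoothFun m U)) = 0 := by
  have h := gen_fn_const (μ := μ) (U := U) 0
  rwa [map_zero, map_zero] at h

lemma gen_fn_smul (c : ℝ) (f : SmoothFun m U) : μ.gen (.fn (c • f)) = c • μ.gen (.fn f) := by
  rw [Algebra.smul_def, gen_fn_mul, gen_fn_const, Algebra.smul_def]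

lemma gen_sec_add (i : Fin n) (η ζ : DualSec m (Fib i) (E i) U) :
    μ.gen (.sec i (η + ζ)) = μ.gen (.sec i η) + μ.gen (.sec i ζ) :=
  (gen_eq_of_rel (.sym (.sec_add i η ζ))).trans (map_add _ _ _)

lemma gen_sec_fsmul (i : Fin n) (f : SmoothFun m U) (η : DualSec m (Fib i) (E i) U) :
    μ.gen (.sec i (DualSec.fsmul f η)) = μ.gen (.fn f) * μ.gen (.sec i η) :=
  (gen_eq_of_rel (.sym (.sec_fsmul i f η))).trans (map_mul _ _ _)

lemma gen_sec_smul (i : Fin n) (c : ℝ) (η : DualSec m (Fib i) (E i) U) :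
    μ.gen (.sec i (c • η)) = c • μ.gen (.sec i η) := by
  have h : c • η = DualSec.fsmul (algebraMap ℝ (SmoothFun m U) c) η := rfl
  rw [h, gen_sec_fsmul, gen_fn_const, Algebra.smul_def]

lemma gen_sec_zero (i : Fin n) : μ.gen (.sec i (0 : DualSec m (Fib i) (E i) U)) = 0 := by
  have h := gen_sec_smul (μ := μ) i 0 (0 : DualSec m (Fib i) (E i) U)
  rwa [zero_smul, zero_smul] at h

lemma gen_comm (a b : μ.Gen U) :
    μ.gen a * μ.gen b = (-1 : ℝ) ^ (a.degree * b.degree) • (μ.gen b * μ.gen a) := by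
  have h := gen_eq_of_rel (.sym (.comm a b))
  rw [map_mul, map_smul, map_mul] at h
  exact h

lemma gen_sec_mul {i j l : Fin n} (h : deg i + deg j = deg l)
    (η : DualSec m (Fib i) (E i) U) (ζ : DualSec m (Fib j) (E j) U) :
    μ.gen (.sec i η) * μ.gen (.sec j ζ) = μ.gen (.sec l (μ.mul h η ζ)) :=
  ((map_mul _ _ _).symm.trans (gen_eq_of_rel (.mul h η ζ)))

@[elab_as_elim]
lemma PreFun.induction {P : μ.PreFun U → Prop} (hgen : ∀ a, P (μ.gen a))
    (hc : ∀ c : ℝ, P (algebraMap ℝ _ c)) (hadd : ∀ a b, P a → P b → P (a + b))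
    (hmul : ∀ a b, P a → P b → P (a * b)) (a : μ.PreFun U) : P a := by
  obtain ⟨a, rfl⟩ := RingQuot.mkAlgHom_surjective ℝ (μ.FunRel U) a
  induction a using FreeAlgebra.induction with
  | grade0 r =>
    rw [AlgHom.commutes]
    exact hc r
  | grade1 x => exact hgen x
  | mul a b ha hb =>
    rw [map_mul]
    exact hmul _ _ ha hb
  | add a b ha hb =>
    rw [map_add]
    exact hadd _ _ ha hb

end Gen

section Homog

variable {μ} {U : Opens M}

lemma PreFun.gen_mem_homog (a : μ.Gen U) : μ.gen a ∈ PreFun.homog μ U a.degree :=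
  Submodule.subset_span ⟨[a], by simp, by simp⟩

lemma PreFun.mul_mem_homog {k l : ℤ} {a b : μ.PreFun U} (ha : a ∈ PreFun.homog μ U k)
    (hb : b ∈ PreFun.homog μ U l) : a * b ∈ PreFun.homog μ U (k + l) := by
  unfold PreFun.homog at ha hb
  induction ha using Submodule.span_induction with
  | mem a ha =>
    obtain ⟨L, hL, rfl⟩ := ha
    induction hb using Submodule.span_induction with
    | mem b hb =>
      obtain ⟨L', hL', rfl⟩ := hb
      refine Submodule.subset_span ⟨L ++ L', ?_, by simp⟩
      rw [← hL, ← hL']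
      simp
    | zero => rw [mul_zero]; exact zero_mem _
    | add b c _ _ hb hc => rw [mul_add]; exact add_mem hb hc
    | smul r b _ hb => rw [mul_smul_comm]; exact Submodule.smul_mem _ _ hb
  | zero => rw [zero_mul]; exact zero_mem _
  | add b c _ _ hb hc => rw [add_mul]; exact add_mem hb hc
  | smul r b _ hb => rw [smul_mul_assoc]; exact Submodule.smul_mem _ _ hb

lemma PreFun.mul_comm_gen_list (a : μ.Gen U) (L : List (μ.Gen U)) :
    μ.gen a * (L.map μ.gen).prod =
      (-1 : ℝ) ^ (a.degree * (L.map Gen.degree).sum) • ((L.map μ.gen).prod * μ.gen a) := by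
  induction L with
  | nil => simp
  | cons b L ih =>
    rw [List.map_cons, List.prod_cons, ← mul_assoc, gen_comm, smul_mul_assoc, mul_assoc, ih,
      mul_smul_comm, smul_smul, ← mul_assoc, List.map_cons, List.sum_cons, mul_add, pow_add]

lemma PreFun.mul_comm_list (L L' : List (μ.Gen U)) :
    (L.map μ.gen).prod * (L'.map μ.gen).prod =
      (-1 : ℝ) ^ ((L.map Gen.degree).sum * (L'.map Gen.degree).sum) •
        ((L'.map μ.gen).prod * (L.map μ.gen).prod) := by
  induction L with
  | nil => simp
  | cons b L ih =>
    rw [List.map_cons, List.prod_cons, mul_assoc, ih, mul_smul_comm, ← mul_assoc,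
      PreFun.mul_comm_gen_list, smul_mul_assoc, smul_smul, mul_assoc, List.map_cons, List.sum_cons,
      add_mul, pow_add, mul_comm ((-1 : ℝ) ^ _)]

lemma PreFun.mul_comm_homog {k l : ℤ} {a b : μ.PreFun U} (ha : a ∈ PreFun.homog μ U k)
    (hb : b ∈ PreFun.homog μ U l) : a * b = sgn (k * l) • (b * a) := by
  unfold PreFun.homog at ha hb
  induction ha using Submodule.span_induction with
  | mem a ha =>
    obtain ⟨L, hL, rfl⟩ := ha
    induction hb using Submodule.span_induction with
    | mem b hb =>
      obtain ⟨L', hL', rfl⟩ := hb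
      rw [PreFun.mul_comm_list, ← hL, ← hL', sgn, ← Nat.cast_mul, zpow_natCast]
    | zero => simp
    | add b c _ _ hb hc => rw [mul_add, hb, hc, add_mul, smul_add]
    | smul r b _ hb => rw [mul_smul_comm, hb, smul_mul_assoc, smul_comm]
  | zero => simp
  | add b c _ _ hb hc => rw [add_mul, hb, hc, mul_add, smul_add]
  | smul r b _ hb => rw [smul_mul_assoc, hb, mul_smul_comm, smul_comm]

lemma PreFun.res_mem_homog {V : Opens M} (h : V ≤ U) {k : ℤ} {a : μ.PreFun U}
    (ha : a ∈ PreFun.homog μ U k) : PreFun.res μ h a ∈ PreFun.homog μ V k := by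
  unfold PreFun.homog at ha
  induction ha using Submodule.span_induction with
  | mem a ha =>
    obtain ⟨L, hL, rfl⟩ := ha
    refine Submodule.subset_span ⟨L.map (Gen.res h), ?_, ?_⟩
    · rw [List.map_map, ← hL]
      congr 2
      exact List.map_congr_left fun b _ => Gen.degree_res h b
    · rw [map_list_prod, List.map_map, List.map_map]
      congr 1
      exact List.map_congr_left fun b _ => PreFun.res_gen μ h b
  | zero => rw [map_zero]; exact zero_mem _
  | add b c _ _ hb hc => rw [map_add]; exact add_mem hb hc
  | smul r b _ hb => rw [map_smul]; exact Submodule.smul_mem _ _ hb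

lemma PreFun.iSup_homog (a : μ.PreFun U) : a ∈ ⨆ k : ℤ, PreFun.homog μ U k := by
  induction a using PreFun.induction with
  | hgen a => exact Submodule.mem_iSup_of_mem _ (PreFun.gen_mem_homog a)
  | hc c =>
    rw [← gen_fn_const]
    exact Submodule.mem_iSup_of_mem _ (PreFun.gen_mem_homog _)
  | hadd a b ha hb => exact add_mem ha hb
  | hmul a b ha hb =>
    induction ha using Submodule.iSup_induction' with
    | mem k a ha =>
      induction hb using Submodule.iSup_induction' with
      | mem l b hb => exact Submodule.mem_iSup_of_mem _ (PreFun.mul_mem_homog ha hb)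
      | zero => rw [mul_zero]; exact zero_mem _
      | add b c _ _ hb hc => rw [mul_add]; exact add_mem hb hc
    | zero => rw [zero_mul]; exact zero_mem _
    | add b c _ _ hb hc => rw [add_mul]; exact add_mem hb hc

/-- Up to degree `n` the relations of `I_μ` absorb a product of sections into one section, and
functions are absorbed by the module relations. Hence the parts of degrees `0, …, n` consist of
generators. -/
lemma PreFun.prod_eq_gen (L : List (μ.Gen U)) (hL : (L.map Gen.degree).sum ≤ n) :
    ((L.map Gen.degree).sum = 0 ∧ ∃ f, (L.map μ.gen).prod = μ.gen (.fn f)) ∨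
      ∃ i η, (L.map Gen.degree).sum = deg i ∧ (L.map μ.gen).prod = μ.gen (.sec i η) := by
  induction L with
  | nil => exact Or.inl ⟨rfl, 1, by rw [gen_fn_one]; rfl⟩
  | cons a L ih =>
    rw [List.map_cons, List.sum_cons] at hL ⊢
    rw [List.map_cons, List.prod_cons]
    rcases ih (by omega) with ⟨h0, f, hf⟩ | ⟨j, ζ, hj, hζ⟩
    · cases a with
      | fn g => exact Or.inl ⟨by rw [h0]; rfl, g * f, by rw [hf, gen_fn_mul]⟩
      | sec i η =>
        refine Or.inr ⟨i, DualSec.fsmul f η, by rw [h0]; rfl, ?_⟩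
        rw [hf, gen_sec_fsmul, gen_comm]
        simp [Gen.degree]
    · cases a with
      | fn g => exact Or.inr ⟨j, DualSec.fsmul g ζ, by rw [hj]; simp [Gen.degree], by
          rw [hζ, gen_sec_fsmul]⟩
      | sec i η =>
        rw [hj] at hL ⊢
        have h1 : deg i + deg j ≤ n := hL
        -- The component of degree `d` has index `d - 1`; this index is in range exactly because the
        -- total degree is at most `n`.
        have h2 : deg i + deg j = deg (⟨deg i + deg j - 1, by simp only [deg] at h1 ⊢; omega⟩ : Fin n) := by
          simp only [deg]; omega
        exact Or.inr ⟨_, μ.mul h2 η ζ, h2, by rw [hζ, gen_sec_mul h2]⟩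

lemma PreFun.exists_fn_of_mem_homog {a : μ.PreFun U} (ha : a ∈ PreFun.homog μ U 0) :
    ∃ f, a = μ.gen (.fn f) := by
  unfold PreFun.homog at ha
  induction ha using Submodule.span_induction with
  | mem a ha =>
    obtain ⟨L, hL, rfl⟩ := ha
    have hL : (L.map Gen.degree).sum = 0 := by exact_mod_cast hL
    rcases PreFun.prod_eq_gen L (by omega) with ⟨_, h⟩ | ⟨i, η, h, -⟩
    · exact h
    · simp only [deg] at h
      omega
  | zero => exact ⟨0, gen_fn_zero.symm⟩
  | add b c _ _ hb hc =>
    obtain ⟨f, rfl⟩ := hb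
    obtain ⟨g, rfl⟩ := hc
    exact ⟨f + g, (gen_fn_add f g).symm⟩
  | smul r b _ hb =>
    obtain ⟨f, rfl⟩ := hb
    exact ⟨r • f, (gen_fn_smul r f).symm⟩

lemma PreFun.exists_sec_of_mem_homog {i : Fin n} {a : μ.PreFun U}
    (ha : a ∈ PreFun.homog μ U (deg i)) : ∃ η, a = μ.gen (.sec i η) := by
  unfold PreFun.homog at ha
  induction ha using Submodule.span_induction with
  | mem a ha =>
    obtain ⟨L, hL, rfl⟩ := ha
    have hL : (L.map Gen.degree).sum = deg i := by exact_mod_cast hL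
    rcases PreFun.prod_eq_gen L (by rw [hL]; exact i.2) with ⟨h0, -⟩ | ⟨j, η, h, h'⟩
    · rw [hL] at h0
      simp only [deg] at h0
      omega
    · obtain rfl : i = j := Fin.ext (by have := hL.symm.trans h; simp only [deg] at this; omega)
      exact ⟨η, h'⟩
  | zero => exact ⟨0, (gen_sec_zero i).symm⟩
  | add b c _ _ hb hc =>
    obtain ⟨f, rfl⟩ := hb
    obtain ⟨g, rfl⟩ := hc
    exact ⟨f + g, (gen_sec_add i f g).symm⟩
  | smul r b _ hb =>
    obtain ⟨f, rfl⟩ := hb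
    exact ⟨r • f, (gen_sec_smul i r f).symm⟩

end Homog

/-! ### The representation of functions on `ℝ ⊕ E_x`. -/

section Eval

/-- The endomorphism of the coaugmented coalgebra `ℝ ⊕ E_x` defined by a generator. -/
def Gen.act {μ : CoalgebraBundle m Fib E} {U : Opens M} {x : M} (hx : x ∈ U) :
    μ.Gen U → Module.End ℝ (ℝ × ∀ i, E i x)
  | .fn f => algebraMap ℝ _ (f ⟨x, hx⟩)
  | .sec i η => convAct (μ.comul x) ((η.1 ⟨x, hx⟩).toLinearMap ∘ₗ LinearMap.proj i)

/-- The action of `PreFun U` on the coaugmented coalgebra `ℝ ⊕ E_x`. -/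
def PreFun.act {U : Opens M} {x : M} (hx : x ∈ U) :
    μ.PreFun U →ₐ[ℝ] Module.End ℝ (ℝ × ∀ i, E i x) :=
  PreFun.lift μ (Gen.act hx) (by
    have hmul := convAct_mul (μ.comul x) (μ.isCoalgebra x).coassoc
    intro a b hab
    cases hab with
    | sym hab =>
      cases hab with
      | fn_add f g =>
        simp only [map_add, FreeAlgebra.lift_ι_apply]
        exact map_add _ _ _
      | fn_mul f g =>
        simp only [map_mul, FreeAlgebra.lift_ι_apply]
        exact map_mul _ _ _
      | fn_const c =>
        simp only [FreeAlgebra.lift_ι_apply, AlgHom.commutes]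
        rfl
      | sec_add i η ζ =>
        simp only [map_add, FreeAlgebra.lift_ι_apply]
        exact map_add (convAct (μ.comul x)) ((η.1 ⟨x, hx⟩).toLinearMap ∘ₗ LinearMap.proj i)
          ((ζ.1 ⟨x, hx⟩).toLinearMap ∘ₗ LinearMap.proj i)
      | sec_fsmul i f η =>
        simp only [map_mul, FreeAlgebra.lift_ι_apply]
        refine (map_smul (convAct (μ.comul x)) (f ⟨x, hx⟩) ((η.1 ⟨x, hx⟩).toLinearMap ∘ₗ LinearMap.proj i)).trans ?_
        exact Algebra.smul_def _ _
      | comm a b =>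
        simp only [map_mul, map_smul, FreeAlgebra.lift_ι_apply]
        cases a with
        | fn f =>
          simp only [Gen.degree, zero_mul, pow_zero, one_smul]
          exact Algebra.commutes _ _
        | sec i η =>
          cases b with
          | fn f =>
            simp only [Gen.degree, mul_zero, pow_zero, one_smul]
            exact (Algebra.commutes _ _).symm
          | sec j ζ =>
            simp only [Gen.act, hmul, Gen.degree]
            rw [(μ.isCoalgebra x).conv_comm, map_smul]
    | mul hd η ζ =>
      simp only [map_mul, FreeAlgebra.lift_ι_apply]
      simp only [Gen.act, hmul]
      rw [(μ.isCoalgebra x).conv_eq hd]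
      rfl)

lemma PreFun.act_gen {U : Opens M} {x : M} (hx : x ∈ U) (a : μ.Gen U) :
    PreFun.act μ hx (μ.gen a) = a.act hx := PreFun.lift_gen μ _ _ a

lemma PreFun.act_res {U V : Opens M} (h : V ≤ U) {x : M} (hx : x ∈ V) (a : μ.PreFun U) :
    PreFun.act μ hx (PreFun.res μ h a) = PreFun.act μ (h hx) a := by
  have : (PreFun.act μ hx).comp (PreFun.res μ h) = PreFun.act μ (h hx) := by
    refine PreFun.hom_ext μ fun a => ?_
    rw [AlgHom.comp_apply, PreFun.res_gen, PreFun.act_gen, PreFun.act_gen]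
    cases a <;> rfl
  rw [← this]; rfl

/-- The action of the stalk at `x` on the coaugmented coalgebra `ℝ ⊕ E_x`. -/
def Stalk.act (x : M) : μ.Stalk x →ₐ[ℝ] Module.End ℝ (ℝ × ∀ i, E i x) :=
  DirectLimit.Algebra.lift _ (μ.nhdsRes x) _
    (fun U => PreFun.act μ (OrderDual.ofDual U).mem)
    (fun _ _ h a => PreFun.act_res μ h _ a)

lemma PreFun.eval_fn {U : Opens M} {x : M} (hx : x ∈ U) (f : SmoothFun m U) :
    PreFun.eval μ hx (μ.gen (.fn f)) = f ⟨x, hx⟩ := PreFun.lift_gen μ _ _ _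

lemma PreFun.eval_sec {U : Opens M} {x : M} (hx : x ∈ U) (i : Fin n)
    (η : DualSec m (Fib i) (E i) U) : PreFun.eval μ hx (μ.gen (.sec i η)) = 0 :=
  PreFun.lift_gen μ _ _ _

/-- The representation exists to give this formula: a section can be read off from its class, so
dividing by `I_μ` does not collapse it. -/
lemma PreFun.act_sec_apply {U : Opens M} {x : M} (hx : x ∈ U) (i : Fin n)
    (η : DualSec m (Fib i) (E i) U) (v : ∀ i, E i x) :
    (PreFun.act μ hx (μ.gen (.sec i η)) (0, v)).1 = η.1 ⟨x, hx⟩ (v i) := by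
  rw [PreFun.act_gen]
  rfl

lemma PreFun.eval_eq_zero {U : Opens M} {x : M} (hx : x ∈ U) {k : ℤ} (hk : k ≠ 0)
    {a : μ.PreFun U} (ha : a ∈ PreFun.homog μ U k) : PreFun.eval μ hx a = 0 := by
  unfold PreFun.homog at ha
  induction ha using Submodule.span_induction with
  | mem a ha =>
    obtain ⟨L, hL, rfl⟩ := ha
    rw [map_list_prod]
    refine List.prod_eq_zero ?_
    have h : ∃ b ∈ L, b.degree ≠ 0 := by
      by_contra! h
      refine hk ?_
      rw [← hL, List.sum_eq_zero]
      · rfl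
      · intro d hd
        obtain ⟨b, hb, rfl⟩ := List.mem_map.1 hd
        exact h b hb
    obtain ⟨b, hb, hb'⟩ := h
    cases b with
    | fn f => exact absurd rfl hb'
    | sec i η =>
      rw [List.mem_map]
      exact ⟨_, List.mem_map.2 ⟨_, hb, rfl⟩, PreFun.eval_sec μ hx i η⟩
  | zero => rw [map_zero]
  | add b c _ _ hb hc => rw [map_add, hb, hc, add_zero]
  | smul r b _ hb => rw [map_smul, hb, smul_zero]

end Eval

section Stalk

variable {μ}

lemma exists_germ {x : M} (s : μ.Stalk x) : ∃ (U : Opens M) (hx : x ∈ U) (a : μ.PreFun U),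
    s = μ.germ hx a := by
  obtain ⟨U, a, h⟩ := DirectLimit.exists_eq_mk (μ.nhdsRes x) s
  exact ⟨_, (OrderDual.ofDual U).mem, a, h⟩

lemma germ_eq_iff {x : M} {U V : Opens M} (hU : x ∈ U) (hV : x ∈ V) {a : μ.PreFun U}
    {b : μ.PreFun V} (h : μ.germ hU a = μ.germ hV b) : ∃ (W : Opens M) (_ : x ∈ W) (h₁ : W ≤ U)
      (h₂ : W ≤ V), PreFun.res μ h₁ a = PreFun.res μ h₂ b := by
  obtain ⟨W, h1, h2, h3⟩ := Quotient.exact h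
  exact ⟨_, (OrderDual.ofDual W).mem, h1, h2, h3⟩

lemma germ_eq_of_res_eq {x : M} {U V W : Opens M} (hx : x ∈ W) (h₁ : W ≤ U) (h₂ : W ≤ V)
    {a : μ.PreFun U} {b : μ.PreFun V} (h : PreFun.res μ h₁ a = PreFun.res μ h₂ b) :
    μ.germ (h₁ hx) a = μ.germ (h₂ hx) b := by
  rw [← germ_res μ h₁ hx, h, germ_res]

lemma germ_mem_homog {x : M} {U : Opens M} (hx : x ∈ U) {k : ℤ} {a : μ.PreFun U}
    (ha : a ∈ PreFun.homog μ U k) : μ.germ hx a ∈ Stalk.homog μ x k :=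
  Submodule.mem_iSup_of_mem U (Submodule.mem_iSup_of_mem hx (Submodule.mem_map_of_mem ha))

lemma Stalk.exists_germ_of_mem_homog {x : M} {k : ℤ} {s : μ.Stalk x} (hs : s ∈ Stalk.homog μ x k) :
    ∃ (U : Opens M) (hx : x ∈ U), ∃ a ∈ PreFun.homog μ U k, s = μ.germ hx a := by
  unfold Stalk.homog at hs
  induction hs using Submodule.iSup_induction' with
  | mem U s hs =>
    induction hs using Submodule.iSup_induction' with
    | mem hx s hs =>
      obtain ⟨a, ha, rfl⟩ := hs
      exact ⟨U, hx, a, ha, rfl⟩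
    | zero => exact ⟨⊤, Opens.mem_top x, 0, zero_mem _, (map_zero _).symm⟩
    | add s t _ _ hs ht =>
      obtain ⟨U, hU, a, ha, rfl⟩ := hs
      obtain ⟨V, hV, b, hb, rfl⟩ := ht
      exact ⟨U ⊓ V, Opens.mem_inf.2 ⟨hU, hV⟩, _, add_mem (PreFun.res_mem_homog inf_le_left ha)
        (PreFun.res_mem_homog inf_le_right hb), by rw [map_add, germ_res, germ_res]⟩
  | zero => exact ⟨⊤, Opens.mem_top x, 0, zero_mem _, (map_zero _).symm⟩
  | add s t _ _ hs ht =>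
    obtain ⟨U, hU, a, ha, rfl⟩ := hs
    obtain ⟨V, hV, b, hb, rfl⟩ := ht
    exact ⟨U ⊓ V, Opens.mem_inf.2 ⟨hU, hV⟩, _, add_mem (PreFun.res_mem_homog inf_le_left ha)
      (PreFun.res_mem_homog inf_le_right hb), by rw [map_add, germ_res, germ_res]⟩

lemma Stalk.mul_mem_homog {x : M} {k l : ℤ} {s t : μ.Stalk x} (hs : s ∈ Stalk.homog μ x k)
    (ht : t ∈ Stalk.homog μ x l) : s * t ∈ Stalk.homog μ x (k + l) := by
  obtain ⟨U, hU, a, ha, rfl⟩ := Stalk.exists_germ_of_mem_homog hs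
  obtain ⟨V, hV, b, hb, rfl⟩ := Stalk.exists_germ_of_mem_homog ht
  rw [← germ_res μ (inf_le_left : U ⊓ V ≤ U) (Opens.mem_inf.2 ⟨hU, hV⟩),
    ← germ_res μ (inf_le_right : U ⊓ V ≤ V) (Opens.mem_inf.2 ⟨hU, hV⟩), ← map_mul]
  exact germ_mem_homog _ (PreFun.mul_mem_homog (PreFun.res_mem_homog _ ha) (PreFun.res_mem_homog _ hb))

lemma Stalk.mul_comm_homog {x : M} {k l : ℤ} {s t : μ.Stalk x} (hs : s ∈ Stalk.homog μ x k)
    (ht : t ∈ Stalk.homog μ x l) : s * t = sgn (k * l) • (t * s) := by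
  obtain ⟨U, hU, a, ha, rfl⟩ := Stalk.exists_germ_of_mem_homog hs
  obtain ⟨V, hV, b, hb, rfl⟩ := Stalk.exists_germ_of_mem_homog ht
  rw [← germ_res μ (inf_le_left : U ⊓ V ≤ U) (Opens.mem_inf.2 ⟨hU, hV⟩),
    ← germ_res μ (inf_le_right : U ⊓ V ≤ V) (Opens.mem_inf.2 ⟨hU, hV⟩), ← map_mul,
    PreFun.mul_comm_homog (PreFun.res_mem_homog _ ha) (PreFun.res_mem_homog _ hb), map_smul, map_mul]

lemma Stalk.iSup_homog {x : M} (s : μ.Stalk x) : s ∈ ⨆ k : ℤ, Stalk.homog μ x k := by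
  obtain ⟨U, hU, a, rfl⟩ := exists_germ s
  have h := PreFun.iSup_homog a
  induction h using Submodule.iSup_induction' with
  | mem k a ha => exact Submodule.mem_iSup_of_mem k (germ_mem_homog hU ha)
  | zero => rw [map_zero]; exact zero_mem _
  | add a b _ _ ha hb => rw [map_add]; exact add_mem ha hb

lemma Stalk.one_mem_homog (x : M) : (1 : μ.Stalk x) ∈ Stalk.homog μ x 0 := by
  have h := germ_mem_homog (Opens.mem_top x) (PreFun.gen_mem_homog (μ := μ) (.fn 1))
  rw [gen_fn_one, map_one] at h
  exact h

lemma Stalk.eval_eq_zero {x : M} {k : ℤ} (hk : k ≠ 0) {s : μ.Stalk x}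
    (hs : s ∈ Stalk.homog μ x k) : Stalk.eval μ x s = 0 := by
  obtain ⟨U, hU, a, ha, rfl⟩ := Stalk.exists_germ_of_mem_homog hs
  exact PreFun.eval_eq_zero μ hU hk ha

end Stalk

end CoalgebraBundle

end Stalks

/-! ### Local nature and extension of sections of the dual bundles. -/

section DualSections

variable {m : ℕ} {M : Type*} [TopologicalSpace M] [ChartedSpace (EuclideanSpace ℝ (Fin m)) M]
  {Fib : Type*} [NormedAddCommGroup Fib] [NormedSpace ℝ Fib]
  {E : M → Type*} [TopologicalSpace (TotalSpace Fib E)]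
  [∀ x, AddCommGroup (E x)] [∀ x, Module ℝ (E x)] [∀ x, TopologicalSpace (E x)]
  [FiberBundle Fib E] [VectorBundle ℝ Fib E]

/-- Sections over `U` and `V` live on different subtypes. Extending both by zero to `M` lets their
germs be compared there. -/
lemma isSmoothDual_of_local {U : Opens M} {η : ∀ x : U, E x →L[ℝ] ℝ}
    (h : ∀ x ∈ U, ∃ V : Opens M, x ∈ V ∧ ∃ ζ : DualSec m Fib E V,
      ∀ (y : M) (hU : y ∈ U) (hV : y ∈ V), η ⟨y, hU⟩ = ζ.1 ⟨y, hV⟩) :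
    IsSmoothDual m Fib E U η := by
  classical
  rintro ⟨x, hx⟩
  obtain ⟨V, hxV, ζ, hζ⟩ := h x hx
  let F : M → TotalSpace (Fib →L[ℝ] ℝ) (fun y : M => E y →L[ℝ] Bundle.Trivial M ℝ y) := fun y =>
    TotalSpace.mk' (Fib →L[ℝ] ℝ) y (if hy : y ∈ U then (η ⟨y, hy⟩ : E y →L[ℝ] ℝ) else 0)
  let G : M → TotalSpace (Fib →L[ℝ] ℝ) (fun y : M => E y →L[ℝ] Bundle.Trivial M ℝ y) := fun y =>
    TotalSpace.mk' (Fib →L[ℝ] ℝ) y (if hy : y ∈ V then (ζ.1 ⟨y, hy⟩ : E y →L[ℝ] ℝ) else 0)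
  have h1 : ContMDiffAt (𝓡 m) ((𝓡 m).prod 𝓘(ℝ, Fib →L[ℝ] ℝ)) ∞ G x := by
    refine (contMDiffAt_subtype_iff (U := V) (x := ⟨x, hxV⟩)).1 ?_
    refine (ζ.2 ⟨x, hxV⟩).congr_of_eventuallyEq (Filter.Eventually.of_forall fun y => ?_)
    simp only [G]
    rw [dif_pos y.2]
  have h2 : ContMDiffAt (𝓡 m) ((𝓡 m).prod 𝓘(ℝ, Fib →L[ℝ] ℝ)) ∞ F x := by
    refine h1.congr_of_eventuallyEq ?_
    filter_upwards [U.isOpen.mem_nhds hx, V.isOpen.mem_nhds hxV] with y (hyU : y ∈ U) (hyV : y ∈ V)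
    simp only [F, G]
    rw [dif_pos hyU, dif_pos hyV, hζ y hyU hyV]
  refine ((contMDiffAt_subtype_iff (U := U) (x := ⟨x, hx⟩)).2 h2).congr_of_eventuallyEq
    (Filter.Eventually.of_forall fun y => ?_)
  simp only [F]
  rw [dif_pos y.2]

lemma DualSec.ext {U : Opens M} {η ζ : DualSec m Fib E U} (h : ∀ x, η.1 x = ζ.1 x) : η = ζ :=
  Subtype.ext (funext h)

variable [T2Space M] [IsManifold (𝓡 m) ∞ M]

lemma DualSec.exists_extension {U : Opens M} (η : DualSec m Fib E U) {x : M} (hx : x ∈ U) :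
    ∃ (ζ : DualSec m Fib E (⊤ : Opens M)) (W : Opens M), x ∈ W ∧ ∃ h : W ≤ U,
      DualSec.res le_top ζ = DualSec.res h η := by
  classical
  obtain ⟨ρ, hρ, h1, h2, -⟩ := exists_bump m hx
  let ζ : ∀ y : (⊤ : Opens M), E y →L[ℝ] ℝ := fun y =>
    if h : (y : M) ∈ U then ρ y • η.1 ⟨y, h⟩ else 0
  have hζ : IsSmoothDual m Fib E ⊤ ζ := by
    refine isSmoothDual_of_local fun y _ => ?_
    by_cases hy : y ∈ U
    · refine ⟨U, hy, DualSec.fsmul (SmoothFun.ofGlobal ρ hρ U) η, fun z _ hz => ?_⟩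
      exact dif_pos hz
    · refine ⟨⟨(tsupport ρ)ᶜ, (isClosed_tsupport ρ).isOpen_compl⟩, fun h => hy (h2 h), 0,
        fun z _ hz => ?_⟩
      by_cases hzU : z ∈ U
      · refine (dif_pos hzU).trans ?_
        rw [image_eq_zero_of_notMem_tsupport hz, zero_smul]
        rfl
      · exact dif_neg hzU
  obtain ⟨W, hxW, hW⟩ := exists_open_nhds (h1.and (U.isOpen.mem_nhds hx))
  refine ⟨⟨ζ, hζ⟩, W, hxW, fun y hy => (hW y hy).2, DualSec.ext fun y => ?_⟩
  have h3 : ρ y = 1 := (hW y y.2).1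
  refine (dif_pos (hW y y.2).2).trans ((congrArg (· • η.1 ⟨y, (hW y y.2).2⟩) h3).trans (one_smul _ _))

end DualSections

/-! ### The structure sheaf in degrees `0, …, n`. -/

section Functions

variable {m n : ℕ} {M : Type*} [TopologicalSpace M] [ChartedSpace (EuclideanSpace ℝ (Fin m)) M]
  [T2Space M] [IsManifold (𝓡 m) ∞ M]
  {Fib : Fin n → Type*} [∀ i, NormedAddCommGroup (Fib i)] [∀ i, NormedSpace ℝ (Fib i)]
  [∀ i, FiniteDimensional ℝ (Fib i)]
  {E : Fin n → M → Type*} [∀ i, TopologicalSpace (TotalSpace (Fib i) (E i))]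
  [∀ i x, AddCommGroup (E i x)] [∀ i x, Module ℝ (E i x)] [∀ i x, TopologicalSpace (E i x)]
  [∀ i, FiberBundle (Fib i) (E i)] [∀ i, VectorBundle ℝ (Fib i) (E i)]

namespace CoalgebraBundle

variable {μ : CoalgebraBundle m Fib E}

section Basic

variable {U V : Opens M}

lemma Fun.ext {s t : μ.Fun U} (h : ∀ (x : M) (hx : x ∈ U), s.1 ⟨x, hx⟩ = t.1 ⟨x, hx⟩) : s = t :=
  Subtype.ext (funext fun x => h x x.2)

variable (μ) in
/-- The germ at `x` of a function over `U`. -/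
def stalkAt {x : M} (hx : x ∈ U) : μ.Fun U →ₐ[ℝ] μ.Stalk x :=
  (Pi.evalAlgHom ℝ (fun x : U => μ.Stalk (x : M)) ⟨x, hx⟩).comp (μ.funSubalgebra U).val

lemma Fun.ext_stalkAt {s t : μ.Fun U} (h : ∀ (x : M) (hx : x ∈ U), μ.stalkAt hx s = μ.stalkAt hx t) :
    s = t := Fun.ext h

lemma stalkAt_res (h : V ≤ U) {x : M} (hx : x ∈ V) (s : μ.Fun U) :
    μ.stalkAt hx (Fun.res μ h s) = μ.stalkAt (h hx) s := rfl

lemma stalkAt_toFun {x : M} (hx : x ∈ U) (a : μ.PreFun U) :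
    μ.stalkAt hx (μ.toFun a) = μ.germ hx a := rfl

lemma res_toFun (h : V ≤ U) (a : μ.PreFun U) :
    Fun.res μ h (μ.toFun a) = μ.toFun (PreFun.res μ h a) :=
  Fun.ext fun _ hx => (germ_res μ h hx a).symm

lemma res_ofFn (h : V ≤ U) (f : SmoothFun m U) :
    Fun.res μ h (μ.ofFn f) = μ.ofFn (f.res h) := by
  unfold ofFn
  rw [res_toFun, PreFun.res_gen]
  rfl

lemma res_ofSec (h : V ≤ U) (i : Fin n) (η : DualSec m (Fib i) (E i) U) :
    Fun.res μ h (μ.ofSec i η) = μ.ofSec i (DualSec.res h η) := by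
  unfold ofSec
  rw [res_toFun, PreFun.res_gen]
  rfl

lemma bodyVal_eq (x : U) (s : μ.Fun U) : μ.bodyVal x s = Stalk.eval μ (x : M) (μ.stalkAt x.2 s) := rfl

lemma mem_homog_iff {k : ℤ} {s : μ.Fun U} :
    s ∈ μ.homog U k ↔ ∀ (x : M) (hx : x ∈ U), μ.stalkAt hx s ∈ Stalk.homog μ x k :=
  ⟨fun h x hx => h ⟨x, hx⟩, fun h x => h x x.2⟩

lemma exists_local (s : μ.Fun U) {x : M} (hx : x ∈ U) :
    ∃ (W : Opens M) (h : W ≤ U) (a : μ.PreFun W), x ∈ W ∧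
      ∀ (y : M) (hy : y ∈ W), μ.stalkAt (h hy) s = μ.germ hy a := s.2 ⟨x, hx⟩

lemma exists_eq_of_stalkAt_eq {s : μ.Fun U} {t : μ.Fun V} {x : M} (hU : x ∈ U) (hV : x ∈ V)
    (h : μ.stalkAt hU s = μ.stalkAt hV t) : ∃ (W : Opens M) (h₁ : W ≤ U) (h₂ : W ≤ V), x ∈ W ∧
      ∀ (y : M) (hy : y ∈ W), μ.stalkAt (h₁ hy) s = μ.stalkAt (h₂ hy) t := by
  obtain ⟨W₁, h₁, a, hx₁, ha⟩ := exists_local s hU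
  obtain ⟨W₂, h₂, b, hx₂, hb⟩ := exists_local t hV
  rw [ha x hx₁, hb x hx₂] at h
  obtain ⟨W, hxW, h₃, h₄, hW⟩ := germ_eq_iff hx₁ hx₂ h
  refine ⟨W, h₃.trans h₁, h₄.trans h₂, hxW, fun y hy => ?_⟩
  rw [ha y (h₃ hy), hb y (h₄ hy)]
  exact germ_eq_of_res_eq hy h₃ h₄ hW

/-- Gluing of functions. -/
lemma exists_fun (s : ∀ x : U, μ.Stalk (x : M))
    (h : ∀ (x : M) (_ : x ∈ U), ∃ (W : Opens M) (_ : x ∈ W) (t : μ.Fun W),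
      ∀ (y : M) (hU : y ∈ U) (hy : y ∈ W), s ⟨y, hU⟩ = μ.stalkAt hy t) :
    ∃ t : μ.Fun U, ∀ (x : M) (hx : x ∈ U), μ.stalkAt hx t = s ⟨x, hx⟩ := by
  refine ⟨⟨s, fun x => ?_⟩, fun x hx => rfl⟩
  obtain ⟨W, hxW, t, ht⟩ := h x x.2
  obtain ⟨W₁, h₁, a, hx₁, ha⟩ := exists_local t hxW
  refine ⟨W₁ ⊓ U, inf_le_right, PreFun.res μ inf_le_left a, ⟨hx₁, x.2⟩, fun y hy => ?_⟩
  rw [germ_res, ← ha y hy.1]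
  exact ht y hy.2 (h₁ hy.1)

end Basic

section Extension

lemma exists_gen_extension {U : Opens M} (a : μ.Gen U) {x : M} (hx : x ∈ U) :
    ∃ (b : μ.Gen ⊤) (W : Opens M), x ∈ W ∧ ∃ h : W ≤ U, b.res le_top = a.res h := by
  cases a with
  | fn f =>
    obtain ⟨g, W, hW, h, hg⟩ := f.exists_extension hx
    exact ⟨.fn g, W, hW, h, congrArg Gen.fn hg⟩
  | sec i η =>
    obtain ⟨g, W, hW, h, hg⟩ := DualSec.exists_extension η hx
    exact ⟨.sec i g, W, hW, h, congrArg (Gen.sec i) hg⟩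

lemma germ_gen_eq_of_res_eq {U V W : Opens M} {a : μ.Gen U} {b : μ.Gen V} (h₁ : W ≤ U) (h₂ : W ≤ V)
    (h : a.res h₁ = b.res h₂) {x : M} (hx : x ∈ W) :
    μ.germ (h₁ hx) (μ.gen a) = μ.germ (h₂ hx) (μ.gen b) := by
  refine germ_eq_of_res_eq hx h₁ h₂ ?_
  rw [PreFun.res_gen, PreFun.res_gen, h]

/-- Each factor of a product of generators has, near `x`, the same restriction as a global generator
of the same degree, obtained with a bump function. No germ is therefore purely local. -/
lemma Stalk.exists_global_homog {x : M} {k : ℤ} {s : μ.Stalk x} (hs : s ∈ Stalk.homog μ x k) :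
    ∃ b ∈ PreFun.homog μ ⊤ k, s = μ.germ (Opens.mem_top x) b := by
  obtain ⟨U, hU, a, ha, rfl⟩ := Stalk.exists_germ_of_mem_homog hs
  clear hs
  unfold PreFun.homog at ha
  induction ha using Submodule.span_induction with
  | mem a ha =>
    obtain ⟨L, hL, rfl⟩ := ha
    have h1 : ∃ L' : List (μ.Gen ⊤), L'.map Gen.degree = L.map Gen.degree ∧
        L'.map (fun b => μ.germ (Opens.mem_top x) (μ.gen b)) = L.map (fun b => μ.germ hU (μ.gen b)) := by
      clear hL
      induction L with
      | nil => exact ⟨[], rfl, rfl⟩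
      | cons a L ih =>
        obtain ⟨L', h1, h2⟩ := ih
        obtain ⟨b, W, hxW, h, hb⟩ := exists_gen_extension a hU
        refine ⟨b :: L', ?_, ?_⟩
        · rw [List.map_cons, List.map_cons, h1, ← Gen.degree_res h a, ← hb, Gen.degree_res]
        · rw [List.map_cons, List.map_cons, h2, germ_gen_eq_of_res_eq le_top h hb hxW]
    obtain ⟨L', h1, h2⟩ := h1
    refine ⟨_, Submodule.subset_span ⟨L', by rw [h1]; exact hL, rfl⟩, ?_⟩
    rw [map_list_prod, map_list_prod, List.map_map, List.map_map]
    exact congrArg List.prod h2.symm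
  | zero => exact ⟨0, zero_mem _, by rw [map_zero, map_zero]⟩
  | add a b _ _ ha hb =>
    obtain ⟨a', ha, ha'⟩ := ha
    obtain ⟨b', hb, hb'⟩ := hb
    exact ⟨a' + b', add_mem ha hb, by rw [map_add, map_add, ha', hb']⟩
  | smul c a _ ha =>
    obtain ⟨a', ha, ha'⟩ := ha
    exact ⟨c • a', Submodule.smul_mem _ _ ha, by rw [map_smul, map_smul, ha']⟩

lemma toFun_mem_homog {U : Opens M} {k : ℤ} {a : μ.PreFun U} (ha : a ∈ PreFun.homog μ U k) :
    μ.toFun a ∈ μ.homog U k := fun x => germ_mem_homog x.2 ha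

lemma exists_homog_stalkAt_eq {U : Opens M} {x : M} (hx : x ∈ U) {k : ℤ} {s : μ.Stalk x}
    (hs : s ∈ Stalk.homog μ x k) : ∃ t ∈ μ.homog U k, μ.stalkAt hx t = s := by
  obtain ⟨b, hb, rfl⟩ := Stalk.exists_global_homog hs
  exact ⟨_, toFun_mem_homog (PreFun.res_mem_homog le_top hb), germ_res μ le_top hx b⟩

lemma stalkAt_surjective {U : Opens M} {x : M} (hx : x ∈ U) :
    Function.Surjective (μ.stalkAt hx) := fun s => by
  have h := Stalk.iSup_homog s
  induction h using Submodule.iSup_induction' with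
  | mem k s hs =>
    obtain ⟨t, -, ht⟩ := exists_homog_stalkAt_eq hx hs
    exact ⟨t, ht⟩
  | zero => exact ⟨0, map_zero _⟩
  | add a b _ _ ha hb =>
    obtain ⟨s, rfl⟩ := ha
    obtain ⟨t, rfl⟩ := hb
    exact ⟨s + t, map_add _ _ _⟩

end Extension

section Homog

variable {U : Opens M}

lemma ofFn_mem_homog (f : SmoothFun m U) : μ.ofFn f ∈ μ.homog U 0 :=
  toFun_mem_homog (PreFun.gen_mem_homog (.fn f))

lemma ofSec_mem_homog (i : Fin n) (η : DualSec m (Fib i) (E i) U) :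
    μ.ofSec i η ∈ μ.homog U (deg i) :=
  toFun_mem_homog (PreFun.gen_mem_homog (.sec i η))

lemma stalkAt_ofFn {x : M} (hx : x ∈ U) (f : SmoothFun m U) :
    μ.stalkAt hx (μ.ofFn f) = μ.germ hx (μ.gen (.fn f)) := rfl

lemma stalkAt_ofSec {x : M} (hx : x ∈ U) (i : Fin n) (η : DualSec m (Fib i) (E i) U) :
    μ.stalkAt hx (μ.ofSec i η) = μ.germ hx (μ.gen (.sec i η)) := rfl

lemma bodyVal_ofFn (x : U) (f : SmoothFun m U) : μ.bodyVal x (μ.ofFn f) = f x :=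
  PreFun.eval_fn μ x.2 f

lemma act_ofSec {x : M} (hx : x ∈ U) (i : Fin n) (η : DualSec m (Fib i) (E i) U) (v : ∀ i, E i x) :
    (Stalk.act μ x (μ.stalkAt hx (μ.ofSec i η)) (0, v)).1 = η.1 ⟨x, hx⟩ (v i) :=
  PreFun.act_sec_apply μ hx i η v

lemma ofSec_injective (i : Fin n) : Function.Injective (μ.ofSec (U := U) i) := fun η ζ h =>
  DualSec.ext fun x => ContinuousLinearMap.ext fun v => by
    have h1 := act_ofSec (μ := μ) x.2 i η (Pi.single i v)
    rw [h, act_ofSec, Pi.single_eq_same] at h1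
    exact h1.symm

lemma ofFn_add (f g : SmoothFun m U) : μ.ofFn (f + g) = μ.ofFn f + μ.ofFn g :=
  Fun.ext_stalkAt fun x hx => by
    rw [map_add, stalkAt_ofFn, gen_fn_add, map_add]
    rfl

lemma ofFn_smul (c : ℝ) (f : SmoothFun m U) : μ.ofFn (c • f) = c • μ.ofFn f :=
  Fun.ext_stalkAt fun x hx => by
    rw [map_smul, stalkAt_ofFn, gen_fn_smul, map_smul]
    rfl

lemma ofFn_mul (f g : SmoothFun m U) : μ.ofFn (f * g) = μ.ofFn f * μ.ofFn g :=
  Fun.ext_stalkAt fun x hx => by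
    rw [map_mul, stalkAt_ofFn, gen_fn_mul, map_mul]
    rfl

lemma ofFn_one : μ.ofFn (1 : SmoothFun m U) = 1 :=
  Fun.ext_stalkAt fun x hx => by
    rw [map_one, stalkAt_ofFn, gen_fn_one, map_one]

lemma ofSec_add (i : Fin n) (η ζ : DualSec m (Fib i) (E i) U) :
    μ.ofSec i (η + ζ) = μ.ofSec i η + μ.ofSec i ζ :=
  Fun.ext_stalkAt fun x hx => by
    rw [map_add, stalkAt_ofSec, gen_sec_add, map_add]
    rfl

lemma ofSec_fsmul (i : Fin n) (f : SmoothFun m U) (η : DualSec m (Fib i) (E i) U) :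
    μ.ofSec i (DualSec.fsmul f η) = μ.ofFn f * μ.ofSec i η :=
  Fun.ext_stalkAt fun x hx => by
    rw [map_mul, stalkAt_ofSec, gen_sec_fsmul, map_mul]
    rfl

lemma ofSec_mul {i j l : Fin n} (h : deg i + deg j = deg l) (η : DualSec m (Fib i) (E i) U)
    (ζ : DualSec m (Fib j) (E j) U) : μ.ofSec i η * μ.ofSec j ζ = μ.ofSec l (μ.mul h η ζ) :=
  Fun.ext_stalkAt fun x hx => by
    rw [map_mul, stalkAt_ofSec, stalkAt_ofSec, ← map_mul, gen_sec_mul h]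
    rfl

/-- Each local representative must equal the body value of `s`, so the local representatives agree
and their union is smooth. -/
lemma exists_ofFn {s : μ.Fun U} (hs : s ∈ μ.homog U 0) : ∃ f, s = μ.ofFn f := by
  have h : ∀ (x : M) (hx : x ∈ U), ∃ (W : Opens M) (hW : W ≤ U) (_ : x ∈ W) (g : SmoothFun m W),
      ∀ (y : M) (hy : y ∈ W), μ.stalkAt (hW hy) s = μ.stalkAt hy (μ.ofFn g) := fun x hx => by
    obtain ⟨V, hV, a, ha, h⟩ := Stalk.exists_germ_of_mem_homog (mem_homog_iff.1 hs x hx)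
    obtain ⟨g, rfl⟩ := PreFun.exists_fn_of_mem_homog ha
    obtain ⟨W, h₁, h₂, hxW, hW⟩ := exists_eq_of_stalkAt_eq (t := μ.ofFn g) hx hV h
    refine ⟨W, h₁, hxW, g.res h₂, fun y hy => ?_⟩
    rw [hW y hy, ← res_ofFn, stalkAt_res]
  have hb : ∀ (x : M) (hx : x ∈ U) (W : Opens M) (hW : W ≤ U) (g : SmoothFun m W) (y : M)
      (hy : y ∈ W), μ.stalkAt (hW hy) s = μ.stalkAt hy (μ.ofFn g) →
      μ.bodyVal ⟨y, hW hy⟩ s = g ⟨y, hy⟩ := fun x hx W hW g y hy h => by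
    rw [bodyVal_eq, h, ← bodyVal_ofFn (μ := μ), bodyVal_eq]
  have hsm : ContMDiff (𝓡 m) 𝓘(ℝ, ℝ) ∞ fun x : U => μ.bodyVal x s := by
    classical
    rintro ⟨x, hx⟩
    obtain ⟨W, hW, hxW, g, hg⟩ := h x hx
    let f' : M → ℝ := fun y => if h : y ∈ U then μ.bodyVal ⟨y, h⟩ s else 0
    have hf' : ContMDiffOn (𝓡 m) 𝓘(ℝ, ℝ) ∞ f' W :=
      contMDiffOn_of_smoothFun g fun y => (dif_pos (hW y.2)).trans (hb x hx W hW g y y.2 (hg y y.2))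
    refine ((contMDiffAt_subtype_iff (U := U) (x := ⟨x, hx⟩)).2
      ((hf' x hxW).contMDiffAt (W.isOpen.mem_nhds hxW))).congr_of_eventuallyEq
        (Filter.Eventually.of_forall fun y => ?_)
    have h1 : f' y = μ.bodyVal y s := dif_pos y.2
    exact h1.symm
  let f : SmoothFun m U := ⟨_, hsm⟩
  refine ⟨f, Fun.ext_stalkAt fun x hx => ?_⟩
  obtain ⟨W, hW, hxW, g, hg⟩ := h x hx
  rw [hg x hxW, ← stalkAt_res hW hxW, res_ofFn]
  congr 2
  exact ContMDiffMap.ext fun y => (hb x hx W hW g y y.2 (hg y y.2)).symm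

/-- The gluing is the same as in degree 0, with the action on `ℝ ⊕ E_x` in place of the body value.
With `ofSec_injective` this identifies the degree `i` part with `Γ(U, E_{-i}^*)`, and the
connections of a distribution come from it. -/
lemma exists_ofSec {i : Fin n} {s : μ.Fun U} (hs : s ∈ μ.homog U (deg i)) :
    ∃ η, s = μ.ofSec i η := by
  have h : ∀ (x : M) (hx : x ∈ U), ∃ (W : Opens M) (hW : W ≤ U) (_ : x ∈ W)
      (ζ : DualSec m (Fib i) (E i) W),
      ∀ (y : M) (hy : y ∈ W), μ.stalkAt (hW hy) s = μ.stalkAt hy (μ.ofSec i ζ) := fun x hx => by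
    obtain ⟨V, hV, a, ha, h⟩ := Stalk.exists_germ_of_mem_homog (mem_homog_iff.1 hs x hx)
    obtain ⟨g, rfl⟩ := PreFun.exists_sec_of_mem_homog ha
    obtain ⟨W, h₁, h₂, hxW, hW⟩ := exists_eq_of_stalkAt_eq (t := μ.ofSec i g) hx hV h
    refine ⟨W, h₁, hxW, DualSec.res h₂ g, fun y hy => ?_⟩
    rw [hW y hy, ← res_ofSec, stalkAt_res]
  -- The matrix coefficient that returns `ζ` when the germ is that of a section `ζ`.
  let φ : ∀ x : U, E i x →ₗ[ℝ] ℝ := fun x =>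
    LinearMap.fst ℝ ℝ (∀ i, E i x) ∘ₗ Stalk.act μ (x : M) (μ.stalkAt x.2 s) ∘ₗ
      LinearMap.inr ℝ ℝ (∀ i, E i x) ∘ₗ incl (fun i => E i x) i
  let η : ∀ x : U, E i x →L[ℝ] ℝ := fun x => ⟨φ x, continuous_of_fiber (Fib := Fib i) (x : M) (φ x)⟩
  have hη : ∀ (W : Opens M) (hW : W ≤ U) (ζ : DualSec m (Fib i) (E i) W) (y : M)
      (hy : y ∈ W), μ.stalkAt (hW hy) s = μ.stalkAt hy (μ.ofSec i ζ) →
      η ⟨y, hW hy⟩ = ζ.1 ⟨y, hy⟩ := fun W hW ζ y hy h => by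
    refine ContinuousLinearMap.ext fun v => ?_
    have h1 := act_ofSec (μ := μ) hy i ζ (Pi.single i v)
    rw [← h, Pi.single_eq_same] at h1
    exact h1
  have hsm : IsSmoothDual m (Fib i) (E i) U η := isSmoothDual_of_local fun x hx => by
    obtain ⟨W, hW, hxW, ζ, hζ⟩ := h x hx
    exact ⟨W, hxW, ζ, fun y _ hy => hη W hW ζ y hy (hζ y hy)⟩
  refine ⟨⟨_, hsm⟩, Fun.ext_stalkAt fun x hx => ?_⟩
  obtain ⟨W, hW, hxW, ζ, hζ⟩ := h x hx
  rw [hζ x hxW, ← stalkAt_res hW hxW, res_ofSec]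
  congr 2
  exact DualSec.ext fun y => (hη W hW ζ y y.2 (hζ y y.2)).symm

lemma mul_mem_homog {k l : ℤ} {s t : μ.Fun U} (hs : s ∈ μ.homog U k) (ht : t ∈ μ.homog U l) :
    s * t ∈ μ.homog U (k + l) := fun x => Stalk.mul_mem_homog (hs x) (ht x)

lemma res_mem_homog {V : Opens M} (h : V ≤ U) {k : ℤ} {s : μ.Fun U} (hs : s ∈ μ.homog U k) :
    Fun.res μ h s ∈ μ.homog V k := fun x => hs ⟨x, h x.2⟩

lemma mul_comm_homog {k l : ℤ} {s t : μ.Fun U} (hs : s ∈ μ.homog U k) (ht : t ∈ μ.homog U l) :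
    s * t = sgn (k * l) • (t * s) :=
  Fun.ext fun x hx => Stalk.mul_comm_homog (hs ⟨x, hx⟩) (ht ⟨x, hx⟩)

lemma one_mem_homog : (1 : μ.Fun U) ∈ μ.homog U 0 := fun x => Stalk.one_mem_homog (x : M)

end Homog

end CoalgebraBundle

end Functions

/-! ### Vector fields as families of stalk derivations. -/

section VectorFields

variable {m n : ℕ} {M : Type*} [TopologicalSpace M] [ChartedSpace (EuclideanSpace ℝ (Fin m)) M]
  [T2Space M] [IsManifold (𝓡 m) ∞ M]
  {Fib : Fin n → Type*} [∀ i, NormedAddCommGroup (Fib i)] [∀ i, NormedSpace ℝ (Fib i)]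
  [∀ i, FiniteDimensional ℝ (Fib i)]
  {E : Fin n → M → Type*} [∀ i, TopologicalSpace (TotalSpace (Fib i) (E i))]
  [∀ i x, AddCommGroup (E i x)] [∀ i x, Module ℝ (E i x)] [∀ i x, TopologicalSpace (E i x)]
  [∀ i, FiberBundle (Fib i) (E i)] [∀ i, VectorBundle ℝ (Fib i) (E i)]

namespace CoalgebraBundle

variable {μ : CoalgebraBundle m Fib E}

section StalkOp

variable {U V : Opens M}

variable (μ) in
/-- A linear section of the map to the stalk. -/
def stalkSection {x : M} (hx : x ∈ U) : μ.Stalk x →ₗ[ℝ] μ.Fun U :=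
  ((μ.stalkAt hx).toLinearMap.exists_rightInverse_of_surjective
    (LinearMap.range_eq_top.2 (stalkAt_surjective hx))).choose

lemma stalkAt_stalkSection {x : M} (hx : x ∈ U) (s : μ.Stalk x) :
    μ.stalkAt hx (μ.stalkSection hx s) = s :=
  LinearMap.congr_fun ((μ.stalkAt hx).toLinearMap.exists_rightInverse_of_surjective
    (LinearMap.range_eq_top.2 (stalkAt_surjective hx))).choose_spec s

/-- The operator induced on the stalk at `x` by a local operator. -/
def stalkOp (X : Module.End ℝ (μ.Fun U)) {x : M} (hx : x ∈ U) : Module.End ℝ (μ.Stalk x) :=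
  (μ.stalkAt hx).toLinearMap ∘ₗ X ∘ₗ μ.stalkSection hx

lemma stalkOp_apply (X : Module.End ℝ (μ.Fun U)) {x : M} (hx : x ∈ U) (s : μ.Stalk x) :
    stalkOp X hx s = μ.stalkAt hx (X (μ.stalkSection hx s)) := rfl

lemma stalkOp_add (X Y : Module.End ℝ (μ.Fun U)) {x : M} (hx : x ∈ U) :
    stalkOp (X + Y) hx = stalkOp X hx + stalkOp Y hx := by
  unfold stalkOp
  rw [LinearMap.add_comp, LinearMap.comp_add]

lemma stalkOp_sub (X Y : Module.End ℝ (μ.Fun U)) {x : M} (hx : x ∈ U) :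
    stalkOp (X - Y) hx = stalkOp X hx - stalkOp Y hx := by
  unfold stalkOp
  rw [LinearMap.sub_comp, LinearMap.comp_sub]

lemma stalkOp_zero {x : M} (hx : x ∈ U) :
    stalkOp (0 : Module.End ℝ (μ.Fun U)) hx = 0 := by
  unfold stalkOp
  rw [LinearMap.zero_comp, LinearMap.comp_zero]

lemma stalkOp_fmul (f : μ.Fun U) (X : Module.End ℝ (μ.Fun U)) {x : M} (hx : x ∈ U) :
    stalkOp (μ.fmul f X) hx = LinearMap.mulLeft ℝ (μ.stalkAt hx f) ∘ₗ stalkOp X hx :=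
  LinearMap.ext fun _ => map_mul (μ.stalkAt hx) _ _

lemma stalkOp_sum {ι : Type*} (t : Finset ι) (X : ι → Module.End ℝ (μ.Fun U)) {x : M} (hx : x ∈ U) :
    stalkOp (∑ a ∈ t, X a) hx = ∑ a ∈ t, stalkOp (X a) hx := by
  classical
  induction t using Finset.induction_on with
  | empty => simp [stalkOp_zero]
  | insert a t ha ih => rw [Finset.sum_insert ha, Finset.sum_insert ha, stalkOp_add, ih]

lemma stalkOp_eq_of_forall {X : Module.End ℝ (μ.Fun U)} {x : M} (hx : x ∈ U)
    {ξ : Module.End ℝ (μ.Stalk x)} (h : ∀ s, μ.stalkAt hx (X s) = ξ (μ.stalkAt hx s)) :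
    stalkOp X hx = ξ :=
  LinearMap.ext fun s => by rw [stalkOp_apply, h, stalkAt_stalkSection]

end StalkOp

section Bump

/-- The bump function in the form needed for germs. Since `U` and `V` cover `M`, an object over `U`
multiplied by `ρ` can be extended by zero over `V`, and over `W` it is unchanged. -/
lemma exists_bump_germ {U : Opens M} {x : M} (hx : x ∈ U) :
    ∃ (ρ : SmoothFun m (⊤ : Opens M)) (W V : Opens M), x ∈ W ∧ W ≤ U ∧ (∀ y, y ∈ U ∨ y ∈ V) ∧
      (∀ y ∈ W, ρ.val y = 1) ∧ (∀ y ∈ V, ρ.val y = 0) ∧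
      (∀ y ∈ W, μ.germ (Opens.mem_top y) (μ.gen (.fn ρ)) = 1) ∧
      ∀ y ∈ V, μ.germ (Opens.mem_top y) (μ.gen (.fn ρ)) = 0 := by
  obtain ⟨ρ, hρ, h1, h2, -⟩ := exists_bump m hx
  obtain ⟨W, hxW, hW⟩ := exists_open_nhds (h1.and (U.isOpen.mem_nhds hx))
  let V : Opens M := ⟨(tsupport ρ)ᶜ, (isClosed_tsupport ρ).isOpen_compl⟩
  have hV : ∀ y ∈ V, ρ y = 0 := fun y hy => image_eq_zero_of_notMem_tsupport hy
  refine ⟨SmoothFun.ofGlobal ρ hρ ⊤, W, V, hxW,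
    fun y hy => (hW y hy).2, fun y => ?_, fun y hy => (hW y hy).1, hV, fun y hy => ?_, fun y hy => ?_⟩
  · by_cases hy : y ∈ tsupport ρ
    · exact Or.inl (h2 hy)
    · exact Or.inr hy
  · have h3 : (SmoothFun.ofGlobal ρ hρ ⊤).res (le_top : W ≤ ⊤) = (1 : SmoothFun m W) :=
      ContMDiffMap.ext fun z => (hW z z.2).1
    rw [← germ_res μ le_top hy, PreFun.res_gen, Gen.res, h3, gen_fn_one, map_one]
  · have h3 : (SmoothFun.ofGlobal ρ hρ ⊤).res (le_top : V ≤ ⊤) = (0 : SmoothFun m V) :=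
      ContMDiffMap.ext fun z => hV z z.2
    rw [← germ_res μ le_top hy, PreFun.res_gen, Gen.res, h3, gen_fn_zero, map_zero]

lemma stalkAt_ofFn_res {U : Opens M} {x : M} (hx : x ∈ U) (f : SmoothFun m (⊤ : Opens M)) :
    μ.stalkAt hx (μ.ofFn (f.res le_top)) = μ.germ (Opens.mem_top x) (μ.gen (.fn f)) := by
  rw [← res_ofFn, stalkAt_res]
  rfl

end Bump

/-- A graded derivation of degree `k` of the stalk at `x`. -/
structure IsStalkDerivation {x : M} (k : ℤ) (ξ : Module.End ℝ (μ.Stalk x)) : Prop where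
  map_homog : ∀ l : ℤ, ∀ s ∈ Stalk.homog μ x l, ξ s ∈ Stalk.homog μ x (l + k)
  leibniz : ∀ l : ℤ, ∀ s ∈ Stalk.homog μ x l, ∀ t,
    ξ (s * t) = ξ s * t + sgn (l * k) • (s * ξ t)

section VectorField

variable {U V : Opens M} {k : ℤ}

/-- If `s` vanishes near `x`, then `ρ s = 0` for a bump function `ρ` of degree 0, and the Leibniz
rule at `x`, where the germ of `ρ` is 1, leaves only `X s`. -/
lemma stalkAt_eq_zero_of_vectorField {X : Module.End ℝ (μ.Fun U)} (hX : X ∈ μ.vectorFields U k)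
    {x : M} (hx : x ∈ U) {s : μ.Fun U} (hs : μ.stalkAt hx s = 0) : μ.stalkAt hx (X s) = 0 := by
  obtain ⟨W, hWU, hWU', hxW, hW⟩ := exists_eq_of_stalkAt_eq (t := (0 : μ.Fun U)) hx hx
    (hs.trans (map_zero _).symm)
  obtain ⟨ρ, W', V, hxW', hW'W, hUV, -, -, h1, h0⟩ := exists_bump_germ (μ := μ) hxW
  have h2 : μ.ofFn (ρ.res le_top) * s = 0 := Fun.ext_stalkAt fun y hy => by
    rw [map_mul, stalkAt_ofFn_res, map_zero]
    rcases hUV y with hyW | hyV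
    · rw [hW y hyW, map_zero, mul_zero]
    · rw [h0 y hyV, zero_mul]
  have h3 := hX.2 0 _ (ofFn_mem_homog (ρ.res le_top)) s
  rw [h2, map_zero] at h3
  have h4 := congrArg (μ.stalkAt hx) h3
  rw [map_zero, map_add, map_mul, hs, mul_zero, zero_add, map_smul, map_mul, stalkAt_ofFn_res,
    h1 x hxW', one_mul, zero_mul, sgn, zpow_zero, one_smul] at h4
  exact h4.symm

/-- By locality the arbitrary choice of `stalkSection` does not matter, so `stalkOp X` is the
operator that `X` induces on germs. -/
lemma stalkOp_stalkAt {X : Module.End ℝ (μ.Fun U)} (hX : X ∈ μ.vectorFields U k)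
    {x : M} (hx : x ∈ U) (s : μ.Fun U) : stalkOp X hx (μ.stalkAt hx s) = μ.stalkAt hx (X s) := by
  rw [stalkOp_apply, ← sub_eq_zero, ← map_sub, ← map_sub]
  refine stalkAt_eq_zero_of_vectorField hX hx ?_
  rw [map_sub, stalkAt_stalkSection, sub_self]

lemma vectorField_ext {X Y : Module.End ℝ (μ.Fun U)} (hX : X ∈ μ.vectorFields U k)
    (hY : Y ∈ μ.vectorFields U k) (h : ∀ (x : M) (hx : x ∈ U), stalkOp X hx = stalkOp Y hx) :
    X = Y :=
  LinearMap.ext fun s => Fun.ext_stalkAt fun x hx => by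
    rw [← stalkOp_stalkAt hX, h, stalkOp_stalkAt hY]

lemma isStalkDerivation_stalkOp {X : Module.End ℝ (μ.Fun U)} (hX : X ∈ μ.vectorFields U k)
    {x : M} (hx : x ∈ U) : IsStalkDerivation k (stalkOp X hx) where
  map_homog l s hs := by
    obtain ⟨s, hs', rfl⟩ := exists_homog_stalkAt_eq hx hs
    rw [stalkOp_stalkAt hX]
    exact mem_homog_iff.1 (hX.1 l s hs') x hx
  leibniz l s hs t := by
    obtain ⟨s, hs', rfl⟩ := exists_homog_stalkAt_eq hx hs
    obtain ⟨t, rfl⟩ := stalkAt_surjective hx t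
    rw [← map_mul, stalkOp_stalkAt hX, hX.2 l s hs' t, stalkOp_stalkAt hX, stalkOp_stalkAt hX, map_add,
      map_smul, map_mul, map_mul]

/-- The axioms of a vector field are checked stalk by stalk; only the condition that sections go to
sections relates different stalks. -/
lemma exists_vectorField_of_smooth (ξ : ∀ x : M, x ∈ U → Module.End ℝ (μ.Stalk x))
    (hξ : ∀ x hx, IsStalkDerivation k (ξ x hx))
    (h : ∀ (s : μ.Fun U) (x : M) (_ : x ∈ U), ∃ (W : Opens M) (_ : x ∈ W) (t : μ.Fun W),
      ∀ (y : M) (hU : y ∈ U) (hy : y ∈ W), ξ y hU (μ.stalkAt hU s) = μ.stalkAt hy t) :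
    ∃ X ∈ μ.vectorFields U k, ∀ x hx, stalkOp X hx = ξ x hx := by
  have h1 : ∀ s : μ.Fun U, ∃ t : μ.Fun U, ∀ (x : M) (hx : x ∈ U),
      μ.stalkAt hx t = ξ x hx (μ.stalkAt hx s) := fun s =>
    exists_fun (fun x => ξ x x.2 (μ.stalkAt x.2 s)) (h s)
  choose X hX using h1
  let X' : Module.End ℝ (μ.Fun U) :=
    { toFun := X
      map_add' := fun s t => Fun.ext_stalkAt fun x hx => by
        rw [map_add, hX, hX, hX, map_add, map_add]
      map_smul' := fun c s => Fun.ext_stalkAt fun x hx => by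
        rw [RingHom.id_apply, map_smul, hX, hX, map_smul, map_smul] }
  have hX' : ∀ s (x : M) (hx : x ∈ U), μ.stalkAt hx (X' s) = ξ x hx (μ.stalkAt hx s) := hX
  refine ⟨X', ⟨fun l s hs => mem_homog_iff.2 fun x hx => ?_, fun l s hs t => Fun.ext_stalkAt fun x hx => ?_⟩,
    fun x hx => stalkOp_eq_of_forall hx fun s => hX' s x hx⟩
  · rw [hX']
    exact (hξ x hx).map_homog l _ (mem_homog_iff.1 hs x hx)
  · rw [hX', map_mul, (hξ x hx).leibniz l _ (mem_homog_iff.1 hs x hx), map_add, map_smul, map_mul,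
      map_mul, hX', hX']

/-- Gluing of vector fields. -/
lemma exists_vectorField (ξ : ∀ x : M, x ∈ U → Module.End ℝ (μ.Stalk x))
    (h : ∀ x ∈ U, ∃ (V : Opens M), x ∈ V ∧ ∃ X ∈ μ.vectorFields V k,
      ∀ (y : M) (hU : y ∈ U) (hV : y ∈ V), ξ y hU = stalkOp X hV) :
    ∃ X ∈ μ.vectorFields U k, ∀ x hx, stalkOp X hx = ξ x hx := by
  refine exists_vectorField_of_smooth ξ (fun x hx => ?_) fun s x hx => ?_
  · obtain ⟨V, hxV, X, hX, h⟩ := h x hx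
    rw [h x hx hxV]
    exact isStalkDerivation_stalkOp hX hxV
  · obtain ⟨V, hxV, X, hX, h⟩ := h x hx
    obtain ⟨t, ht⟩ := stalkAt_surjective hxV (μ.stalkAt hx s)
    obtain ⟨W, h₁, h₂, hxW, hW⟩ := exists_eq_of_stalkAt_eq hx hxV ht.symm
    refine ⟨W, hxW, Fun.res μ h₂ (X t), fun y hU hy => ?_⟩
    rw [h y hU (h₂ hy), hW y hy, stalkOp_stalkAt hX, stalkAt_res]

/-- Functions over `V` need not extend to `U`, so the restriction is assembled from the stalk
operators instead of from values on extended functions. -/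
lemma exists_restriction (h : V ≤ U) {X : Module.End ℝ (μ.Fun U)} (hX : X ∈ μ.vectorFields U k) :
    ∃ Y ∈ μ.vectorFields V k, ∀ (x : M) (hx : x ∈ V), stalkOp Y hx = stalkOp X (h hx) :=
  exists_vectorField (fun _ hx => stalkOp X (h hx)) fun _ hx => ⟨U, h hx, X, hX, fun _ _ _ => rfl⟩

lemma isRestriction_iff (h : V ≤ U) {X : Module.End ℝ (μ.Fun U)} {Y : Module.End ℝ (μ.Fun V)}
    (hX : X ∈ μ.vectorFields U k) (hY : Y ∈ μ.vectorFields V k) :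
    μ.IsRestriction h X Y ↔ ∀ (x : M) (hx : x ∈ V), stalkOp Y hx = stalkOp X (h hx) := by
  refine ⟨fun H x hx => LinearMap.ext fun s => ?_, fun H s => Fun.ext_stalkAt fun x hx => ?_⟩
  · obtain ⟨s, rfl⟩ := stalkAt_surjective (h hx) s
    rw [stalkOp_stalkAt hX, ← stalkAt_res h hx, ← stalkAt_res h hx, stalkOp_stalkAt hY, H]
  · rw [← stalkOp_stalkAt hY, H, stalkAt_res, stalkOp_stalkAt hX, stalkAt_res]

lemma fmul_mem_vectorFields {l : ℤ} {f : μ.Fun U} (hf : f ∈ μ.homog U l)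
    {X : Module.End ℝ (μ.Fun U)} (hX : X ∈ μ.vectorFields U k) :
    μ.fmul f X ∈ μ.vectorFields U (l + k) := by
  have happ : ∀ s, μ.fmul f X s = f * X s := fun s => rfl
  refine ⟨fun j s hs => ?_, fun j s hs t => ?_⟩
  · rw [happ]
    have h := mul_mem_homog hf (hX.1 j s hs)
    rwa [show l + (j + k) = j + (l + k) by ring] at h
  · rw [happ, happ, happ, hX.2 j s hs t, mul_add, mul_smul_comm, ← mul_assoc, ← mul_assoc, ← mul_assoc,
      mul_comm_homog hf hs, smul_mul_assoc, smul_smul]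
    congr 2
    rw [sgn, sgn, sgn, ← zpow_add₀ (by norm_num)]
    congr 1
    ring

end VectorField

section Subsheaf

variable (D : μ.GradedSubsheaf) {U V : Opens M} {k : ℤ}

variable {D} in
lemma GradedSubsheaf.mem_of_stalkOp {X : Module.End ℝ (μ.Fun U)} (hX : X ∈ μ.vectorFields U k)
    (h : ∀ x ∈ U, ∃ V : Opens M, x ∈ V ∧ ∃ X' ∈ D.carrier V k, ∃ W : Opens M, x ∈ W ∧
      ∀ (y : M) (hU : y ∈ U) (hV : y ∈ V), y ∈ W → stalkOp X hU = stalkOp X' hV) :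
    X ∈ D.carrier U k := by
  refine D.glue_mem U k X hX fun x hx => ?_
  obtain ⟨V, hxV, X', hX', W, hxW, hW⟩ := h x hx
  have hV : U ⊓ V ⊓ W ≤ V := inf_le_left.trans inf_le_right
  have hU : U ⊓ V ⊓ W ≤ U := inf_le_left.trans inf_le_left
  obtain ⟨Y, hY, hYX⟩ := exists_restriction hV (D.le V k hX')
  refine ⟨U ⊓ V ⊓ W, hU, ⟨⟨hx, hxV⟩, hxW⟩, Y, D.res_mem V _ hV k X' hX' Y hY
    ((isRestriction_iff hV (D.le V k hX') hY).2 hYX), (isRestriction_iff hU hX hY).2 fun y hy => ?_⟩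
  rw [hYX, hW y (hU hy) (hV hy) hy.2]

variable {D} in
-- The field is multiplied by a bump function and extended by zero. It stays in `D` because `D` is a
-- module over functions of degree 0 and is closed under gluing.
lemma GradedSubsheaf.exists_global {X : Module.End ℝ (μ.Fun U)} (hX : X ∈ D.carrier U k) {x : M}
    (hx : x ∈ U) : ∃ X' ∈ D.carrier ⊤ k, ∃ W : Opens M, x ∈ W ∧ ∃ h : W ≤ U,
      ∀ (y : M) (hy : y ∈ W), stalkOp X' (Opens.mem_top y) = stalkOp X (h hy) := by
  classical
  obtain ⟨ρ, W, V, hxW, hWU, hUV, -, -, h1, h0⟩ := exists_bump_germ (μ := μ) hx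
  let ξ : ∀ y : M, y ∈ (⊤ : Opens M) → Module.End ℝ (μ.Stalk y) := fun y _ =>
    if h : y ∈ U then LinearMap.mulLeft ℝ (μ.germ (Opens.mem_top y) (μ.gen (.fn ρ))) ∘ₗ stalkOp X h else 0
  have hρX : μ.fmul (μ.ofFn (ρ.res le_top)) X ∈ D.carrier U k := by
    have h := D.fmul_mem U 0 k _ (ofFn_mem_homog (ρ.res le_top)) X hX
    rwa [zero_add] at h
  have hU : ∀ (y : M) (hy : y ∈ U), ξ y (Opens.mem_top y) =
      stalkOp (μ.fmul (μ.ofFn (ρ.res le_top)) X) hy := fun y hy => by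
    rw [stalkOp_fmul, stalkAt_ofFn_res]
    exact dif_pos hy
  have hV : ∀ (y : M) (hy : y ∈ V), ξ y (Opens.mem_top y) =
      stalkOp (0 : Module.End ℝ (μ.Fun V)) hy := fun y hy => by
    rw [stalkOp_zero]
    by_cases hyU : y ∈ U
    · refine (dif_pos hyU).trans ?_
      rw [h0 y hy, LinearMap.mulLeft_zero_eq_zero, LinearMap.zero_comp]
    · exact dif_neg hyU
  obtain ⟨X', hX', hX'ξ⟩ := exists_vectorField (k := k) ξ fun y _ => by
    rcases hUV y with hy | hy
    · exact ⟨U, hy, _, D.le U k hρX, fun z _ hz => hU z hz⟩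
    · exact ⟨V, hy, 0, zero_mem _, fun z _ hz => hV z hz⟩
  refine ⟨X', D.mem_of_stalkOp hX' fun y _ => ?_, W, hxW, hWU, fun y hy => ?_⟩
  · rcases hUV y with hy | hy
    · exact ⟨U, hy, _, hρX, ⊤, Opens.mem_top y, fun z _ hz _ => by rw [hX'ξ, hU z hz]⟩
    · exact ⟨V, hy, 0, zero_mem _, ⊤, Opens.mem_top y, fun z _ hz _ => by rw [hX'ξ, hV z hz]⟩
  · rw [hX'ξ, hU y (hWU hy), stalkOp_fmul, stalkAt_ofFn_res, h1 y hy, LinearMap.mulLeft_one,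
      LinearMap.id_comp]

end Subsheaf

end CoalgebraBundle

end VectorFields

/-! ### The vector field of degree 0 defined by `∇_Y`. -/

section NablaField

variable {m n : ℕ} {M : Type*} [TopologicalSpace M] [ChartedSpace (EuclideanSpace ℝ (Fin m)) M]
  [T2Space M] [IsManifold (𝓡 m) ∞ M]
  {Fib : Fin n → Type*} [∀ i, NormedAddCommGroup (Fib i)] [∀ i, NormedSpace ℝ (Fib i)]
  [∀ i, FiniteDimensional ℝ (Fib i)]
  {E : Fin n → M → Type*} [∀ i, TopologicalSpace (TotalSpace (Fib i) (E i))]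
  [∀ i x, AddCommGroup (E i x)] [∀ i x, Module ℝ (E i x)] [∀ i x, TopologicalSpace (E i x)]
  [∀ i, FiberBundle (Fib i) (E i)] [∀ i, VectorBundle ℝ (Fib i) (E i)]

namespace CoalgebraBundle

variable {μ : CoalgebraBundle m Fib E}


section Induction

variable {x : M}

lemma Stalk.homog_induction {P : ℤ → μ.Stalk x → Prop} (one : P 0 1)
    (gen_mul : ∀ (a : μ.Gen ⊤) (k : ℤ), ∀ s ∈ Stalk.homog μ x k, P k s →
      P (a.degree + k) (μ.germ (Opens.mem_top x) (μ.gen a) * s))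
    (zero : ∀ k, P k 0) (add : ∀ k s t, P k s → P k t → P k (s + t))
    (smul : ∀ k (c : ℝ) s, P k s → P k (c • s)) {k : ℤ} {s : μ.Stalk x}
    (hs : s ∈ Stalk.homog μ x k) : P k s := by
  obtain ⟨b, hb, rfl⟩ := Stalk.exists_global_homog hs
  clear hs
  unfold PreFun.homog at hb
  induction hb using Submodule.span_induction with
  | mem b hb =>
    obtain ⟨L, hL, rfl⟩ := hb
    rw [← hL]
    clear hL
    induction L with
    | nil => simpa using one
    | cons a L ih =>
      have h := gen_mul a _ _ (germ_mem_homog (Opens.mem_top x) (Submodule.subset_span ⟨L, rfl, rfl⟩)) ih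
      simpa using h
  | zero => rw [map_zero]; exact zero k
  | add a b _ _ ha hb => rw [map_add]; exact add _ _ _ ha hb
  | smul c a _ ha => rw [map_smul]; exact smul _ _ _ ha

lemma Stalk.induction {P : μ.Stalk x → Prop} (one : P 1)
    (gen_mul : ∀ (a : μ.Gen ⊤) (s : μ.Stalk x), P s → P (μ.germ (Opens.mem_top x) (μ.gen a) * s))
    (zero : P 0) (add : ∀ s t, P s → P t → P (s + t)) (smul : ∀ (c : ℝ) s, P s → P (c • s))
    (s : μ.Stalk x) : P s := by
  have h := Stalk.iSup_homog s
  induction h using Submodule.iSup_induction' with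
  | mem k s hs =>
    exact Stalk.homog_induction (P := fun _ s => P s) one (fun a _ s _ => gen_mul a s) (fun _ => zero)
      (fun _ => add) (fun _ => smul) hs
  | zero => exact zero
  | add s t _ _ hs ht => exact add _ _ hs ht

lemma IsStalkDerivation.map_one {k : ℤ} {ξ : Module.End ℝ (μ.Stalk x)} (hξ : IsStalkDerivation k ξ) :
    ξ 1 = 0 := by
  have h := hξ.leibniz 0 1 (Stalk.one_mem_homog x) 1
  rw [mul_one, mul_one, one_mul, zero_mul, sgn, zpow_zero, one_smul] at h
  exact left_eq_add.1 h

lemma IsStalkDerivation.ext {k : ℤ} {ξ ξ' : Module.End ℝ (μ.Stalk x)} (hξ : IsStalkDerivation k ξ)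
    (hξ' : IsStalkDerivation k ξ')
    (h : ∀ a : μ.Gen ⊤, ξ (μ.germ (Opens.mem_top x) (μ.gen a)) =
      ξ' (μ.germ (Opens.mem_top x) (μ.gen a))) : ξ = ξ' := by
  refine LinearMap.ext fun s => ?_
  induction s using Stalk.induction with
  | one => rw [hξ.map_one, hξ'.map_one]
  | gen_mul a s hs =>
    have ha := germ_mem_homog (Opens.mem_top x) (PreFun.gen_mem_homog a)
    rw [hξ.leibniz _ _ ha, hξ'.leibniz _ _ ha, h, hs]
  | zero => rw [map_zero, map_zero]
  | add s t hs ht => rw [map_add, map_add, hs, ht]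
  | smul c s hs => rw [map_smul, map_smul, hs]

end Induction

lemma Gen.res_res {U V W : Opens M} (h : V ≤ U) (h' : W ≤ V) (a : μ.Gen U) :
    (a.res h).res h' = a.res (h'.trans h) := by
  cases a <;> rfl

section Lie

variable {d : ℕ} {S : TangentSubbundle m M d}

lemma val_lieDeriv (Y : S.sections) (f : SmoothFun m (⊤ : Opens M)) (x : M) :
    (S.lieDeriv Y f).val x = dirDeriv f.val x (Y.1 x) := rfl

lemma lieDeriv_add (Y : S.sections) (f g : SmoothFun m (⊤ : Opens M)) :
    S.lieDeriv Y (f + g) = S.lieDeriv Y f + S.lieDeriv Y g :=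
  SmoothFun.val_injective <| funext fun x =>
    dirDeriv_add (f.mdifferentiableAt_val x) (g.mdifferentiableAt_val x) _

lemma lieDeriv_mul (Y : S.sections) (f g : SmoothFun m (⊤ : Opens M)) :
    S.lieDeriv Y (f * g) = S.lieDeriv Y f * g + f * S.lieDeriv Y g :=
  SmoothFun.val_injective <| funext fun x => by
    rw [val_lieDeriv, SmoothFun.val_mul,
      dirDeriv_mul (f.mdifferentiableAt_val x) (g.mdifferentiableAt_val x), SmoothFun.val_add,
      SmoothFun.val_mul, SmoothFun.val_mul, Pi.add_apply, Pi.mul_apply, Pi.mul_apply, val_lieDeriv,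
      val_lieDeriv]
    ring

lemma lieDeriv_const (Y : S.sections) (c : ℝ) :
    S.lieDeriv Y (algebraMap ℝ (SmoothFun m (⊤ : Opens M)) c) = 0 :=
  SmoothFun.val_injective <| funext fun x => dirDeriv_const c x _

end Lie

variable {d : ℕ} (P : μ.CompatibleFlatConnections d) (Y : P.subbundle.sections)

/-- The action of `∇_Y` on generators. -/
def CompatibleFlatConnections.onGen : μ.Gen (⊤ : Opens M) → μ.Gen (⊤ : Opens M)
  | .fn f => .fn (P.subbundle.lieDeriv Y f)
  | .sec i η => .sec i ((P.conn i).nabla Y η)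

lemma CompatibleFlatConnections.degree_onGen (a : μ.Gen (⊤ : Opens M)) :
    (P.onGen Y a).degree = a.degree := by
  cases a <;> rfl

/-- Locality of `∇_Y`: multiplying by a bump function makes the two generators globally equal. In
the Leibniz rule the terms with the derivative of the bump function have equal germs on both sides
and cancel. -/
lemma CompatibleFlatConnections.germ_onGen_eq {a b : μ.Gen (⊤ : Opens M)} {W : Opens M} {x : M} (hx : x ∈ W)
    (h : a.res (le_top : W ≤ ⊤) = b.res le_top) :
    μ.germ (Opens.mem_top x) (μ.gen (P.onGen Y a)) = μ.germ (Opens.mem_top x) (μ.gen (P.onGen Y b)) := by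
  obtain ⟨ρ, W', V, hxW', hW'W, hUV, h1, h0, h1', -⟩ := exists_bump_germ (μ := μ) hx
  have hab := germ_gen_eq_of_res_eq le_top le_top h hx
  have hρ : ∀ s : μ.Stalk x, μ.germ (Opens.mem_top x) (μ.gen (.fn ρ)) * s = s := fun s => by
    rw [h1' x hxW', one_mul]
  cases a with
  | fn f =>
    cases b with
    | fn g =>
      have h2 : f.res le_top = g.res (le_top : W ≤ ⊤) := by simpa only [Gen.res, Gen.fn.injEq] using h
      have h3 : ρ * f = ρ * g := SmoothFun.val_injective <| funext fun y => by
        rw [SmoothFun.val_mul, SmoothFun.val_mul, Pi.mul_apply, Pi.mul_apply]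
        rcases hUV y with hy | hy
        · exact congrArg _ (DFunLike.congr_fun h2 ⟨y, hy⟩)
        · rw [h0 y hy, zero_mul, zero_mul]
      have h4 := congrArg (fun f => μ.germ (Opens.mem_top x) (μ.gen (.fn (P.subbundle.lieDeriv Y f)))) h3
      simp only [lieDeriv_mul, gen_fn_add, gen_fn_mul, map_add, map_mul, hρ, hab] at h4
      exact add_left_cancel h4
    | sec i η => simp [Gen.res] at h
  | sec i η =>
    cases b with
    | fn g => simp [Gen.res] at h
    | sec j ζ =>
      obtain ⟨rfl, h2⟩ : i = j ∧ HEq (DualSec.res (le_top : W ≤ ⊤) η) (DualSec.res (le_top : W ≤ ⊤) ζ) := by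
        simpa only [Gen.res, Gen.sec.injEq] using h
      have h2 := eq_of_heq h2
      have h3 : DualSec.fsmul ρ η = DualSec.fsmul ρ ζ := DualSec.ext fun y => by
        change ρ.val y • η.1 y = ρ.val y • ζ.1 y
        rcases hUV y with hy | hy
        · exact congrArg _ (congrFun (congrArg Subtype.val h2) ⟨y, hy⟩)
        · rw [h0 y hy, zero_smul, zero_smul]
      have h4 := congrArg (fun f => μ.germ (Opens.mem_top x) (μ.gen (.sec i ((P.conn i).nabla Y f)))) h3
      simp only [(P.conn i).leibniz, gen_sec_add, gen_sec_fsmul, map_add, map_mul, hρ, hab] at h4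
      exact add_right_cancel h4

open TrivSqZeroExt in
/-- The germ of a generator together with the germ of its derivative. -/
def CompatibleFlatConnections.dualGen (x : M) (a : μ.Gen (⊤ : Opens M)) : DualNumber (μ.Stalk x) :=
  inl (μ.germ (Opens.mem_top x) (μ.gen a)) + inr (μ.germ (Opens.mem_top x) (μ.gen (P.onGen Y a)))

@[simp] lemma CompatibleFlatConnections.fst_dualGen (x : M) (a : μ.Gen (⊤ : Opens M)) :
    (P.dualGen Y x a).fst = μ.germ (Opens.mem_top x) (μ.gen a) := by simp [dualGen]

@[simp] lemma CompatibleFlatConnections.snd_dualGen (x : M) (a : μ.Gen (⊤ : Opens M)) :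
    (P.dualGen Y x a).snd = μ.germ (Opens.mem_top x) (μ.gen (P.onGen Y a)) := by simp [dualGen]

lemma CompatibleFlatConnections.dualGen_fn_add (x : M) (f g : SmoothFun m (⊤ : Opens M)) :
    P.dualGen Y x (.fn (f + g)) = P.dualGen Y x (.fn f) + P.dualGen Y x (.fn g) := by
  ext <;> simp [onGen, lieDeriv_add, gen_fn_add]

lemma CompatibleFlatConnections.dualGen_fn_mul (x : M) (f g : SmoothFun m (⊤ : Opens M)) :
    P.dualGen Y x (.fn (f * g)) = P.dualGen Y x (.fn f) * P.dualGen Y x (.fn g) := by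
  ext <;> simp [onGen, lieDeriv_mul, gen_fn_add, gen_fn_mul, add_comm]

lemma CompatibleFlatConnections.dualGen_fn_const (x : M) (c : ℝ) :
    P.dualGen Y x (.fn (algebraMap ℝ _ c)) = algebraMap ℝ _ c := by
  ext <;> simp [onGen, lieDeriv_const, gen_fn_zero, gen_fn_const, TrivSqZeroExt.algebraMap_eq_inl']

lemma CompatibleFlatConnections.dualGen_sec_add (x : M) (i : Fin n)
    (η ζ : DualSec m (Fib i) (E i) (⊤ : Opens M)) :
    P.dualGen Y x (.sec i (η + ζ)) = P.dualGen Y x (.sec i η) + P.dualGen Y x (.sec i ζ) := by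
  ext <;> simp [onGen, (P.conn i).add_right, gen_sec_add]

lemma CompatibleFlatConnections.dualGen_sec_fsmul (x : M) (i : Fin n) (f : SmoothFun m (⊤ : Opens M))
    (η : DualSec m (Fib i) (E i) (⊤ : Opens M)) :
    P.dualGen Y x (.sec i (DualSec.fsmul f η)) = P.dualGen Y x (.fn f) * P.dualGen Y x (.sec i η) := by
  ext <;> simp [onGen, (P.conn i).leibniz, gen_sec_add, gen_sec_fsmul]

lemma germ_gen_comm (x : M) (a b : μ.Gen (⊤ : Opens M)) :
    μ.germ (Opens.mem_top x) (μ.gen a) * μ.germ (Opens.mem_top x) (μ.gen b) =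
      (-1 : ℝ) ^ (a.degree * b.degree) •
        (μ.germ (Opens.mem_top x) (μ.gen b) * μ.germ (Opens.mem_top x) (μ.gen a)) := by
  rw [← map_mul, gen_comm, map_smul, map_mul]

/-- As `∇_Y` preserves degrees, both summands of the `ε`-part acquire the same Koszul sign. -/
lemma CompatibleFlatConnections.dualGen_comm (x : M) (a b : μ.Gen (⊤ : Opens M)) :
    P.dualGen Y x a * P.dualGen Y x b =
      (-1 : ℝ) ^ (a.degree * b.degree) • (P.dualGen Y x b * P.dualGen Y x a) := by
  ext
  · simpa using germ_gen_comm x a b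
  · simp only [TrivSqZeroExt.snd_mul, TrivSqZeroExt.snd_smul, fst_dualGen, snd_dualGen, smul_eq_mul,
      MulOpposite.smul_eq_mul_unop, MulOpposite.unop_op]
    rw [germ_gen_comm x a, germ_gen_comm x (P.onGen Y a), P.degree_onGen, P.degree_onGen, smul_add, add_comm]

/-- The `ε`-part of this relation is the compatibility of the connections with `μ^*`. -/
lemma CompatibleFlatConnections.dualGen_sec_mul (x : M) {i j l : Fin n} (h : deg i + deg j = deg l)
    (η : DualSec m (Fib i) (E i) (⊤ : Opens M)) (ζ : DualSec m (Fib j) (E j) (⊤ : Opens M)) :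
    P.dualGen Y x (.sec i η) * P.dualGen Y x (.sec j ζ) = P.dualGen Y x (.sec l (μ.mul h η ζ)) := by
  ext <;> simp [onGen, P.compatible, gen_sec_add, ← gen_sec_mul h, add_comm]

/-- The germ of a local generator together with the germ of its derivative. -/
def CompatibleFlatConnections.localDualGen {U : Opens M} {x : M} (hx : x ∈ U) (a : μ.Gen U) :
    DualNumber (μ.Stalk x) :=
  P.dualGen Y x (exists_gen_extension a hx).choose

/-- Connections act on global sections only, so local generators are extended first. Locality of
`∇_Y` makes the chosen extension irrelevant. -/
lemma CompatibleFlatConnections.localDualGen_eq {U W : Opens M} {x : M} (hx : x ∈ U) (hxW : x ∈ W)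
    (hW : W ≤ U) {a : μ.Gen U} {b : μ.Gen ⊤} (h : b.res le_top = a.res hW) :
    P.localDualGen Y hx a = P.dualGen Y x b := by
  obtain ⟨W', hW', hW'U, h'⟩ := (exists_gen_extension a hx).choose_spec
  have hxWW' : x ∈ W ⊓ W' := ⟨hxW, hW'⟩
  have h1 : (exists_gen_extension a hx).choose.res (le_top : W ⊓ W' ≤ ⊤) = b.res le_top := by
    rw [← Gen.res_res le_top inf_le_right, h', ← Gen.res_res le_top inf_le_left, h, Gen.res_res,
      Gen.res_res]
  ext
  · simpa [localDualGen] using germ_gen_eq_of_res_eq _ _ h1 hxWW'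
  · simpa [localDualGen] using P.germ_onGen_eq Y hxWW' h1

lemma CompatibleFlatConnections.exists_localDualGen_eq {U : Opens M} {x : M} (hx : x ∈ U) (a : μ.Gen U) :
    ∃ (b : μ.Gen ⊤) (W : Opens M) (_ : x ∈ W) (hW : W ≤ U), b.res le_top = a.res hW ∧
      P.localDualGen Y hx a = P.dualGen Y x b := by
  obtain ⟨b, W, hxW, hW, h⟩ := exists_gen_extension a hx
  exact ⟨b, W, hxW, hW, h, P.localDualGen_eq Y hx hxW hW h⟩

lemma exists_gen_extension₂ {U : Opens M} {x : M} (hx : x ∈ U) (a b : μ.Gen U) :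
    ∃ (a' b' : μ.Gen ⊤) (W : Opens M) (_ : x ∈ W) (hW : W ≤ U), a'.res le_top = a.res hW ∧
      b'.res le_top = b.res hW := by
  obtain ⟨a', W, hxW, hW, ha⟩ := exists_gen_extension a hx
  obtain ⟨b', W', hxW', hW', hb⟩ := exists_gen_extension b hx
  exact ⟨a', b', W ⊓ W', ⟨hxW, hxW'⟩, inf_le_left.trans hW,
    by rw [← Gen.res_res le_top inf_le_left, ha, Gen.res_res],
    by rw [← Gen.res_res le_top inf_le_right, hb, Gen.res_res]⟩

lemma Gen.eq_fn_of_res_eq {U W : Opens M} {hW : W ≤ U} {f : SmoothFun m U} {a : μ.Gen ⊤}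
    (h : a.res le_top = (Gen.fn f : μ.Gen U).res hW) :
    ∃ f', a = .fn f' ∧ f'.res le_top = f.res hW := by
  cases a with
  | fn g => exact ⟨g, rfl, by simpa only [Gen.res, Gen.fn.injEq] using h⟩
  | sec i η => simp [Gen.res] at h

lemma Gen.eq_sec_of_res_eq {U W : Opens M} {hW : W ≤ U} {i : Fin n} {η : DualSec m (Fib i) (E i) U}
    {a : μ.Gen ⊤} (h : a.res le_top = (Gen.sec i η : μ.Gen U).res hW) :
    ∃ η', a = .sec i η' ∧ DualSec.res le_top η' = DualSec.res hW η := by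
  cases a with
  | fn g => simp [Gen.res] at h
  | sec j ζ =>
    obtain ⟨rfl, h2⟩ : j = i ∧ HEq (DualSec.res (le_top : W ≤ ⊤) ζ) (DualSec.res hW η) := by
      simpa only [Gen.res, Gen.sec.injEq] using h
    exact ⟨ζ, rfl, eq_of_heq h2⟩

lemma res_mul {U V : Opens M} (hV : V ≤ U) {i j l : Fin n} (h : deg i + deg j = deg l)
    (η : DualSec m (Fib i) (E i) U) (ζ : DualSec m (Fib j) (E j) U) :
    DualSec.res hV (μ.mul h η ζ) = μ.mul h (DualSec.res hV η) (DualSec.res hV ζ) := rfl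

lemma CompatibleFlatConnections.localDualGen_mul {U : Opens M} {x : M} (hx : x ∈ U) {i j l : Fin n}
    (h : deg i + deg j = deg l) (η : DualSec m (Fib i) (E i) U) (ζ : DualSec m (Fib j) (E j) U) :
    P.localDualGen Y hx (.sec i η) * P.localDualGen Y hx (.sec j ζ) =
      P.localDualGen Y hx (.sec l (μ.mul h η ζ)) := by
  obtain ⟨a, b, W, hxW, hW, ha, hb⟩ := exists_gen_extension₂ (μ := μ) hx (.sec i η) (.sec j ζ)
  rw [P.localDualGen_eq Y hx hxW hW ha, P.localDualGen_eq Y hx hxW hW hb]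
  obtain ⟨η', rfl, hη⟩ := Gen.eq_sec_of_res_eq ha
  obtain ⟨ζ', rfl, hζ⟩ := Gen.eq_sec_of_res_eq hb
  have h2 : (Gen.sec l (μ.mul h η' ζ') : μ.Gen ⊤).res le_top = (Gen.sec l (μ.mul h η ζ)).res hW := by
    rw [Gen.res, Gen.res, res_mul, res_mul, hη, hζ]
  rw [P.dualGen_sec_mul Y x h, P.localDualGen_eq Y hx hxW hW h2]

/-- Each relation over `U` is replaced by the same relation between global generators that restrict
to the given ones near `x`, where it is already known. -/
lemma CompatibleFlatConnections.lift_localDualGen_eq {U : Opens M} {x : M} (hx : x ∈ U)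
    (a b : FreeAlgebra ℝ (μ.Gen U)) (hab : μ.FunRel U a b) :
    FreeAlgebra.lift ℝ (P.localDualGen Y hx) a = FreeAlgebra.lift ℝ (P.localDualGen Y hx) b := by
  have key : ∀ {W : Opens M} (_ : x ∈ W) (hW : W ≤ U) {a : μ.Gen U} {b : μ.Gen ⊤},
    b.res le_top = a.res hW → P.localDualGen Y hx a = P.dualGen Y x b := fun h₁ h₂ _ _ h =>
      P.localDualGen_eq Y hx h₁ h₂ h
  cases hab with
  | sym hab =>
    cases hab with
    | fn_add f g =>
      obtain ⟨f', g', W, hxW, hW, hf, hg⟩ := exists_gen_extension₂ (μ := μ) hx (.fn f) (.fn g)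
      simp only [map_add, FreeAlgebra.lift_ι_apply]
      rw [key hxW hW hf, key hxW hW hg]
      obtain ⟨f', rfl, hf'⟩ := Gen.eq_fn_of_res_eq hf
      obtain ⟨g', rfl, hg'⟩ := Gen.eq_fn_of_res_eq hg
      rw [← P.dualGen_fn_add]
      exact key hxW hW (congrArg Gen.fn (congrArg₂ (· + ·) hf' hg'))
    | fn_mul f g =>
      obtain ⟨f', g', W, hxW, hW, hf, hg⟩ := exists_gen_extension₂ (μ := μ) hx (.fn f) (.fn g)
      simp only [map_mul, FreeAlgebra.lift_ι_apply]
      rw [key hxW hW hf, key hxW hW hg]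
      obtain ⟨f', rfl, hf'⟩ := Gen.eq_fn_of_res_eq hf
      obtain ⟨g', rfl, hg'⟩ := Gen.eq_fn_of_res_eq hg
      rw [← P.dualGen_fn_mul]
      exact key hxW hW (congrArg Gen.fn (congrArg₂ (· * ·) hf' hg'))
    | fn_const c =>
      simp only [FreeAlgebra.lift_ι_apply, AlgHom.commutes]
      rw [← P.dualGen_fn_const Y]
      exact key hx le_rfl rfl
    | sec_add i f g =>
      obtain ⟨f', g', W, hxW, hW, hf, hg⟩ := exists_gen_extension₂ (μ := μ) hx (.sec i f) (.sec i g)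
      simp only [map_add, FreeAlgebra.lift_ι_apply]
      rw [key hxW hW hf, key hxW hW hg]
      obtain ⟨f', rfl, hf'⟩ := Gen.eq_sec_of_res_eq hf
      obtain ⟨g', rfl, hg'⟩ := Gen.eq_sec_of_res_eq hg
      rw [← P.dualGen_sec_add]
      exact key hxW hW (congrArg (Gen.sec i) (congrArg₂ (· + ·) hf' hg'))
    | sec_fsmul i f g =>
      obtain ⟨f', g', W, hxW, hW, hf, hg⟩ := exists_gen_extension₂ (μ := μ) hx (.fn f) (.sec i g)
      simp only [map_mul, FreeAlgebra.lift_ι_apply]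
      rw [key hxW hW hf, key hxW hW hg]
      obtain ⟨f', rfl, hf'⟩ := Gen.eq_fn_of_res_eq hf
      obtain ⟨g', rfl, hg'⟩ := Gen.eq_sec_of_res_eq hg
      rw [← P.dualGen_sec_fsmul]
      exact key hxW hW (congrArg (Gen.sec i) (congrArg₂ DualSec.fsmul hf' hg'))
    | comm a b =>
      obtain ⟨a', b', W, hxW, hW, ha, hb⟩ := exists_gen_extension₂ hx a b
      simp only [map_mul, map_smul, FreeAlgebra.lift_ι_apply]
      rw [key hxW hW ha, key hxW hW hb, P.dualGen_comm, ← Gen.degree_res hW a, ← Gen.degree_res hW b,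
        ← ha, ← hb, Gen.degree_res, Gen.degree_res]
  | mul hd f g =>
    simp only [map_mul, FreeAlgebra.lift_ι_apply]
    exact P.localDualGen_mul Y hx hd f g

/-- `∇_Y` as a homomorphism into the dual numbers. -/
def CompatibleFlatConnections.preHom {U : Opens M} {x : M} (hx : x ∈ U) :
    μ.PreFun U →ₐ[ℝ] DualNumber (μ.Stalk x) :=
  PreFun.lift μ (P.localDualGen Y hx) (P.lift_localDualGen_eq Y hx)

lemma CompatibleFlatConnections.preHom_gen {U : Opens M} {x : M} (hx : x ∈ U) (a : μ.Gen U) :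
    P.preHom Y hx (μ.gen a) = P.localDualGen Y hx a := PreFun.lift_gen μ _ _ a

lemma CompatibleFlatConnections.preHom_res {U V : Opens M} (h : V ≤ U) {x : M} (hx : x ∈ V)
    (a : μ.PreFun U) : P.preHom Y hx (PreFun.res μ h a) = P.preHom Y (h hx) a := by
  have : (P.preHom Y hx).comp (PreFun.res μ h) = P.preHom Y (h hx) := by
    refine PreFun.hom_ext μ fun a => ?_
    rw [AlgHom.comp_apply, PreFun.res_gen, P.preHom_gen, P.preHom_gen]
    obtain ⟨b, W, hxW, hW, hb, hb'⟩ := P.exists_localDualGen_eq Y hx (a.res h)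
    rw [hb', P.localDualGen_eq Y (h hx) hxW (hW.trans h) (hb.trans (Gen.res_res h hW a))]
  rw [← this]; rfl

/-- `∇_Y` on the stalk at `x`, as a homomorphism into the dual numbers. -/
def CompatibleFlatConnections.stalkHom (x : M) : μ.Stalk x →ₐ[ℝ] DualNumber (μ.Stalk x) :=
  DirectLimit.Algebra.lift _ (μ.nhdsRes x) _
    (fun U => P.preHom Y (OrderDual.ofDual U).mem)
    (fun _ _ h a => P.preHom_res Y h _ a)

lemma CompatibleFlatConnections.stalkHom_germ {U : Opens M} {x : M} (hx : x ∈ U) (a : μ.PreFun U) :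
    P.stalkHom Y x (μ.germ hx a) = P.preHom Y hx a := rfl

lemma CompatibleFlatConnections.stalkHom_germ_gen (x : M) (a : μ.Gen ⊤) :
    P.stalkHom Y x (μ.germ (Opens.mem_top x) (μ.gen a)) = P.dualGen Y x a := by
  rw [P.stalkHom_germ, P.preHom_gen, P.localDualGen_eq Y _ (Opens.mem_top x) le_top rfl]

/-- A homomorphism into the dual numbers lying over the identity has a derivation as its `ε`-part.
-/
lemma CompatibleFlatConnections.fst_stalkHom {x : M} (s : μ.Stalk x) : (P.stalkHom Y x s).fst = s := by
  induction s using Stalk.induction with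
  | one => simp
  | gen_mul a s hs => rw [map_mul, P.stalkHom_germ_gen, TrivSqZeroExt.fst_mul, P.fst_dualGen, hs]
  | zero => simp
  | add s t hs ht => rw [map_add, TrivSqZeroExt.fst_add, hs, ht]
  | smul c s hs => rw [map_smul, TrivSqZeroExt.fst_smul, hs]

/-- The operator `∇_Y` on the stalk at `x`. -/
def CompatibleFlatConnections.stalkNabla (x : M) : Module.End ℝ (μ.Stalk x) where
  toFun s := (P.stalkHom Y x s).snd
  map_add' s t := by rw [map_add, TrivSqZeroExt.snd_add]
  map_smul' c s := by rw [map_smul, TrivSqZeroExt.snd_smul, RingHom.id_apply]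

lemma CompatibleFlatConnections.stalkNabla_gen (x : M) (a : μ.Gen ⊤) :
    P.stalkNabla Y x (μ.germ (Opens.mem_top x) (μ.gen a)) =
      μ.germ (Opens.mem_top x) (μ.gen (P.onGen Y a)) :=
  (congrArg TrivSqZeroExt.snd (P.stalkHom_germ_gen Y x a)).trans (P.snd_dualGen Y x a)

lemma CompatibleFlatConnections.stalkNabla_mul (x : M) (s t : μ.Stalk x) :
    P.stalkNabla Y x (s * t) = P.stalkNabla Y x s * t + s * P.stalkNabla Y x t := by
  change (P.stalkHom Y x (s * t)).snd = (P.stalkHom Y x s).snd * t + s * (P.stalkHom Y x t).snd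
  rw [map_mul, TrivSqZeroExt.snd_mul, P.fst_stalkHom, P.fst_stalkHom, add_comm]
  rfl

lemma CompatibleFlatConnections.isStalkDerivation_stalkNabla (x : M) :
    IsStalkDerivation 0 (P.stalkNabla Y x) where
  map_homog l s hs := by
    refine Stalk.homog_induction (P := fun l s => P.stalkNabla Y x s ∈ Stalk.homog μ x (l + 0))
      ?_ ?_ ?_ ?_ ?_ hs
    · have h := P.stalkNabla_mul Y x 1 1
      rw [one_mul, mul_one, one_mul] at h
      rw [left_eq_add.1 h]
      exact zero_mem _
    · intro a k s hs h
      rw [add_zero] at h ⊢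
      rw [P.stalkNabla_mul, P.stalkNabla_gen]
      have h1 := germ_mem_homog (Opens.mem_top x) (PreFun.gen_mem_homog (P.onGen Y a))
      rw [P.degree_onGen] at h1
      exact add_mem (Stalk.mul_mem_homog h1 hs)
        (Stalk.mul_mem_homog (germ_mem_homog (Opens.mem_top x) (PreFun.gen_mem_homog a)) h)
    · intro k
      rw [map_zero]
      exact zero_mem _
    · intro k s t hs ht
      rw [map_add]
      exact add_mem hs ht
    · intro k c s hs
      rw [map_smul]
      exact Submodule.smul_mem _ _ hs
  leibniz l s hs t := by
    rw [P.stalkNabla_mul, mul_zero, sgn, zpow_zero, one_smul]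

/-- This supplies the condition that sections go to sections. The neighbourhood shrinks because a
generator agrees with a global one only near the given point. -/
lemma CompatibleFlatConnections.exists_stalkNabla_germ {W : Opens M} (a : μ.PreFun W) :
    ∀ x ∈ W, ∃ (W' : Opens M) (_ : x ∈ W') (t : μ.Fun W'),
      ∀ (y : M) (hy : y ∈ W) (hy' : y ∈ W'), P.stalkNabla Y y (μ.germ hy a) = μ.stalkAt hy' t := by
  induction a using PreFun.induction with
  | hgen a =>
    intro x hx
    obtain ⟨b, W', hxW', hW', hb⟩ := exists_gen_extension a hx
    refine ⟨W', hxW', Fun.res μ le_top (μ.toFun (μ.gen (P.onGen Y b))), fun y hy hy' => ?_⟩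
    rw [stalkAt_res, stalkAt_toFun, ← P.stalkNabla_gen, ← germ_gen_eq_of_res_eq hW' le_top hb.symm hy']
  | hc c =>
    refine fun x hx => ⟨W, hx, 0, fun y hy _ => ?_⟩
    rw [AlgHom.commutes, Algebra.algebraMap_eq_smul_one, map_smul,
      (P.isStalkDerivation_stalkNabla Y y).map_one, smul_zero, map_zero]
  | hadd a b ha hb =>
    intro x hx
    obtain ⟨W₁, h₁, s, hs⟩ := ha x hx
    obtain ⟨W₂, h₂, t, ht⟩ := hb x hx
    refine ⟨W₁ ⊓ W₂, ⟨h₁, h₂⟩, Fun.res μ inf_le_left s + Fun.res μ inf_le_right t, fun y hy hy' => ?_⟩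
    rw [map_add, map_add, hs y hy hy'.1, ht y hy hy'.2, map_add]
    rfl
  | hmul a b ha hb =>
    intro x hx
    obtain ⟨W₁, h₁, s, hs⟩ := ha x hx
    obtain ⟨W₂, h₂, t, ht⟩ := hb x hx
    refine ⟨W ⊓ (W₁ ⊓ W₂), ⟨hx, h₁, h₂⟩,
      Fun.res μ (inf_le_right.trans inf_le_left) s * Fun.res μ inf_le_left (μ.toFun b) +
        Fun.res μ inf_le_left (μ.toFun a) * Fun.res μ (inf_le_right.trans inf_le_right) t, fun y hy hy' => ?_⟩
    rw [map_mul, P.stalkNabla_mul, hs y hy hy'.2.1, ht y hy hy'.2.2, map_add, map_mul, map_mul]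
    rfl

lemma CompatibleFlatConnections.exists_vectorField :
    ∃ X ∈ μ.vectorFields ⊤ 0, ∀ x hx, stalkOp X hx = P.stalkNabla Y x := by
  refine exists_vectorField_of_smooth (fun x _ => P.stalkNabla Y x)
    (fun x _ => P.isStalkDerivation_stalkNabla Y x) fun s x hx => ?_
  obtain ⟨W, hW, a, hxW, ha⟩ := exists_local s hx
  obtain ⟨W', hxW', t, ht⟩ := P.exists_stalkNabla_germ Y a x hxW
  refine ⟨W ⊓ W', ⟨hxW, hxW'⟩, Fun.res μ inf_le_right t, fun y hU hy => ?_⟩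
  rw [stalkAt_res, ← ht y hy.1, ← ha y hy.1]

/-- The vector field of degree `0` defined by `∇_Y`. -/
def CompatibleFlatConnections.field : Module.End ℝ (μ.Fun ⊤) := (P.exists_vectorField Y).choose

lemma CompatibleFlatConnections.field_mem : P.field Y ∈ μ.vectorFields ⊤ 0 :=
  (P.exists_vectorField Y).choose_spec.1

lemma CompatibleFlatConnections.stalkOp_field {x : M} (hx : x ∈ (⊤ : Opens M)) :
    stalkOp (P.field Y) hx = P.stalkNabla Y x := (P.exists_vectorField Y).choose_spec.2 x hx

lemma CompatibleFlatConnections.field_toFun (a : μ.Gen ⊤) :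
    P.field Y (μ.toFun (μ.gen a)) = μ.toFun (μ.gen (P.onGen Y a)) :=
  Fun.ext_stalkAt fun x hx => by
    rw [← stalkOp_stalkAt (P.field_mem Y), P.stalkOp_field]
    exact P.stalkNabla_gen Y x a

lemma CompatibleFlatConnections.field_ofFn (f : SmoothFun m (⊤ : Opens M)) :
    P.field Y (μ.ofFn f) = μ.ofFn (P.subbundle.lieDeriv Y f) := P.field_toFun Y (.fn f)

lemma CompatibleFlatConnections.field_ofSec (i : Fin n) (η : DualSec m (Fib i) (E i) (⊤ : Opens M)) :
    P.field Y (μ.ofSec i η) = μ.ofSec i ((P.conn i).nabla Y η) := P.field_toFun Y (.sec i η)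

lemma vectorField_ext_gen {k : ℤ} {X X' : Module.End ℝ (μ.Fun ⊤)} (hX : X ∈ μ.vectorFields ⊤ k)
    (hX' : X' ∈ μ.vectorFields ⊤ k) (h₁ : ∀ f, X (μ.ofFn f) = X' (μ.ofFn f))
    (h₂ : ∀ i η, X (μ.ofSec i η) = X' (μ.ofSec i η)) : X = X' :=
  vectorField_ext hX hX' fun x hx =>
    (isStalkDerivation_stalkOp hX hx).ext (isStalkDerivation_stalkOp hX' hx) fun a => by
      rw [← stalkAt_toFun hx, stalkOp_stalkAt hX, stalkOp_stalkAt hX']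
      cases a with
      | fn f => exact congrArg _ (h₁ f)
      | sec i η => exact congrArg _ (h₂ i η)

/-- Derivations of a stalk are determined by the germs of global generators, so acting as `∇_Y`
becomes an equality of stalk operators, which glues and restricts easily. -/
lemma actsAsNabla_iff {U V : Opens M} (h : V ≤ U) {X : Module.End ℝ (μ.Fun U)}
    (hX : X ∈ μ.vectorFields U 0) : μ.ActsAsNabla P h X Y ↔
      ∀ (y : M) (hy : y ∈ V), stalkOp X (h hy) = stalkOp (P.field Y) (Opens.mem_top y) := by
  constructor
  · rintro ⟨h₁, h₂⟩ y hy
    refine (isStalkDerivation_stalkOp hX (h hy)).ext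
      (isStalkDerivation_stalkOp (P.field_mem Y) (Opens.mem_top y)) fun a => ?_
    rw [← stalkAt_toFun (Opens.mem_top y), stalkOp_stalkAt (P.field_mem Y), P.field_toFun,
      ← stalkAt_res (le_top : U ≤ ⊤) (h hy), stalkOp_stalkAt hX, ← stalkAt_res h hy,
      ← stalkAt_res (le_top : V ≤ ⊤) hy, res_toFun, res_toFun, PreFun.res_gen, PreFun.res_gen]
    cases a with
    | fn f => exact congrArg _ (h₁ f)
    | sec i η => exact congrArg _ (h₂ i η)
  · intro H
    have key : ∀ a : μ.Gen ⊤, Fun.res μ h (X (μ.toFun (μ.gen (a.res le_top)))) =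
        μ.toFun (μ.gen ((P.onGen Y a).res le_top)) := fun a => Fun.ext_stalkAt fun y hy => by
      rw [stalkAt_res, ← stalkOp_stalkAt hX, H y hy, ← PreFun.res_gen, ← res_toFun, stalkAt_res,
        stalkOp_stalkAt (P.field_mem Y), P.field_toFun, ← PreFun.res_gen, ← res_toFun, stalkAt_res]
    exact ⟨fun f => key (.fn f), fun i η => key (.sec i η)⟩

end CoalgebraBundle

end NablaField

/-! ### Symbols of degree 0 derivations and frames of distributions. -/

section Frames

variable {m n : ℕ} {M : Type*} [TopologicalSpace M] [ChartedSpace (EuclideanSpace ℝ (Fin m)) M]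
  [T2Space M] [IsManifold (𝓡 m) ∞ M]
  {Fib : Fin n → Type*} [∀ i, NormedAddCommGroup (Fib i)] [∀ i, NormedSpace ℝ (Fib i)]
  [∀ i, FiniteDimensional ℝ (Fib i)]
  {E : Fin n → M → Type*} [∀ i, TopologicalSpace (TotalSpace (Fib i) (E i))]
  [∀ i x, AddCommGroup (E i x)] [∀ i x, Module ℝ (E i x)] [∀ i x, TopologicalSpace (E i x)]
  [∀ i, FiberBundle (Fib i) (E i)] [∀ i, VectorBundle ℝ (Fib i) (E i)]

namespace CoalgebraBundle

variable {μ : CoalgebraBundle m Fib E}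


section Symbol

variable {x : M}

/-- The tangent vector of an operator on the stalk at `x`, as a functional. -/
def stalkSymbol (ξ : Module.End ℝ (μ.Stalk x)) : μ.Stalk x →ₗ[ℝ] ℝ :=
  (Stalk.eval μ x).toLinearMap ∘ₗ ξ

lemma stalkSymbol_apply (ξ : Module.End ℝ (μ.Stalk x)) (s : μ.Stalk x) :
    stalkSymbol ξ s = Stalk.eval μ x (ξ s) := rfl

/-- The operator `ξ` on the stalk at `x` acts on functions by the tangent vector `v`. -/
def IsSymbol (ξ : Module.End ℝ (μ.Stalk x)) (v : TangentSpace (𝓡 m) x) : Prop :=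
  ∀ f : SmoothFun m (⊤ : Opens M),
    stalkSymbol ξ (μ.germ (Opens.mem_top x) (μ.gen (.fn f))) = dirDeriv f.val x v

lemma IsSymbol.unique {ξ : Module.End ℝ (μ.Stalk x)} {v w : TangentSpace (𝓡 m) x}
    (hv : IsSymbol ξ v) (hw : IsSymbol ξ w) : v = w :=
  eq_of_dirDeriv_eq fun f => (hv f).symm.trans (hw f)

lemma IsSymbol.sub {ξ ξ' : Module.End ℝ (μ.Stalk x)} {v w : TangentSpace (𝓡 m) x}
    (hv : IsSymbol ξ v) (hw : IsSymbol ξ' w) : IsSymbol (ξ - ξ') (v - w) := fun f => by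
  rw [dirDeriv_sub_vec, ← hv, ← hw, stalkSymbol_apply, LinearMap.sub_apply, map_sub]
  rfl

lemma IsSymbol.sum_mul {ι : Type*} (t : Finset ι) (s : ι → μ.Stalk x)
    {ξ : ι → Module.End ℝ (μ.Stalk x)} {v : ι → TangentSpace (𝓡 m) x} (h : ∀ a, IsSymbol (ξ a) (v a)) :
    IsSymbol (∑ a ∈ t, LinearMap.mulLeft ℝ (s a) ∘ₗ ξ a) (∑ a ∈ t, Stalk.eval μ x (s a) • v a) :=
  fun f => by
    rw [dirDeriv_sum_vec, stalkSymbol_apply, LinearMap.sum_apply, map_sum]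
    refine Finset.sum_congr rfl fun a _ => ?_
    rw [dirDeriv_smul_vec, ← h]
    exact map_mul (Stalk.eval μ x) _ _

lemma eval_germ_fn (f : SmoothFun m (⊤ : Opens M)) :
    Stalk.eval μ x (μ.germ (Opens.mem_top x) (μ.gen (.fn f))) = f.val x := PreFun.eval_fn μ _ f

lemma IsStalkDerivation.exists_isSymbol {ξ : Module.End ℝ (μ.Stalk x)} (hξ : IsStalkDerivation 0 ξ) :
    ∃ v, IsSymbol ξ v := by
  let δ : SmoothFun m (⊤ : Opens M) →ₗ[ℝ] ℝ :=
    { toFun := fun f => stalkSymbol ξ (μ.germ (Opens.mem_top x) (μ.gen (.fn f)))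
      map_add' := fun f g => by rw [gen_fn_add, map_add, map_add]
      map_smul' := fun c f => by rw [gen_fn_smul, map_smul, map_smul, RingHom.id_apply] }
  refine exists_tangentVector x δ fun f g => ?_
  change stalkSymbol ξ _ = _ * stalkSymbol ξ _ + _ * stalkSymbol ξ _
  rw [gen_fn_mul, map_mul, stalkSymbol_apply, hξ.leibniz 0 _ (germ_mem_homog _ (PreFun.gen_mem_homog (.fn f))),
    map_add, map_smul, map_mul, map_mul, eval_germ_fn, eval_germ_fn, zero_mul, sgn, zpow_zero, one_smul,
    add_comm, mul_comm (Stalk.eval μ x _) (g.val x)]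
  rfl

lemma Stalk.functional_eq_zero {φ : μ.Stalk x →ₗ[ℝ] ℝ}
    (h : ∀ k ≠ 0, ∀ s ∈ Stalk.homog μ x k, φ s = 0)
    (h' : ∀ f : SmoothFun m (⊤ : Opens M), φ (μ.germ (Opens.mem_top x) (μ.gen (.fn f))) = 0) : φ = 0 := by
  refine LinearMap.ext fun s => ?_
  have hs := Stalk.iSup_homog s
  induction hs using Submodule.iSup_induction' with
  | mem k s hs =>
    by_cases hk : k = 0
    · subst hk
      obtain ⟨b, hb, rfl⟩ := Stalk.exists_global_homog hs
      obtain ⟨f, rfl⟩ := PreFun.exists_fn_of_mem_homog hb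
      exact h' f
    · exact h k hk s hs
  | zero => rw [map_zero, map_zero]
  | add s t _ _ hs ht => rw [map_add, map_add, hs, ht]

/-- A derivation of degree 0 followed by evaluation kills all homogeneous germs of nonzero degree.
Its symbol functional is therefore determined by its values on functions, that is, by the tangent
vector. -/
lemma linearIndependent_stalkSymbol_iff {d : ℕ} {ξ : Fin d → Module.End ℝ (μ.Stalk x)}
    (hξ : ∀ a, IsStalkDerivation 0 (ξ a)) {v : Fin d → TangentSpace (𝓡 m) x}
    (h : ∀ a, IsSymbol (ξ a) (v a)) :
    LinearIndependent ℝ (fun a => stalkSymbol (ξ a)) ↔ LinearIndependent ℝ v := by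
  have key : ∀ g : Fin d → ℝ, ∑ a, g a • stalkSymbol (ξ a) = 0 ↔ ∑ a, g a • v a = 0 := fun g => by
    have h1 : ∀ f : SmoothFun m (⊤ : Opens M), (∑ a, g a • stalkSymbol (ξ a))
        (μ.germ (Opens.mem_top x) (μ.gen (.fn f))) = dirDeriv f.val x (∑ a, g a • v a) := fun f => by
      rw [dirDeriv_sum_vec, LinearMap.sum_apply]
      refine Finset.sum_congr rfl fun a _ => ?_
      rw [dirDeriv_smul_vec, ← h a, LinearMap.smul_apply, smul_eq_mul]
    refine ⟨fun hg => eq_of_dirDeriv_eq fun f => ?_, fun hg => Stalk.functional_eq_zero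
      (fun k hk s hs => ?_) fun f => ?_⟩
    · rw [← h1, hg, dirDeriv_zero_vec, LinearMap.zero_apply]
    · rw [LinearMap.sum_apply]
      refine Finset.sum_eq_zero fun a _ => ?_
      have h2 := (hξ a).map_homog k s hs
      rw [add_zero] at h2
      rw [LinearMap.smul_apply, stalkSymbol_apply, Stalk.eval_eq_zero hk h2, smul_zero]
    · rw [h1, hg, dirDeriv_zero_vec]
  rw [Fintype.linearIndependent_iff, Fintype.linearIndependent_iff]
  exact forall_congr' fun g => by rw [key g]

end Symbol

lemma linearIndependent_tangentVector_iff {d : ℕ} {U : Opens M} {X : Fin d → Module.End ℝ (μ.Fun U)}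
    (hX : ∀ a, X a ∈ μ.vectorFields U 0) (y : U) :
    LinearIndependent ℝ (fun a => μ.tangentVector (X a) y) ↔
      LinearIndependent ℝ (fun a => stalkSymbol (stalkOp (X a) y.2)) := by
  have h : (fun a => μ.tangentVector (X a) y) =
      (LinearMap.lcomp ℝ ℝ (μ.stalkAt y.2).toLinearMap) ∘ fun a => stalkSymbol (stalkOp (X a) y.2) :=
    funext fun a => LinearMap.ext fun s => congrArg (Stalk.eval μ (y : M)) (stalkOp_stalkAt (hX a) y.2 s).symm
  rw [h]
  refine LinearMap.linearIndependent_iff _ (LinearMap.ker_eq_bot.2 fun φ ψ hφ => LinearMap.ext fun s => ?_)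
  obtain ⟨s, rfl⟩ := stalkAt_surjective y.2 s
  exact LinearMap.congr_fun hφ s

section Rank

/-- The index set of a frame of a distribution of rank `d | 0 | ⋯ | 0`. -/
def singleEquiv (n d : ℕ) : (Σ k : Fin (n + 1), Fin ((Pi.single 0 d : Fin (n + 1) → ℕ) k)) ≃ Fin d where
  toFun p := p.2.castLE (by
    by_cases h : p.1 = 0
    · rw [h, Pi.single_eq_same]
    · rw [Pi.single_eq_of_ne h]
      exact Nat.zero_le d)
  invFun a := ⟨0, a.cast (Pi.single_eq_same (M := fun _ => ℕ) 0 d).symm⟩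
  left_inv := by
    rintro ⟨k, a⟩
    by_cases h : k = 0
    · subst h
      rfl
    · rw [Pi.single_eq_of_ne h] at a
      exact a.elim0
  right_inv a := rfl

lemma fst_eq_zero {n d : ℕ} (p : Σ k : Fin (n + 1), Fin ((Pi.single 0 d : Fin (n + 1) → ℕ) k)) :
    p.1 = 0 := by
  obtain ⟨a, rfl⟩ := (singleEquiv n d).symm.surjective p
  rfl

lemma GradedSubsheaf.hasRank_iff {d : ℕ} (D : μ.GradedSubsheaf) :
    D.HasRank (Pi.single 0 d) ↔ ∀ x : M, ∃ U : Opens M, x ∈ U ∧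
      ∃ X : Fin d → Module.End ℝ (μ.Fun U), (∀ a, X a ∈ μ.vectorFields U 0) ∧
        (∀ y : U, LinearIndependent ℝ fun a => μ.tangentVector (X a) y) ∧
        ∀ (k : ℤ) (Y : Module.End ℝ (μ.Fun U)), Y ∈ D.carrier U k ↔
          ∃ f : Fin d → μ.Fun U, (∀ a, f a ∈ μ.homog U k) ∧ Y = ∑ a, μ.fmul (f a) (X a) := by
  refine forall_congr' fun x => exists_congr fun U => and_congr_right fun _ => ?_
  have h0 : ∀ (p : Σ k : Fin (n + 1), Fin ((Pi.single 0 d : Fin (n + 1) → ℕ) k)),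
      ((p.1 : ℕ) : ℤ) = 0 := fun p => by rw [fst_eq_zero p]; rfl
  simp only [h0, neg_zero, add_zero]
  constructor
  · rintro ⟨X, h₁, h₂, h₃⟩
    refine ⟨X ∘ (singleEquiv n d).symm, fun a => h₁ _, fun y =>
      (h₂ y).comp _ (singleEquiv n d).symm.injective, fun k Y => (h₃ k Y).trans ⟨?_, ?_⟩⟩
    · rintro ⟨f, hf, rfl⟩
      exact ⟨f ∘ (singleEquiv n d).symm, fun a => hf _,
        (Equiv.sum_comp (singleEquiv n d).symm fun p => μ.fmul (f p) (X p)).symm⟩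
    · rintro ⟨f, hf, rfl⟩
      refine ⟨f ∘ singleEquiv n d, fun a => hf _, ?_⟩
      rw [← Equiv.sum_comp (singleEquiv n d)]
      simp
  · rintro ⟨X, h₁, h₂, h₃⟩
    refine ⟨X ∘ singleEquiv n d, fun a => h₁ _, fun y =>
      (h₂ y).comp _ (singleEquiv n d).injective, fun k Y => (h₃ k Y).trans ⟨?_, ?_⟩⟩
    · rintro ⟨f, hf, rfl⟩
      exact ⟨f ∘ singleEquiv n d, fun a => hf _,
        (Equiv.sum_comp (singleEquiv n d) fun p => μ.fmul (f p) (X p)).symm⟩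
    · rintro ⟨f, hf, rfl⟩
      refine ⟨f ∘ (singleEquiv n d).symm, fun a => hf _, ?_⟩
      rw [← Equiv.sum_comp (singleEquiv n d).symm]
      simp

/-- A frame over `U` of the graded subsheaf `D`, consisting of global vector fields of degree `0`. -/
structure GradedSubsheaf.IsFrame (D : μ.GradedSubsheaf) {d : ℕ} (U : Opens M)
    (Z : Fin d → Module.End ℝ (μ.Fun ⊤)) : Prop where
  mem : ∀ a, Z a ∈ D.carrier ⊤ 0
  linearIndependent : ∀ y ∈ U,
    LinearIndependent ℝ fun a => stalkSymbol (stalkOp (Z a) (Opens.mem_top y))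
  exists_eq_sum : ∀ (k : ℤ) (V : Opens M), ∀ X ∈ D.carrier V k, ∀ y ∈ U, y ∈ V →
    ∃ (W : Opens M) (_ : y ∈ W) (f : Fin d → μ.Fun W), (∀ a, f a ∈ μ.homog W k) ∧
      ∀ (z : M) (hV : z ∈ V) (hW : z ∈ W), stalkOp X hV =
        ∑ a, LinearMap.mulLeft ℝ (μ.stalkAt hW (f a)) ∘ₗ stalkOp (Z a) (Opens.mem_top z)

/-- The local generators become global after multiplication by bump functions. To expand a field
given over another open set, it is made global near the point, restricted to `U`, and expressed
there in the original generators. -/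
lemma GradedSubsheaf.HasRank.exists_isFrame {D : μ.GradedSubsheaf} {d : ℕ}
    (hD : D.HasRank (Pi.single 0 d)) (x : M) :
    ∃ (U : Opens M) (_ : x ∈ U) (Z : Fin d → Module.End ℝ (μ.Fun ⊤)), D.IsFrame U Z := by
  classical
  obtain ⟨U, hxU, X, hX, hindep, hspan⟩ := D.hasRank_iff.1 hD x
  have hXD : ∀ a, X a ∈ D.carrier U 0 := fun a => (hspan 0 _).2
    ⟨fun b => if b = a then 1 else 0, fun b => by
      beta_reduce
      split_ifs
      · exact one_mem_homog
      · exact zero_mem _, by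
      rw [Finset.sum_eq_single a]
      · beta_reduce
        rw [if_pos rfl]
        exact LinearMap.ext fun s => (one_mul _).symm
      · intro b _ hb
        beta_reduce
        rw [if_neg hb]
        exact LinearMap.ext fun s => zero_mul _
      · exact fun h => absurd (Finset.mem_univ a) h⟩
  choose Z hZ W hxW hWU hZX using fun a => D.exists_global (hXD a) hxU
  obtain ⟨W', hxW', hW'⟩ := exists_open_nhds (x := x) (p := fun y => y ∈ U ∧ ∀ a, y ∈ W a)
    (Filter.Eventually.and (U.isOpen.mem_nhds hxU) (Filter.eventually_all.2 fun a => (W a).isOpen.mem_nhds (hxW a)))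
  refine ⟨W', hxW', Z, hZ, fun y hy => ?_, fun k V Y hY y hy hyV => ?_⟩
  · have h := (linearIndependent_tangentVector_iff hX ⟨y, (hW' y hy).1⟩).1 (hindep _)
    have h1 : ∀ a, stalkOp (Z a) (Opens.mem_top y) = stalkOp (X a) (hW' y hy).1 :=
      fun a => hZX a y ((hW' y hy).2 a)
    simpa only [h1] using h
  · obtain ⟨Y', hY', W'', hyW'', hW''V, hYY'⟩ := D.exists_global hY hyV
    obtain ⟨Y'', hY'', hY''eq⟩ := exists_restriction (le_top : U ≤ ⊤) (D.le _ _ hY')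
    have hmem := D.res_mem ⊤ U le_top k Y' hY' Y'' hY'' ((isRestriction_iff le_top (D.le _ _ hY') hY'').2 hY''eq)
    obtain ⟨f, hf, rfl⟩ := (hspan k _).1 hmem
    refine ⟨U ⊓ W'' ⊓ W', ⟨⟨(hW' y hy).1, hyW''⟩, hy⟩,
      fun a => Fun.res μ (inf_le_left.trans inf_le_left) (f a), fun a => res_mem_homog _ (hf a),
      fun z hV hz => ?_⟩
    rw [← hYY' z hz.1.2, ← hY''eq z hz.1.1, stalkOp_sum]
    refine Finset.sum_congr rfl fun a _ => ?_
    rw [stalkOp_fmul, hZX a z ((hW' z hz.2).2 a)]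
    rfl

/-- All generators have degree 0, so the part of degree `k` is locally generated by the degree 0
part with coefficients of degree `k`. -/
lemma GradedSubsheaf.eq_of_carrier_zero {D D' : μ.GradedSubsheaf} {d : ℕ}
    (hD : D.HasRank (Pi.single 0 d)) (h : ∀ U, D.carrier U 0 ≤ D'.carrier U 0) (U : Opens M) (k : ℤ) :
    D.carrier U k ≤ D'.carrier U k := fun X hX =>
  D'.mem_of_stalkOp (D.le U k hX) fun x hx => by
    obtain ⟨V, hxV, Z, hZ⟩ := hD.exists_isFrame x
    obtain ⟨W, hxW, f, hf, hW⟩ := hZ.exists_eq_sum k U X hX x hxV hx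
    choose Z' hZ'mem hZ' using fun a => exists_restriction (le_top : W ≤ ⊤) (D.le _ _ (hZ.mem a))
    refine ⟨W, hxW, ∑ a, μ.fmul (f a) (Z' a), sum_mem fun a _ => ?_, W, hxW, fun y hU hy _ => ?_⟩
    · have h1 := D'.res_mem ⊤ W le_top 0 (Z a) (h ⊤ (hZ.mem a)) (Z' a) (hZ'mem a)
        ((isRestriction_iff le_top (D.le _ _ (hZ.mem a)) (hZ'mem a)).2 (hZ' a))
      have h2 := D'.fmul_mem W k 0 _ (hf a) _ h1
      rwa [add_zero] at h2
    · rw [hW y hU hy, stalkOp_sum]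
      exact Finset.sum_congr rfl fun a _ => by rw [stalkOp_fmul, hZ' a y hy]

end Rank

end CoalgebraBundle

end Frames

/-! ### Frames and sections of an involutive subbundle. -/

section Sections

variable {m : ℕ} {M : Type*} [TopologicalSpace M] [ChartedSpace (EuclideanSpace ℝ (Fin m)) M]
  [T2Space M] [IsManifold (𝓡 m) ∞ M]

namespace TangentSubbundle

variable {d : ℕ} (S : TangentSubbundle m M d)

lemma exists_global_frame (x : M) : ∃ (U : Opens M) (_ : x ∈ U) (Z : Fin d → S.sections),
    ∀ y ∈ U, LinearIndependent ℝ (fun a => (Z a).1 y) ∧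
      Submodule.span ℝ (Set.range fun a => (Z a).1 y) = S.fiber y := by
  obtain ⟨U, hxU, Z, hZ, hU⟩ := S.exists_frame x
  obtain ⟨ρ, hρ, h1, h2, -⟩ := exists_bump m hxU
  obtain ⟨W, hxW, hW⟩ := exists_open_nhds (Filter.Eventually.and h1 (U.isOpen.mem_nhds hxU))
  refine ⟨W, hxW, fun a => ⟨fun y => ρ y • Z a y, ?_, fun y => ?_⟩, fun y hy => ?_⟩
  · exact ContMDiffOn.smul_section_of_tsupport hρ.contMDiffOn U.isOpen h2 (hZ a)
  · by_cases hy : y ∈ U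
    · refine Submodule.smul_mem _ _ ?_
      rw [← (hU y hy).2]
      exact Submodule.subset_span ⟨a, rfl⟩
    · beta_reduce
      rw [image_eq_zero_of_notMem_tsupport fun h => hy (h2 h), zero_smul]
      exact zero_mem _
  · have h3 : ρ y = 1 := (hW y hy).1
    simpa only [h3, one_smul] using hU y (hW y hy).2

/-- Smooth coefficients with respect to a local frame. -/
lemma exists_dual_frame (x : M) : ∃ (U : Opens M) (_ : x ∈ U) (Z : Fin d → S.sections)
    (u : Fin d → SmoothFun m (⊤ : Opens M)) (N : Fin d → Fin d → SmoothFun m (⊤ : Opens M)),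
    ∀ y ∈ U, LinearIndependent ℝ (fun a => (Z a).1 y) ∧
      Submodule.span ℝ (Set.range fun a => (Z a).1 y) = S.fiber y ∧
      ∀ a c, ∑ b, (S.lieDeriv (Z a) (u b)).val y * (N b c).val y = if a = c then 1 else 0 := by
  obtain ⟨U, hxU, Z, hZ⟩ := S.exists_global_frame x
  obtain ⟨u, N, h⟩ := exists_dual_functions (fun a => (Z a).2.1) (hZ x hxU).1
  obtain ⟨W, hxW, hW⟩ := exists_open_nhds (Filter.Eventually.and h (U.isOpen.mem_nhds hxU))
  exact ⟨W, hxW, Z, u, N, fun y hy => ⟨(hZ y (hW y hy).2).1, (hZ y (hW y hy).2).2, (hW y hy).1⟩⟩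

lemma exists_section {x : M} {v : TangentSpace (𝓡 m) x} (hv : v ∈ S.fiber x) :
    ∃ Y : S.sections, Y.1 x = v := by
  obtain ⟨U, hxU, Z, hZ⟩ := S.exists_global_frame x
  rw [← (hZ x hxU).2] at hv
  obtain ⟨c, rfl⟩ := (Submodule.mem_span_range_iff_exists_fun ℝ).1 hv
  refine ⟨∑ a, c a • Z a, ?_⟩
  rw [AddSubmonoidClass.coe_finsetSum, Finset.sum_apply]
  rfl

variable {S}

/-- If `Y = ∑ t_a Z_a` at `y`, then `Y(u_b) = ∑ t_a Z_a(u_b)`, and the inverse matrix `N` recovers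
`t_c`. The resulting coefficients are values of global smooth functions. -/
lemma eq_sum_coeff {y : M} {Z : Fin d → S.sections} {u : Fin d → SmoothFun m (⊤ : Opens M)}
    {N : Fin d → Fin d → SmoothFun m (⊤ : Opens M)}
    (hZ : Submodule.span ℝ (Set.range fun a => (Z a).1 y) = S.fiber y)
    (hN : ∀ a c, ∑ b, (S.lieDeriv (Z a) (u b)).val y * (N b c).val y = if a = c then 1 else 0)
    (Y : S.sections) :
    Y.1 y = ∑ c, (∑ b, (S.lieDeriv Y (u b)).val y * (N b c).val y) • (Z c).1 y := by
  have h := Y.2.2 y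
  rw [← hZ] at h
  obtain ⟨t, ht⟩ := (Submodule.mem_span_range_iff_exists_fun ℝ).1 h
  rw [← ht]
  refine Finset.sum_congr rfl fun c _ => ?_
  have h1 : ∀ b, (S.lieDeriv Y (u b)).val y = ∑ a, t a * (S.lieDeriv (Z a) (u b)).val y := fun b => by
    change dirDeriv (u b).val y (Y.1 y) = _
    rw [← ht, dirDeriv_sum_vec]
    exact Finset.sum_congr rfl fun a _ => dirDeriv_smul_vec _ _ _ _
  congr 1
  simp only [h1, Finset.sum_mul, mul_assoc]
  rw [Finset.sum_comm]
  simp only [← Finset.mul_sum, hN]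
  simp

lemma lieDeriv_add_left (Y Y' : S.sections) (f : SmoothFun m (⊤ : Opens M)) :
    S.lieDeriv (Y + Y') f = S.lieDeriv Y f + S.lieDeriv Y' f :=
  SmoothFun.val_injective <| funext fun x => dirDeriv_add_vec f.val x (Y.1 x) (Y'.1 x)

lemma lieDeriv_fsmul (g : SmoothFun m (⊤ : Opens M)) (Y : S.sections) (f : SmoothFun m (⊤ : Opens M)) :
    S.lieDeriv (S.fsmul g Y) f = g * S.lieDeriv Y f :=
  SmoothFun.val_injective <| funext fun x => dirDeriv_smul_vec f.val x (g.val x) (Y.1 x)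

lemma lieDeriv_bracket (h : S.IsInvolutive) (Y Y' : S.sections) (f : SmoothFun m (⊤ : Opens M)) :
    S.lieDeriv (h.bracket Y Y') f =
      S.lieDeriv Y (S.lieDeriv Y' f) - S.lieDeriv Y' (S.lieDeriv Y f) :=
  SmoothFun.val_injective <| funext fun x =>
    dirDeriv_mlieBracket f.contMDiff_val' (Y.2.1 x) (Y'.2.1 x)

end TangentSubbundle

end Sections

/-! ### From compatible flat connections to an involutive distribution. -/

section Distribution

variable {m n : ℕ} {M : Type*} [TopologicalSpace M] [ChartedSpace (EuclideanSpace ℝ (Fin m)) M]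
  [T2Space M] [IsManifold (𝓡 m) ∞ M]
  {Fib : Fin n → Type*} [∀ i, NormedAddCommGroup (Fib i)] [∀ i, NormedSpace ℝ (Fib i)]
  [∀ i, FiniteDimensional ℝ (Fib i)]
  {E : Fin n → M → Type*} [∀ i, TopologicalSpace (TotalSpace (Fib i) (E i))]
  [∀ i x, AddCommGroup (E i x)] [∀ i x, Module ℝ (E i x)] [∀ i x, TopologicalSpace (E i x)]
  [∀ i, FiberBundle (Fib i) (E i)] [∀ i, VectorBundle ℝ (Fib i) (E i)]

namespace CoalgebraBundle

variable {μ : CoalgebraBundle m Fib E}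


lemma _root_.NMan.SmoothFun.val_sum {ι : Type*} (t : Finset ι) (f : ι → SmoothFun m (⊤ : Opens M)) (x : M) :
    (∑ b ∈ t, f b).val x = ∑ b ∈ t, (f b).val x := by
  classical
  induction t using Finset.induction_on with
  | empty => rfl
  | insert a t ha ih => rw [Finset.sum_insert ha, Finset.sum_insert ha, SmoothFun.val_add, Pi.add_apply, ih]

lemma gen_fn_sum {U : Opens M} {ι : Type*} (t : Finset ι) (f : ι → SmoothFun m U) :
    μ.gen (.fn (∑ b ∈ t, f b)) = ∑ b ∈ t, μ.gen (.fn (f b)) := by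
  classical
  induction t using Finset.induction_on with
  | empty => exact gen_fn_zero
  | insert a t ha ih => rw [Finset.sum_insert ha, Finset.sum_insert ha, gen_fn_add, ih]

section Bracket

variable {U : Opens M} {k l : ℤ}

lemma _root_.NMan.sgn_add (a b : ℤ) : sgn (a + b) = sgn a * sgn b := zpow_add₀ (by norm_num) a b

lemma _root_.NMan.sgn_mul_self (a : ℤ) : sgn a * sgn a = 1 := by
  rw [sgn, ← mul_zpow]
  norm_num

lemma gradedBracket_mem {X Y : Module.End ℝ (μ.Fun U)} (hX : X ∈ μ.vectorFields U k)
    (hY : Y ∈ μ.vectorFields U l) : μ.gradedBracket k l X Y ∈ μ.vectorFields U (k + l) := by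
  have happ : ∀ s, μ.gradedBracket k l X Y s = X (Y s) - sgn (k * l) • Y (X s) := fun _ => rfl
  refine ⟨fun j s hs => ?_, fun j s hs t => ?_⟩
  · rw [happ]
    have h1 := hX.1 _ _ (hY.1 j s hs)
    have h2 := hY.1 _ _ (hX.1 j s hs)
    rw [show j + l + k = j + (k + l) by ring] at h1
    rw [show j + k + l = j + (k + l) by ring] at h2
    exact sub_mem h1 (Submodule.smul_mem _ _ h2)
  -- This sign identity cancels the mixed terms `X s * Y t` coming from the two orders of
  -- composition.
  · have hc : sgn (k * l) * (sgn (j * l) * sgn (k * l)) = sgn (j * l) := by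
      rw [mul_left_comm, sgn_mul_self, mul_one]
    rw [happ, happ, happ, hY.2 j s hs, hX.2 j s hs, map_add, map_add, map_smul, map_smul,
      hX.2 _ _ (hY.1 j s hs), hX.2 _ _ hs, hY.2 _ _ (hX.1 j s hs), hY.2 _ _ hs, add_mul, add_mul,
      mul_add j k l, sgn_add, sgn_add, sgn_add, mul_comm l k, sub_mul, mul_sub, smul_mul_assoc, mul_smul_comm]
    simp only [smul_add, smul_sub, smul_smul, hc]
    module

lemma gradedBracket_zero_zero_apply (X Y : Module.End ℝ (μ.Fun U)) (s : μ.Fun U) :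
    μ.gradedBracket 0 0 X Y s = X (Y s) - Y (X s) := by
  simp [gradedBracket, sgn]

lemma stalkOp_comp {X : Module.End ℝ (μ.Fun U)} (hX : X ∈ μ.vectorFields U k)
    (Y : Module.End ℝ (μ.Fun U)) {x : M} (hx : x ∈ U) :
    stalkOp (X ∘ₗ Y) hx = stalkOp X hx ∘ₗ stalkOp Y hx :=
  LinearMap.ext fun _ => (stalkOp_stalkAt hX hx _).symm

lemma stalkOp_smul (c : ℝ) (X : Module.End ℝ (μ.Fun U)) {x : M} (hx : x ∈ U) :
    stalkOp (c • X) hx = c • stalkOp X hx := by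
  unfold stalkOp
  rw [LinearMap.smul_comp, LinearMap.comp_smul]

lemma stalkOp_gradedBracket {X Y : Module.End ℝ (μ.Fun U)} (hX : X ∈ μ.vectorFields U k)
    (hY : Y ∈ μ.vectorFields U l) {x : M} (hx : x ∈ U) : stalkOp (μ.gradedBracket k l X Y) hx =
      stalkOp X hx ∘ₗ stalkOp Y hx - sgn (k * l) • (stalkOp Y hx ∘ₗ stalkOp X hx) := by
  unfold gradedBracket
  rw [stalkOp_sub, stalkOp_smul, stalkOp_comp hX, stalkOp_comp hY]

end Bracket

namespace CompatibleFlatConnections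

variable {d : ℕ} (P : μ.CompatibleFlatConnections d)

lemma field_add (Y Y' : P.subbundle.sections) : P.field (Y + Y') = P.field Y + P.field Y' :=
  vectorField_ext_gen (P.field_mem _) (add_mem (P.field_mem _) (P.field_mem _))
    (fun f => by
      rw [LinearMap.add_apply, P.field_ofFn, P.field_ofFn, P.field_ofFn,
        TangentSubbundle.lieDeriv_add_left, ofFn_add])
    fun i η => by
      rw [LinearMap.add_apply, P.field_ofSec, P.field_ofSec, P.field_ofSec, (P.conn i).add_left, ofSec_add]

lemma fmul_field_mem {U : Opens M} {k : ℤ} {f : μ.Fun U} (hf : f ∈ μ.homog U k)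
    {X : Module.End ℝ (μ.Fun U)} (hX : X ∈ μ.vectorFields U 0) : μ.fmul f X ∈ μ.vectorFields U k := by
  have h := fmul_mem_vectorFields hf hX
  rwa [add_zero] at h

lemma field_fsmul (f : SmoothFun m (⊤ : Opens M)) (Y : P.subbundle.sections) :
    P.field (P.subbundle.fsmul f Y) = μ.fmul (μ.ofFn f) (P.field Y) :=
  vectorField_ext_gen (P.field_mem _) (fmul_field_mem (ofFn_mem_homog f) (P.field_mem _))
    (fun g => by
      rw [P.field_ofFn, TangentSubbundle.lieDeriv_fsmul, ofFn_mul, ← P.field_ofFn]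
      rfl)
    fun i η => by
      rw [P.field_ofSec, (P.conn i).fsmul_left, ofSec_fsmul, ← P.field_ofSec]
      rfl

/-- It is enough to compare on generators: on functions this is the commutator formula for the Lie
bracket, on sections it is flatness. -/
lemma field_bracket (Y Y' : P.subbundle.sections) :
    P.field (P.involutive.bracket Y Y') = μ.gradedBracket 0 0 (P.field Y) (P.field Y') := by
  have happ := gradedBracket_zero_zero_apply (P.field Y) (P.field Y')
  have hmem := gradedBracket_mem (P.field_mem Y) (P.field_mem Y')
  rw [add_zero] at hmem
  refine vectorField_ext_gen (P.field_mem _) hmem (fun f => ?_) fun i η => ?_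
  · rw [happ, P.field_ofFn, P.field_ofFn, P.field_ofFn, P.field_ofFn, P.field_ofFn,
      TangentSubbundle.lieDeriv_bracket, eq_sub_iff_add_eq, ← ofFn_add, sub_add_cancel]
  · rw [happ, P.field_ofSec, P.field_ofSec, P.field_ofSec, P.field_ofSec, P.field_ofSec, ← P.flat i,
      eq_sub_iff_add_eq, ← ofSec_add]
    exact congrArg (μ.ofSec i) (DualSec.ext fun x =>
      sub_add_cancel (((P.conn i).nabla Y ((P.conn i).nabla Y' η)).1 x) _)

/-- Linearity of `∇_Y` over functions in `Y` allows multiplication by a bump function, after which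
the two sections agree globally. -/
lemma stalkOp_field_congr {Y Y' : P.subbundle.sections} {W : Opens M} (h : ∀ y ∈ W, Y.1 y = Y'.1 y)
    {x : M} (hx : x ∈ W) :
    stalkOp (P.field Y) (Opens.mem_top x) = stalkOp (P.field Y') (Opens.mem_top x) := by
  obtain ⟨ρ, W', V, hxW', hW'W, hUV, -, h0, h1, -⟩ := exists_bump_germ (μ := μ) hx
  have h2 : P.subbundle.fsmul ρ Y = P.subbundle.fsmul ρ Y' := Subtype.ext <| funext fun y => by
    change ρ.val y • Y.1 y = ρ.val y • Y'.1 y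
    rcases hUV y with hy | hy
    · rw [h y hy]
    · rw [h0 y hy, zero_smul, zero_smul]
  have h3 := congrArg (fun Y => stalkOp (P.field Y) (Opens.mem_top x)) h2
  simpa only [P.field_fsmul, stalkOp_fmul, stalkAt_ofFn, h1 x hxW', LinearMap.mulLeft_one,
    LinearMap.id_comp] using h3

lemma field_sum {ι : Type*} (t : Finset ι) (Y : ι → P.subbundle.sections) :
    P.field (∑ a ∈ t, Y a) = ∑ a ∈ t, P.field (Y a) :=
  map_sum (AddMonoidHom.mk' P.field P.field_add) Y t

/-- The vector fields of degree `k` generated by the vector fields `∇_Y`. -/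
def globalFields (k : ℤ) : Submodule ℝ (Module.End ℝ (μ.Fun ⊤)) :=
  Submodule.span ℝ {X | ∃ f ∈ μ.homog ⊤ k, ∃ Y, X = μ.fmul f (P.field Y)}

lemma globalFields_le (k : ℤ) : P.globalFields k ≤ μ.vectorFields ⊤ k :=
  Submodule.span_le.2 fun _ ⟨_, hf, _, h⟩ => h ▸ fmul_field_mem hf (P.field_mem _)

lemma fmul_mem_globalFields {k l : ℤ} {f : μ.Fun ⊤} (hf : f ∈ μ.homog ⊤ l) {X : Module.End ℝ (μ.Fun ⊤)}
    (hX : X ∈ P.globalFields k) : μ.fmul f X ∈ P.globalFields (l + k) := by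
  unfold globalFields at hX
  induction hX using Submodule.span_induction with
  | mem X hX =>
    obtain ⟨g, hg, Y, rfl⟩ := hX
    exact Submodule.subset_span ⟨f * g, mul_mem_homog hf hg, Y,
      LinearMap.ext fun _ => (mul_assoc _ _ _).symm⟩
  | zero =>
    rw [fmul, LinearMap.comp_zero]
    exact zero_mem _
  | add X Y _ _ hX hY =>
    rw [fmul, LinearMap.comp_add]
    exact add_mem hX hY
  | smul c X _ hX =>
    rw [fmul, LinearMap.comp_smul]
    exact Submodule.smul_mem _ c hX

lemma field_mem_globalFields (Y : P.subbundle.sections) : P.field Y ∈ P.globalFields 0 :=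
  Submodule.subset_span ⟨1, one_mem_homog, Y, LinearMap.ext fun _ => (one_mul _).symm⟩

/-- Coefficients of degree 0 are smooth functions and can be absorbed into the section. This is why
the degree 0 part of the distribution contains, locally, only fields `∇_Y`. -/
lemma exists_eq_field_of_mem_globalFields {X : Module.End ℝ (μ.Fun ⊤)} (hX : X ∈ P.globalFields 0) :
    ∃ Y, X = P.field Y := by
  unfold globalFields at hX
  induction hX using Submodule.span_induction with
  | mem X hX =>
    obtain ⟨g, hg, Y, rfl⟩ := hX
    obtain ⟨g, rfl⟩ := exists_ofFn hg
    exact ⟨_, (P.field_fsmul g Y).symm⟩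
  | zero => exact ⟨0, (map_zero (AddMonoidHom.mk' P.field P.field_add)).symm⟩
  | add X Y _ _ hX hY =>
    obtain ⟨Y, rfl⟩ := hX
    obtain ⟨Y', rfl⟩ := hY
    exact ⟨_, (P.field_add Y Y').symm⟩
  | smul c X _ hX =>
    obtain ⟨Y, rfl⟩ := hX
    refine ⟨P.subbundle.fsmul (c • 1) Y, ?_⟩
    rw [P.field_fsmul, ofFn_smul, ofFn_one]
    exact LinearMap.ext fun s => (smul_one_mul c _).symm

/-- The graded Leibniz rule leaves the two terms that differentiate a coefficient and one
commutator; by `field_bracket` the commutator is again some `∇_Y`. -/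
lemma gradedBracket_fmul (f g : μ.Fun ⊤) {k l : ℤ} (hf : f ∈ μ.homog ⊤ k) (hg : g ∈ μ.homog ⊤ l)
    (Y Y' : P.subbundle.sections) :
    μ.gradedBracket k l (μ.fmul f (P.field Y)) (μ.fmul g (P.field Y')) =
      μ.fmul (f * P.field Y g) (P.field Y') - sgn (k * l) • μ.fmul (g * P.field Y' f) (P.field Y) +
        μ.fmul (f * g) (P.field (P.involutive.bracket Y Y')) := by
  refine LinearMap.ext fun s => ?_
  have h := P.field_bracket Y Y'
  rw [h]
  change f * P.field Y (g * P.field Y' s) - sgn (k * l) • (g * P.field Y' (f * P.field Y s)) =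
    f * P.field Y g * P.field Y' s - sgn (k * l) • (g * P.field Y' f * P.field Y s) +
      f * g * (P.field Y (P.field Y' s) - sgn (0 * 0) • P.field Y' (P.field Y s))
  rw [(P.field_mem Y).2 l g hg, (P.field_mem Y').2 k f hf, mul_zero, mul_zero, mul_zero, sgn, zpow_zero,
    one_smul, one_smul, one_smul, mul_add, mul_add, mul_sub, ← mul_assoc, ← mul_assoc, ← mul_assoc,
    ← mul_assoc, mul_comm_homog hf hg, smul_mul_assoc, smul_mul_assoc, smul_add]
  abel

lemma gradedBracket_mem_globalFields {X X' : Module.End ℝ (μ.Fun ⊤)} {k l : ℤ}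
    (hX : X ∈ P.globalFields k) (hX' : X' ∈ P.globalFields l) :
    μ.gradedBracket k l X X' ∈ P.globalFields (k + l) := by
  unfold globalFields at hX hX'
  induction hX using Submodule.span_induction with
  | mem X hX =>
    induction hX' using Submodule.span_induction with
    | mem X' hX' =>
      obtain ⟨f, hf, Y, rfl⟩ := hX
      obtain ⟨g, hg, Y', rfl⟩ := hX'
      rw [P.gradedBracket_fmul f g hf hg]
      have h1 := mul_mem_homog hf ((P.field_mem Y).1 l g hg)
      have h2 := mul_mem_homog hg ((P.field_mem Y').1 k f hf)
      rw [add_zero] at h1 h2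
      rw [add_comm] at h2
      exact add_mem (sub_mem (Submodule.subset_span ⟨_, h1, _, rfl⟩)
        (Submodule.smul_mem _ _ (Submodule.subset_span ⟨_, h2, _, rfl⟩)))
        (Submodule.subset_span ⟨_, mul_mem_homog hf hg, _, rfl⟩)
    | zero =>
      rw [gradedBracket, LinearMap.comp_zero, LinearMap.zero_comp, smul_zero, sub_zero]
      exact zero_mem _
    | add A B _ _ hA hB =>
      have h : μ.gradedBracket k l X (A + B) = μ.gradedBracket k l X A + μ.gradedBracket k l X B := by
        simp only [gradedBracket, LinearMap.comp_add, LinearMap.add_comp, smul_add]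
        abel
      rw [h]
      exact add_mem hA hB
    | smul c A _ hA =>
      have h : μ.gradedBracket k l X (c • A) = c • μ.gradedBracket k l X A := by
        simp only [gradedBracket, LinearMap.comp_smul, LinearMap.smul_comp, smul_sub, smul_comm c]
      rw [h]
      exact Submodule.smul_mem _ c hA
  | zero =>
    rw [gradedBracket, LinearMap.comp_zero, LinearMap.zero_comp, smul_zero, sub_zero]
    exact zero_mem _
  | add A B _ _ hA hB =>
    have h : μ.gradedBracket k l (A + B) X' = μ.gradedBracket k l A X' + μ.gradedBracket k l B X' := by
      simp only [gradedBracket, LinearMap.comp_add, LinearMap.add_comp, smul_add]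
      abel
    rw [h]
    exact add_mem hA hB
  | smul c A _ hA =>
    have h : μ.gradedBracket k l (c • A) X' = c • μ.gradedBracket k l A X' := by
      simp only [gradedBracket, LinearMap.comp_smul, LinearMap.smul_comp, smul_sub, smul_comm c]
    rw [h]
    exact Submodule.smul_mem _ c hA

/-- The distribution defined by compatible flat connections. -/
def distribution : μ.GradedSubsheaf where
  carrier U k :=
    { carrier := {X | X ∈ μ.vectorFields U k ∧ ∀ x ∈ U, ∃ (W : Opens M) (_ : x ∈ W),
        ∃ X' ∈ P.globalFields k, ∀ (y : M) (hU : y ∈ U), y ∈ W →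
          stalkOp X hU = stalkOp X' (Opens.mem_top y)}
      add_mem' := by
        rintro X Y ⟨hX, hX'⟩ ⟨hY, hY'⟩
        refine ⟨add_mem hX hY, fun x hx => ?_⟩
        obtain ⟨W, hxW, X', hX', hW⟩ := hX' x hx
        obtain ⟨V, hxV, Y', hY', hV⟩ := hY' x hx
        refine ⟨W ⊓ V, ⟨hxW, hxV⟩, X' + Y', add_mem hX' hY', fun y hU hy => ?_⟩
        rw [stalkOp_add, stalkOp_add, hW y hU hy.1, hV y hU hy.2]
      zero_mem' := ⟨zero_mem _, fun x hx => ⟨⊤, Opens.mem_top x, 0, zero_mem _, fun y hU _ => by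
        rw [stalkOp_zero, stalkOp_zero]⟩⟩
      smul_mem' := by
        rintro c X ⟨hX, hX'⟩
        refine ⟨Submodule.smul_mem _ c hX, fun x hx => ?_⟩
        obtain ⟨W, hxW, X', hX', hW⟩ := hX' x hx
        refine ⟨W, hxW, c • X', Submodule.smul_mem _ c hX', fun y hU hy => ?_⟩
        rw [stalkOp_smul, stalkOp_smul, hW y hU hy] }
  le U k X hX := hX.1
  fmul_mem U l k f hf X hX := by
    refine ⟨fmul_mem_vectorFields hf hX.1, fun x hx => ?_⟩
    obtain ⟨W, hxW, X', hX', hW⟩ := hX.2 x hx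
    -- The coefficient `f` exists only over `U`; near `x` it is replaced by a global homogeneous
    -- function with the same germ.
    obtain ⟨g, hg, hgf⟩ := exists_homog_stalkAt_eq (U := ⊤) (Opens.mem_top x) (mem_homog_iff.1 hf x hx)
    obtain ⟨V, h₁, h₂, hxV, hV⟩ := exists_eq_of_stalkAt_eq _ hx hgf
    refine ⟨W ⊓ V, ⟨hxW, hxV⟩, μ.fmul g X', P.fmul_mem_globalFields hg hX', fun y hU hy => ?_⟩
    rw [stalkOp_fmul, stalkOp_fmul, hW y hU hy.1, hV y hy.2]
  res_mem U V h k X hX Y hY hXY := by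
    refine ⟨hY, fun x hx => ?_⟩
    obtain ⟨W, hxW, X', hX', hW⟩ := hX.2 x (h hx)
    exact ⟨W, hxW, X', hX', fun y hU hy =>
      ((isRestriction_iff h hX.1 hY).1 hXY y hU).trans (hW y (h hU) hy)⟩
  glue_mem U k X hX H := by
    refine ⟨hX, fun x hx => ?_⟩
    obtain ⟨V, h, hxV, Y, hY, hXY⟩ := H x hx
    obtain ⟨W, hxW, X', hX', hW⟩ := hY.2 x hxV
    exact ⟨W ⊓ V, ⟨hxW, hxV⟩, X', hX', fun y hU hy =>
      ((isRestriction_iff h hX hY.1).1 hXY y hy.2).symm.trans (hW y hy.2 hy.1)⟩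

lemma isInvolutive_distribution : P.distribution.IsInvolutive := by
  intro U k l X hX Y hY
  refine ⟨gradedBracket_mem hX.1 hY.1, fun x hx => ?_⟩
  obtain ⟨W, hxW, X', hX', hW⟩ := hX.2 x hx
  obtain ⟨V, hxV, Y', hY', hV⟩ := hY.2 x hx
  refine ⟨W ⊓ V, ⟨hxW, hxV⟩, _, P.gradedBracket_mem_globalFields hX' hY', fun y hU hy => ?_⟩
  rw [stalkOp_gradedBracket hX.1 hY.1,
    stalkOp_gradedBracket (P.globalFields_le k hX') (P.globalFields_le l hY'), hW y hU hy.1, hV y hU hy.2]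

lemma corresponds_distribution : μ.Corresponds P.distribution P := by
  intro U X
  refine and_congr_right fun hX => forall₂_congr fun x hx => ⟨?_, ?_⟩
  · rintro ⟨W, hxW, X', hX', hW⟩
    obtain ⟨Y, rfl⟩ := P.exists_eq_field_of_mem_globalFields hX'
    exact ⟨U ⊓ W, inf_le_left, ⟨hx, hxW⟩, Y, (actsAsNabla_iff P Y inf_le_left hX).2 fun y hy =>
      hW y hy.1 hy.2⟩
  · rintro ⟨V, h, hxV, Y, hY⟩
    exact ⟨V, hxV, P.field Y, P.field_mem_globalFields Y, fun y _ hy =>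
      (actsAsNabla_iff P Y h hX).1 hY y hy⟩

/-- The operators of the distribution in terms of a local frame of the subbundle. -/
lemma exists_stalkOp_eq_sum {U : Opens M} {Z : Fin d → P.subbundle.sections}
    {u : Fin d → SmoothFun m (⊤ : Opens M)} {N : Fin d → Fin d → SmoothFun m (⊤ : Opens M)}
    (hU : ∀ y ∈ U, Submodule.span ℝ (Set.range fun a => (Z a).1 y) = P.subbundle.fiber y ∧
      ∀ a c, ∑ b, (P.subbundle.lieDeriv (Z a) (u b)).val y * (N b c).val y = if a = c then 1 else 0)
    {k : ℤ} {X : Module.End ℝ (μ.Fun ⊤)} (hX : X ∈ P.globalFields k) {y : M} (hy : y ∈ U) :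
    ∃ f : Fin d → μ.Stalk y, stalkOp X (Opens.mem_top y) =
      ∑ a, LinearMap.mulLeft ℝ (f a) ∘ₗ stalkOp (P.field (Z a)) (Opens.mem_top y) := by
  unfold globalFields at hX
  induction hX using Submodule.span_induction with
  | mem X hX =>
    obtain ⟨f, hf, Y, rfl⟩ := hX
    -- The coefficients of `Y` in the frame `Z`, from `eq_sum_coeff`.
    let g : Fin d → SmoothFun m (⊤ : Opens M) := fun c => ∑ b, P.subbundle.lieDeriv Y (u b) * N b c
    have hg : ∀ z ∈ U, Y.1 z = (∑ a, P.subbundle.fsmul (g a) (Z a) : P.subbundle.sections).1 z := by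
      intro z hz
      have h1 : ∀ a, (g a).val z = ∑ b, (P.subbundle.lieDeriv Y (u b)).val z * (N b a).val z :=
        fun a => SmoothFun.val_sum _ _ z
      rw [TangentSubbundle.eq_sum_coeff (hU z hz).1 (hU z hz).2 Y, AddSubmonoidClass.coe_finsetSum,
        Finset.sum_apply]
      exact Finset.sum_congr rfl fun a _ => by rw [← h1 a]; rfl
    refine ⟨fun a => μ.stalkAt (Opens.mem_top y) f * μ.stalkAt (Opens.mem_top y) (μ.ofFn (g a)), ?_⟩
    rw [stalkOp_fmul, P.stalkOp_field_congr hg hy, P.field_sum, stalkOp_sum]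
    refine LinearMap.ext fun s => ?_
    rw [LinearMap.comp_apply, LinearMap.sum_apply, LinearMap.sum_apply, map_sum]
    refine Finset.sum_congr rfl fun a _ => ?_
    rw [P.field_fsmul, stalkOp_fmul]
    exact (mul_assoc (μ.stalkAt (Opens.mem_top y) f) (μ.stalkAt (Opens.mem_top y) (μ.ofFn (g a)))
      (stalkOp (P.field (Z a)) (Opens.mem_top y) s)).symm
  | zero => exact ⟨0, by simp [stalkOp_zero]⟩
  | add A B _ _ hA hB =>
    obtain ⟨f, hf⟩ := hA
    obtain ⟨g, hg⟩ := hB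
    refine ⟨f + g, ?_⟩
    rw [stalkOp_add, hf, hg, ← Finset.sum_add_distrib]
    exact Finset.sum_congr rfl fun a _ => LinearMap.ext fun s => (add_mul _ _ _).symm
  | smul c A _ hA =>
    obtain ⟨f, hf⟩ := hA
    refine ⟨c • f, ?_⟩
    rw [stalkOp_smul, hf, Finset.smul_sum]
    exact Finset.sum_congr rfl fun a _ => LinearMap.ext fun s =>
      (smul_mul_assoc c (f a) (stalkOp (P.field (Z a)) (Opens.mem_top y) s)).symm

lemma isSymbol_field (Y : P.subbundle.sections) (x : M) :
    IsSymbol (stalkOp (P.field Y) (Opens.mem_top x)) (Y.1 x) := fun f => by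
  rw [stalkSymbol_apply, P.stalkOp_field, P.stalkNabla_gen]
  exact eval_germ_fn _

/-- Membership in the distribution gives coefficients `f_a` only stalk by stalk. Applying `Y = ∑ f_a
∇_{Z_a}` to the `u_b` and multiplying by `N` yields `f_c = ∑ Y(u_b) N_{bc}`. The right side is
defined over all of `U`, so the frame generates over `U` itself. -/
lemma hasRank_distribution : P.distribution.HasRank (Pi.single 0 d) := by
  refine P.distribution.hasRank_iff.2 fun x => ?_
  obtain ⟨U, hxU, Z, u, N, hU⟩ := P.subbundle.exists_dual_frame x
  choose X hX hXZ using fun a => exists_restriction (le_top : U ≤ ⊤) (P.field_mem (Z a))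
  have hXD : ∀ a, X a ∈ P.distribution.carrier U 0 := fun a =>
    ⟨hX a, fun y _ => ⟨⊤, Opens.mem_top y, P.field (Z a), P.field_mem_globalFields (Z a),
      fun z hz _ => hXZ a z hz⟩⟩
  refine ⟨U, hxU, X, hX, fun y => ?_, fun k Y => ⟨fun hY => ?_, ?_⟩⟩
  · rw [linearIndependent_tangentVector_iff hX, linearIndependent_stalkSymbol_iff
      (fun a => isStalkDerivation_stalkOp (hX a) y.2) (v := fun a => (Z a).1 y)]
    · exact (hU y y.2).1
    · intro a
      rw [hXZ]
      exact P.isSymbol_field (Z a) y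
  · have hYu : ∀ b, Y (μ.ofFn ((u b).res le_top)) ∈ μ.homog U k := fun b => by
      have h := hY.1.1 0 _ (ofFn_mem_homog ((u b).res le_top))
      rwa [zero_add] at h
    refine ⟨fun c => ∑ b, Y (μ.ofFn ((u b).res le_top)) * μ.ofFn ((N b c).res le_top),
      fun c => sum_mem fun b _ => ?_, vectorField_ext hY.1 (sum_mem fun a _ => ?_) fun y hy => ?_⟩
    · have h := mul_mem_homog (hYu b) (ofFn_mem_homog ((N b c).res le_top))
      rwa [add_zero] at h
    · refine fmul_field_mem (sum_mem fun b _ => ?_) (hX a)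
      have h := mul_mem_homog (hYu b) (ofFn_mem_homog ((N b a).res le_top))
      rwa [add_zero] at h
    · obtain ⟨W, hyW, Y', hY', hW⟩ := hY.2 y hy
      obtain ⟨f, hf⟩ := P.exists_stalkOp_eq_sum (fun z hz => (hU z hz).2) hY' hy
      have hYf := (hW y hy hyW).trans hf
      rw [hYf, stalkOp_sum]
      refine Finset.sum_congr rfl fun c _ => ?_
      rw [stalkOp_fmul, hXZ]
      congr 2
      rw [map_sum]
      have h1 : ∀ b, μ.stalkAt hy (Y (μ.ofFn ((u b).res le_top)) * μ.ofFn ((N b c).res le_top)) =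
          ∑ a, f a * μ.germ (Opens.mem_top y)
            (μ.gen (.fn (P.subbundle.lieDeriv (Z a) (u b) * N b c))) := fun b => by
        rw [map_mul, stalkAt_ofFn_res, ← stalkOp_stalkAt hY.1, stalkAt_ofFn_res, hYf, LinearMap.sum_apply,
          Finset.sum_mul]
        refine Finset.sum_congr rfl fun a _ => ?_
        rw [LinearMap.comp_apply, P.stalkOp_field, P.stalkNabla_gen, LinearMap.mulLeft_apply, mul_assoc,
          gen_fn_mul, map_mul]
        rfl
      simp only [h1]
      rw [Finset.sum_comm]
      have h2 : ∀ a, ∑ b, f a * μ.germ (Opens.mem_top y)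
          (μ.gen (.fn (P.subbundle.lieDeriv (Z a) (u b) * N b c))) = if a = c then f a else 0 := fun a => by
        have h3 : (∑ b, P.subbundle.lieDeriv (Z a) (u b) * N b c).res (le_top : U ≤ ⊤) =
            (if a = c then (1 : SmoothFun m (⊤ : Opens M)) else 0).res le_top := ContMDiffMap.ext fun z => by
          have h4 := (SmoothFun.val_sum Finset.univ (fun b => P.subbundle.lieDeriv (Z a) (u b) * N b c) (z : M)).trans
            ((hU z z.2).2.2 a c)
          refine h4.trans ?_
          split_ifs <;> rfl
        have h5 := germ_gen_eq_of_res_eq (μ := μ) (a := .fn _) (b := .fn _) le_top le_top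
          (congrArg Gen.fn h3) hy
        rw [← Finset.mul_sum, ← map_sum, ← gen_fn_sum, h5]
        split_ifs
        · rw [gen_fn_one, map_one, mul_one]
        · rw [gen_fn_zero, map_zero, mul_zero]
      simp only [h2]
      simp
  · rintro ⟨f, hf, rfl⟩
    refine sum_mem fun a _ => ?_
    have h := P.distribution.fmul_mem U k 0 _ (hf a) _ (hXD a)
    rwa [add_zero] at h

end CompatibleFlatConnections

end CoalgebraBundle

end Distribution

/-! ### From an involutive distribution to compatible flat connections. -/

section Correspondence

variable {m n : ℕ} {M : Type*} [TopologicalSpace M] [ChartedSpace (EuclideanSpace ℝ (Fin m)) M]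
  [T2Space M] [IsManifold (𝓡 m) ∞ M]
  {Fib : Fin n → Type*} [∀ i, NormedAddCommGroup (Fib i)] [∀ i, NormedSpace ℝ (Fib i)]
  [∀ i, FiniteDimensional ℝ (Fib i)]
  {E : Fin n → M → Type*} [∀ i, TopologicalSpace (TotalSpace (Fib i) (E i))]
  [∀ i x, AddCommGroup (E i x)] [∀ i x, Module ℝ (E i x)] [∀ i x, TopologicalSpace (E i x)]
  [∀ i, FiberBundle (Fib i) (E i)] [∀ i, VectorBundle ℝ (Fib i) (E i)]

namespace CoalgebraBundle

variable {μ : CoalgebraBundle m Fib E}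


section Symbol

variable {x : M}

lemma IsSymbol.add {ξ ξ' : Module.End ℝ (μ.Stalk x)} {v w : TangentSpace (𝓡 m) x}
    (hv : IsSymbol ξ v) (hw : IsSymbol ξ' w) : IsSymbol (ξ + ξ') (v + w) := fun f => by
  rw [dirDeriv_add_vec, ← hv, ← hw, stalkSymbol_apply, LinearMap.add_apply, map_add]
  rfl

lemma IsSymbol.smul (c : ℝ) {ξ : Module.End ℝ (μ.Stalk x)} {v : TangentSpace (𝓡 m) x}
    (hv : IsSymbol ξ v) : IsSymbol (c • ξ) (c • v) := fun f => by
  rw [dirDeriv_smul_vec, ← hv, stalkSymbol_apply, LinearMap.smul_apply, map_smul]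
  rfl

lemma IsSymbol.zero : IsSymbol (0 : Module.End ℝ (μ.Stalk x)) 0 := fun f => by
  rw [dirDeriv_zero_vec, stalkSymbol_apply, LinearMap.zero_apply, map_zero]

lemma stalkSymbol_stalkOp {X : Module.End ℝ (μ.Fun ⊤)} {k : ℤ} (hX : X ∈ μ.vectorFields ⊤ k) (x : M)
    {f g : SmoothFun m (⊤ : Opens M)} (h : X (μ.ofFn f) = μ.ofFn g) :
    stalkSymbol (stalkOp X (Opens.mem_top x)) (μ.germ (Opens.mem_top x) (μ.gen (.fn f))) = g.val x := by
  rw [← stalkAt_ofFn, stalkSymbol_apply, stalkOp_stalkAt hX, h]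
  exact eval_germ_fn g

lemma exists_eq_ofFn {X : Module.End ℝ (μ.Fun ⊤)} (hX : X ∈ μ.vectorFields ⊤ 0)
    (f : SmoothFun m (⊤ : Opens M)) : ∃ g, X (μ.ofFn f) = μ.ofFn g := by
  have h := hX.1 0 _ (ofFn_mem_homog f)
  rw [add_zero] at h
  exact exists_ofFn h

/-- Pointwise the symbol is the tangent vector of a point derivation; it varies smoothly because `X`
maps smooth functions to elements of degree 0, which are smooth functions. -/
lemma exists_symbol {X : Module.End ℝ (μ.Fun ⊤)} (hX : X ∈ μ.vectorFields ⊤ 0) :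
    ∃ Y : ∀ x : M, TangentSpace (𝓡 m) x,
      ContMDiff (𝓡 m) ((𝓡 m).prod 𝓘(ℝ, EuclideanSpace ℝ (Fin m))) ∞
        (fun y => (⟨y, Y y⟩ : TangentBundle (𝓡 m) M)) ∧
      ∀ x, IsSymbol (stalkOp X (Opens.mem_top x)) (Y x) := by
  choose Y hY using fun x => (isStalkDerivation_stalkOp hX (Opens.mem_top x)).exists_isSymbol
  refine ⟨Y, fun x => contMDiffAt_of_dirDeriv fun f => ?_, hY⟩
  obtain ⟨g, hg⟩ := exists_eq_ofFn hX f
  have h : (fun y => dirDeriv f.val y (Y y)) = g.val := funext fun y => by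
    rw [← hY y f, stalkSymbol_stalkOp hX y hg]
  rw [h]
  exact g.contMDiff_val' x

lemma apply_ofFn_of_isSymbol {d : ℕ} {S : TangentSubbundle m M d} {X : Module.End ℝ (μ.Fun ⊤)}
    (hX : X ∈ μ.vectorFields ⊤ 0) {Y : S.sections}
    (hY : ∀ x, IsSymbol (stalkOp X (Opens.mem_top x)) (Y.1 x)) (f : SmoothFun m (⊤ : Opens M)) :
    X (μ.ofFn f) = μ.ofFn (S.lieDeriv Y f) := by
  obtain ⟨g, hg⟩ := exists_eq_ofFn hX f
  rw [hg]
  refine congrArg _ (SmoothFun.val_injective (funext fun x => ?_))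
  rw [← stalkSymbol_stalkOp hX x hg, hY x f]
  rfl

lemma isSymbol_of_apply_ofFn {d : ℕ} {S : TangentSubbundle m M d} {X : Module.End ℝ (μ.Fun ⊤)}
    (hX : X ∈ μ.vectorFields ⊤ 0) {Y : S.sections} (h : ∀ f, X (μ.ofFn f) = μ.ofFn (S.lieDeriv Y f))
    (x : M) : IsSymbol (stalkOp X (Opens.mem_top x)) (Y.1 x) := fun f => stalkSymbol_stalkOp hX x (h f)

end Symbol

namespace GradedSubsheaf

variable {D : μ.GradedSubsheaf} {d : ℕ}

lemma le_zero {X : Module.End ℝ (μ.Fun ⊤)} (hX : X ∈ D.carrier ⊤ 0) : X ∈ μ.vectorFields ⊤ 0 :=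
  D.le ⊤ 0 hX

variable (D) in
/-- The tangent vectors at `x` of the vector fields of degree `0` in `D`. -/
def symbolSpace (x : M) : Submodule ℝ (TangentSpace (𝓡 m) x) where
  carrier := {v | ∃ X ∈ D.carrier ⊤ 0, IsSymbol (stalkOp X (Opens.mem_top x)) v}
  add_mem' := by
    rintro v w ⟨X, hX, hv⟩ ⟨Y, hY, hw⟩
    exact ⟨X + Y, add_mem hX hY, by rw [stalkOp_add]; exact hv.add hw⟩
  zero_mem' := ⟨0, zero_mem _, by rw [stalkOp_zero]; exact IsSymbol.zero⟩
  smul_mem' := by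
    rintro c v ⟨X, hX, hv⟩
    exact ⟨c • X, Submodule.smul_mem _ c hX, by rw [stalkOp_smul]; exact hv.smul c⟩

lemma IsFrame.span_eq {U : Opens M} {Z : Fin d → Module.End ℝ (μ.Fun ⊤)} (hZ : D.IsFrame U Z) {y : M}
    (hy : y ∈ U) {v : Fin d → TangentSpace (𝓡 m) y}
    (hv : ∀ a, IsSymbol (stalkOp (Z a) (Opens.mem_top y)) (v a)) :
    Submodule.span ℝ (Set.range v) = D.symbolSpace y := by
  refine le_antisymm (Submodule.span_le.2 ?_) ?_
  · rintro _ ⟨a, rfl⟩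
    exact ⟨Z a, hZ.mem a, hv a⟩
  · rintro w ⟨X, hX, hw⟩
    obtain ⟨W, hyW, f, hf, h⟩ := hZ.exists_eq_sum 0 ⊤ X hX y hy (Opens.mem_top y)
    rw [h y _ hyW] at hw
    rw [hw.unique (IsSymbol.sum_mul Finset.univ _ hv)]
    exact sum_mem fun a _ => Submodule.smul_mem _ _ (Submodule.subset_span ⟨a, rfl⟩)

lemma IsFrame.linearIndependent_symbol {U : Opens M} {Z : Fin d → Module.End ℝ (μ.Fun ⊤)}
    (hZ : D.IsFrame U Z) {y : M} (hy : y ∈ U) {v : Fin d → TangentSpace (𝓡 m) y}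
    (hv : ∀ a, IsSymbol (stalkOp (Z a) (Opens.mem_top y)) (v a)) : LinearIndependent ℝ v :=
  (linearIndependent_stalkSymbol_iff
    (fun a => isStalkDerivation_stalkOp (le_zero (hZ.mem a)) (Opens.mem_top y)) hv).1
      (hZ.linearIndependent y hy)

/-- The subbundle of tangent vectors of vector fields of degree `0` in a distribution. -/
def symbolBundle (hD : D.HasRank (Pi.single 0 d)) : TangentSubbundle m M d where
  fiber := D.symbolSpace
  exists_frame x := by
    obtain ⟨U, hxU, Z, hZ⟩ := hD.exists_isFrame x
    choose Y hY hYZ using fun a => exists_symbol (le_zero (hZ.mem a))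
    exact ⟨U, hxU, Y, fun a => (hY a).contMDiffOn, fun y hy =>
      ⟨hZ.linearIndependent_symbol hy fun a => hYZ a y, hZ.span_eq hy fun a => hYZ a y⟩⟩

lemma exists_symbol_section (hD : D.HasRank (Pi.single 0 d)) {X : Module.End ℝ (μ.Fun ⊤)}
    (hX : X ∈ D.carrier ⊤ 0) : ∃ Y : (symbolBundle hD).sections,
      ∀ x, IsSymbol (stalkOp X (Opens.mem_top x)) (Y.1 x) := by
  obtain ⟨Y, hY, h⟩ := exists_symbol (le_zero hX)
  exact ⟨⟨Y, hY, fun x => ⟨X, hX, h x⟩⟩, h⟩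

/-- Near `y` the field is `∑ f_a Z_a` with `f_a` of degree 0, hence smooth functions. Its symbol
vanishes on an open set and the symbols of the frame are independent, so every `f_a` vanishes on a
neighbourhood. Vanishing of the symbol at `y` alone would give only `f_a(y) = 0`. -/
lemma stalkOp_eq_zero (hD : D.HasRank (Pi.single 0 d)) {X : Module.End ℝ (μ.Fun ⊤)}
    (hX : X ∈ D.carrier ⊤ 0) {W : Opens M}
    (h : ∀ y ∈ W, IsSymbol (stalkOp X (Opens.mem_top y)) 0) {y : M} (hy : y ∈ W) :
    stalkOp X (Opens.mem_top y) = 0 := by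
  obtain ⟨U, hyU, Z, hZ⟩ := hD.exists_isFrame y
  obtain ⟨V, hyV, f, hf, hsum⟩ := hZ.exists_eq_sum 0 ⊤ X hX y hyU (Opens.mem_top y)
  choose g hg using fun a => exists_ofFn (hf a)
  choose Y hY hYZ using fun a => exists_symbol (le_zero (hZ.mem a))
  have h1 : ∀ z, z ∈ U ⊓ V ⊓ W → ∀ (hz : z ∈ V) (a), g a ⟨z, hz⟩ = 0 := fun z hz hzV => by
    have h2 := h z hz.2
    rw [hsum z _ hzV] at h2
    have h3 := (IsSymbol.sum_mul Finset.univ (fun a => μ.stalkAt hzV (f a)) fun a => hYZ a z).unique h2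
    have h4 := Fintype.linearIndependent_iff.1 (hZ.linearIndependent_symbol hz.1.1 fun a => hYZ a z) _ h3
    intro a
    rw [← bodyVal_ofFn (μ := μ), ← hg, ← h4 a]
    rfl
  rw [hsum y _ hyV]
  refine Finset.sum_eq_zero fun a _ => ?_
  have h5 : (g a).res (inf_le_left.trans inf_le_right : U ⊓ V ⊓ W ≤ V) =
      (0 : SmoothFun m V).res (inf_le_left.trans inf_le_right) :=
    ContMDiffMap.ext fun z => h1 z z.2 z.2.1.2 a
  have hy' : y ∈ U ⊓ V ⊓ W := ⟨⟨hyU, hyV⟩, hy⟩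
  have h6 := germ_gen_eq_of_res_eq (μ := μ) (a := .fn _) (b := .fn _) _ _ (congrArg Gen.fn h5) hy'
  rw [hg, stalkAt_ofFn, h6, gen_fn_zero, map_zero, LinearMap.mulLeft_zero_eq_zero, LinearMap.zero_comp]

lemma stalkOp_eq_of_isSymbol (hD : D.HasRank (Pi.single 0 d)) {X X' : Module.End ℝ (μ.Fun ⊤)}
    (hX : X ∈ D.carrier ⊤ 0) (hX' : X' ∈ D.carrier ⊤ 0) {W : Opens M} {Y : ∀ x : M, TangentSpace (𝓡 m) x}
    (h : ∀ y ∈ W, IsSymbol (stalkOp X (Opens.mem_top y)) (Y y))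
    (h' : ∀ y ∈ W, IsSymbol (stalkOp X' (Opens.mem_top y)) (Y y)) {y : M} (hy : y ∈ W) :
    stalkOp X (Opens.mem_top y) = stalkOp X' (Opens.mem_top y) := by
  rw [← sub_eq_zero, ← stalkOp_sub]
  refine stalkOp_eq_zero hD (sub_mem hX hX') (fun z hz => ?_) hy
  have h1 := (h z hz).sub (h' z hz)
  rwa [sub_self, ← stalkOp_sub] at h1

variable (hD : D.HasRank (Pi.single 0 d))

/-- The frame fields are combined with the coefficients that express `Y` in their symbols. -/
lemma exists_local_lift (Y : (symbolBundle hD).sections) (x : M) :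
    ∃ (W : Opens M) (_ : x ∈ W), ∃ X ∈ D.carrier ⊤ 0,
      ∀ y ∈ W, IsSymbol (stalkOp X (Opens.mem_top y)) (Y.1 y) := by
  obtain ⟨U, hxU, Z, hZ⟩ := hD.exists_isFrame x
  choose Z' hZ' using fun a => exists_symbol_section hD (hZ.mem a)
  obtain ⟨u, N, hN⟩ := exists_dual_functions (fun a => (Z' a).2.1)
    (hZ.linearIndependent_symbol hxU fun a => hZ' a x)
  obtain ⟨W, hxW, hW⟩ := exists_open_nhds (Filter.Eventually.and hN (U.isOpen.mem_nhds hxU))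
  let g : Fin d → SmoothFun m (⊤ : Opens M) := fun c => ∑ b, (symbolBundle hD).lieDeriv Y (u b) * N b c
  refine ⟨W, hxW, ∑ a, μ.fmul (μ.ofFn (g a)) (Z a), sum_mem fun a _ => ?_, fun y hy => ?_⟩
  · have h := D.fmul_mem ⊤ 0 0 _ (ofFn_mem_homog (g a)) _ (hZ.mem a)
    rwa [add_zero] at h
  · rw [TangentSubbundle.eq_sum_coeff (hZ.span_eq (hW y hy).2 fun a => hZ' a y) (hW y hy).1 Y, stalkOp_sum]
    simp only [stalkOp_fmul]
    have h := IsSymbol.sum_mul Finset.univ (fun a => μ.stalkAt (Opens.mem_top y) (μ.ofFn (g a)))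
      fun a => hZ' a y
    have h1 : ∀ a, Stalk.eval μ y (μ.stalkAt (Opens.mem_top y) (μ.ofFn (g a))) =
        ∑ b, ((symbolBundle hD).lieDeriv Y (u b)).val y * (N b a).val y := fun a =>
      (eval_germ_fn _).trans (SmoothFun.val_sum _ _ _)
    simpa only [h1] using h

/-- Local lifts have equal symbols on overlaps, so they coincide there by `stalkOp_eq_of_isSymbol`
and glue to an element of `D`. -/
lemma exists_lift (Y : (symbolBundle hD).sections) : ∃ X ∈ D.carrier ⊤ 0,
    ∀ x, IsSymbol (stalkOp X (Opens.mem_top x)) (Y.1 x) := by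
  choose W hxW X hX hW using exists_local_lift hD Y
  obtain ⟨X', hX', h⟩ := exists_vectorField (U := ⊤) (k := 0) (fun x _ => stalkOp (X x) (Opens.mem_top x))
    fun x _ => by
      obtain ⟨X'', hX'', h⟩ := exists_restriction (le_top : W x ≤ ⊤) (le_zero (hX x))
      refine ⟨W x, hxW x, X'', hX'', fun y _ hy => ?_⟩
      rw [h y hy]
      exact stalkOp_eq_of_isSymbol hD (W := W x ⊓ W y) (hX y) (hX x) (fun z hz => hW y z hz.2)
        (fun z hz => hW x z hz.1) ⟨hy, hxW y⟩
  refine ⟨X', D.mem_of_stalkOp hX' fun x _ => ⟨⊤, Opens.mem_top x, X x, hX x, W x, hxW x, fun y _ _ hy => ?_⟩,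
    fun x => ?_⟩
  · rw [h]
    exact stalkOp_eq_of_isSymbol hD (W := W x ⊓ W y) (hX y) (hX x) (fun z hz => hW y z hz.2)
      (fun z hz => hW x z hz.1) ⟨hy, hxW y⟩
  · rw [h]
    exact hW x x (hxW x)

/-- The vector field of degree `0` in a distribution with a given symbol. -/
def lift (Y : (symbolBundle hD).sections) : Module.End ℝ (μ.Fun ⊤) := (exists_lift hD Y).choose

lemma lift_mem (Y : (symbolBundle hD).sections) : lift hD Y ∈ D.carrier ⊤ 0 :=
  (exists_lift hD Y).choose_spec.1

lemma isSymbol_lift (Y : (symbolBundle hD).sections) (x : M) :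
    IsSymbol (stalkOp (lift hD Y) (Opens.mem_top x)) (Y.1 x) := (exists_lift hD Y).choose_spec.2 x

lemma lift_ofFn (Y : (symbolBundle hD).sections) (f : SmoothFun m (⊤ : Opens M)) :
    lift hD Y (μ.ofFn f) = μ.ofFn ((symbolBundle hD).lieDeriv Y f) :=
  apply_ofFn_of_isSymbol (le_zero (lift_mem hD Y)) (isSymbol_lift hD Y) f

lemma eq_lift {X : Module.End ℝ (μ.Fun ⊤)} (hX : X ∈ D.carrier ⊤ 0) {Y : (symbolBundle hD).sections}
    (h : ∀ f, X (μ.ofFn f) = μ.ofFn ((symbolBundle hD).lieDeriv Y f)) : X = lift hD Y :=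
  vectorField_ext (le_zero hX) (le_zero (lift_mem hD Y)) fun x _ =>
    stalkOp_eq_of_isSymbol hD (W := ⊤) hX (lift_mem hD Y)
      (fun y _ => isSymbol_of_apply_ofFn (le_zero hX) h y) (fun y _ => isSymbol_lift hD Y y) (Opens.mem_top x)

lemma lift_add (Y Y' : (symbolBundle hD).sections) : lift hD (Y + Y') = lift hD Y + lift hD Y' :=
  (eq_lift hD (add_mem (lift_mem hD Y) (lift_mem hD Y')) fun f => by
    rw [LinearMap.add_apply, lift_ofFn, lift_ofFn, TangentSubbundle.lieDeriv_add_left, ofFn_add]).symm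

lemma lift_fsmul (f : SmoothFun m (⊤ : Opens M)) (Y : (symbolBundle hD).sections) :
    lift hD ((symbolBundle hD).fsmul f Y) = μ.fmul (μ.ofFn f) (lift hD Y) := by
  have h := D.fmul_mem ⊤ 0 0 _ (ofFn_mem_homog f) _ (lift_mem hD Y)
  rw [add_zero] at h
  refine (eq_lift hD h fun g => ?_).symm
  rw [TangentSubbundle.lieDeriv_fsmul, ofFn_mul, ← lift_ofFn]
  rfl

lemma gradedBracket_lift_mem (hI : D.IsInvolutive) (Y Y' : (symbolBundle hD).sections) :
    μ.gradedBracket 0 0 (lift hD Y) (lift hD Y') ∈ D.carrier ⊤ 0 := by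
  have h := hI ⊤ 0 0 _ (lift_mem hD Y) _ (lift_mem hD Y')
  rwa [add_zero] at h

/-- The bracket of two lifts lies in `D`, and on functions it acts as the commutator, so its symbol
is the Lie bracket. -/
lemma isInvolutive_symbolBundle (hI : D.IsInvolutive) : (symbolBundle hD).IsInvolutive := by
  intro Y Y' x
  refine ⟨_, gradedBracket_lift_mem hD hI Y Y', fun f => ?_⟩
  have h : μ.gradedBracket 0 0 (lift hD Y) (lift hD Y') (μ.ofFn f) =
      μ.ofFn ((symbolBundle hD).lieDeriv Y ((symbolBundle hD).lieDeriv Y' f) -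
        (symbolBundle hD).lieDeriv Y' ((symbolBundle hD).lieDeriv Y f)) := by
    rw [gradedBracket_zero_zero_apply, lift_ofFn, lift_ofFn, lift_ofFn, lift_ofFn, sub_eq_iff_eq_add,
      ← ofFn_add, sub_add_cancel]
  rw [stalkSymbol_stalkOp (le_zero (gradedBracket_lift_mem hD hI Y Y')) x h]
  exact (dirDeriv_mlieBracket f.contMDiff_val' (Y.2.1 x) (Y'.2.1 x)).symm

lemma lift_bracket (hI : D.IsInvolutive) (Y Y' : (symbolBundle hD).sections) :
    lift hD ((isInvolutive_symbolBundle hD hI).bracket Y Y') =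
      μ.gradedBracket 0 0 (lift hD Y) (lift hD Y') :=
  (eq_lift hD (gradedBracket_lift_mem hD hI Y Y') fun f => by
    rw [gradedBracket_zero_zero_apply, lift_ofFn, lift_ofFn, lift_ofFn, lift_ofFn,
      TangentSubbundle.lieDeriv_bracket, sub_eq_iff_eq_add, ← ofFn_add, sub_add_cancel]).symm

lemma exists_lift_ofSec (Y : (symbolBundle hD).sections) (i : Fin n)
    (η : DualSec m (Fib i) (E i) (⊤ : Opens M)) : ∃ ζ, lift hD Y (μ.ofSec i η) = μ.ofSec i ζ := by
  have h := (le_zero (lift_mem hD Y)).1 _ _ (ofSec_mem_homog i η)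
  rw [add_zero] at h
  exact exists_ofSec h

/-- The partial connection defined by the action of a distribution on sections of `E_{-i}^*`. -/
def nabla (Y : (symbolBundle hD).sections) (i : Fin n) (η : DualSec m (Fib i) (E i) (⊤ : Opens M)) :
    DualSec m (Fib i) (E i) (⊤ : Opens M) := (exists_lift_ofSec hD Y i η).choose

lemma lift_ofSec (Y : (symbolBundle hD).sections) (i : Fin n)
    (η : DualSec m (Fib i) (E i) (⊤ : Opens M)) : lift hD Y (μ.ofSec i η) = μ.ofSec i (nabla hD Y i η) :=
  (exists_lift_ofSec hD Y i η).choose_spec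

lemma lift_mul_of_mem {k : ℤ} (Y : (symbolBundle hD).sections) {s : μ.Fun ⊤} (hs : s ∈ μ.homog ⊤ k)
    (t : μ.Fun ⊤) : lift hD Y (s * t) = lift hD Y s * t + s * lift hD Y t := by
  rw [(le_zero (lift_mem hD Y)).2 k s hs t, mul_zero, sgn, zpow_zero, one_smul]

/-- The partial connection on `E_{-i}^*` defined by a distribution. -/
def connection (i : Fin n) : PartialConnection (symbolBundle hD) (Fib i) (E i) where
  nabla Y η := nabla hD Y i η
  add_left Y Y' η := ofSec_injective i <| by
    rw [← lift_ofSec, lift_add, ofSec_add, ← lift_ofSec, ← lift_ofSec]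
    rfl
  fsmul_left f Y η := ofSec_injective i <| by
    rw [← lift_ofSec, lift_fsmul, ofSec_fsmul, ← lift_ofSec]
    rfl
  add_right Y η ζ := ofSec_injective i <| by
    rw [← lift_ofSec, ofSec_add, map_add, lift_ofSec, lift_ofSec, ← ofSec_add]
  leibniz Y f η := ofSec_injective i <| by
    rw [← lift_ofSec, ofSec_fsmul, lift_mul_of_mem hD Y (ofFn_mem_homog f), lift_ofFn, lift_ofSec, ofSec_add,
      ofSec_fsmul, ofSec_fsmul, add_comm]

/-- The compatible flat connections defined by an involutive distribution. -/
def connections (hI : D.IsInvolutive) : μ.CompatibleFlatConnections d where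
  subbundle := symbolBundle hD
  involutive := isInvolutive_symbolBundle hD hI
  conn := connection hD
  flat i Y Y' η := ofSec_injective i <| by
    change _ = μ.ofSec i (nabla hD _ i η)
    rw [← lift_ofSec, lift_bracket hD hI, gradedBracket_zero_zero_apply, eq_sub_iff_add_eq]
    rw [lift_ofSec, lift_ofSec, lift_ofSec, lift_ofSec, ← ofSec_add]
    exact congrArg (μ.ofSec i) (DualSec.ext fun x => sub_add_cancel ((nabla hD Y i (nabla hD Y' i η)).1 x) _)
  compatible i j l h Y η ζ := ofSec_injective l <| by
    change μ.ofSec l (nabla hD _ l _) = _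
    rw [← lift_ofSec, ← ofSec_mul h, lift_mul_of_mem hD Y (ofSec_mem_homog i η), lift_ofSec, lift_ofSec,
      ofSec_add, ← ofSec_mul h, ← ofSec_mul h]
    rfl

lemma field_connections (hI : D.IsInvolutive) (Y : (symbolBundle hD).sections) :
    (connections hD hI).field Y = lift hD Y :=
  vectorField_ext_gen ((connections hD hI).field_mem Y) (le_zero (lift_mem hD Y))
    (fun f => ((connections hD hI).field_ofFn Y f).trans (lift_ofFn hD Y f).symm)
    fun i η => ((connections hD hI).field_ofSec Y i η).trans (lift_ofSec hD Y i η).symm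

lemma corresponds_connections (hI : D.IsInvolutive) : μ.Corresponds D (connections hD hI) := by
  intro U X
  constructor
  · intro hX
    refine ⟨D.le U 0 hX, fun x hx => ?_⟩
    obtain ⟨X', hX', W, hxW, hWU, hW⟩ := D.exists_global hX hx
    obtain ⟨Y, hY⟩ := exists_symbol_section hD hX'
    refine ⟨W, hWU, hxW, Y, (actsAsNabla_iff (connections hD hI) Y hWU (D.le U 0 hX)).2 fun y hy => ?_⟩
    rw [← hW y hy, eq_lift hD hX' (apply_ofFn_of_isSymbol (le_zero hX') hY)]
    exact congrArg (fun X => stalkOp X (Opens.mem_top y)) (field_connections hD hI Y).symm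
  · rintro ⟨hX, h⟩
    refine D.mem_of_stalkOp hX fun x hx => ?_
    obtain ⟨V, hV, hxV, Y, hY⟩ := h x hx
    refine ⟨⊤, Opens.mem_top x, lift hD Y, lift_mem hD Y, V, hxV, fun y hU _ hy => ?_⟩
    rw [← field_connections hD hI Y]
    exact (actsAsNabla_iff _ Y hV hX).1 hY y hy

end GradedSubsheaf

/-! ### Each side of the correspondence determines the other. -/

section Uniqueness

variable {d : ℕ}

lemma Corresponds.distribution_unique {D D' : μ.GradedSubsheaf} {P : μ.CompatibleFlatConnections d}
    (hD : D.HasRank (Pi.single 0 d)) (hD' : D'.HasRank (Pi.single 0 d)) (h : μ.Corresponds D P)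
    (h' : μ.Corresponds D' P) : D = D' :=
  GradedSubsheaf.ext <| funext fun U => funext fun k => le_antisymm
    (GradedSubsheaf.eq_of_carrier_zero hD (fun V X hX => (h' V X).2 ((h V X).1 hX)) U k)
    (GradedSubsheaf.eq_of_carrier_zero hD' (fun V X hX => (h V X).2 ((h' V X).1 hX)) U k)

variable {D : μ.GradedSubsheaf} {P P' : μ.CompatibleFlatConnections d}

/-- The field `∇_Y` of `P` lies in `D`, hence is locally a field `∇_{Y'}` of `P'`; comparing symbols
gives `Y = Y'` locally. -/
lemma Corresponds.exists_local_field (h : μ.Corresponds D P) (h' : μ.Corresponds D P')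
    (Y : P.subbundle.sections) (x : M) : ∃ (V : Opens M) (_ : x ∈ V) (Y' : P'.subbundle.sections),
      ∀ y ∈ V, stalkOp (P.field Y) (Opens.mem_top y) = stalkOp (P'.field Y') (Opens.mem_top y) ∧
        Y.1 y = Y'.1 y := by
  have hY : P.field Y ∈ D.carrier ⊤ 0 := (h ⊤ _).2 ⟨P.field_mem Y, fun x _ =>
    ⟨⊤, le_rfl, Opens.mem_top x, Y, (actsAsNabla_iff P Y le_rfl (P.field_mem Y)).2 fun _ _ => rfl⟩⟩
  obtain ⟨V, hV, hxV, Y', hY'⟩ := ((h' ⊤ _).1 hY).2 x (Opens.mem_top x)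
  have hV := (actsAsNabla_iff P' Y' hV (P.field_mem Y)).1 hY'
  refine ⟨V, hxV, Y', fun y hy => ⟨hV y hy, ?_⟩⟩
  have h1 := P.isSymbol_field Y y
  rw [hV y hy] at h1
  exact h1.unique (P'.isSymbol_field Y' y)

lemma Corresponds.fiber_le (h : μ.Corresponds D P) (h' : μ.Corresponds D P') (x : M) :
    P.subbundle.fiber x ≤ P'.subbundle.fiber x := fun v hv => by
  obtain ⟨Y, rfl⟩ := P.subbundle.exists_section hv
  obtain ⟨V, hxV, Y', hV⟩ := h.exists_local_field h' Y x
  rw [(hV x hxV).2]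
  exact Y'.2.2 x

lemma Corresponds.field_eq (h : μ.Corresponds D P) (h' : μ.Corresponds D P')
    {Y : P.subbundle.sections} {Y' : P'.subbundle.sections} (hY : Y.1 = Y'.1) :
    P.field Y = P'.field Y' :=
  vectorField_ext (P.field_mem Y) (P'.field_mem Y') fun x _ => by
    obtain ⟨V, hxV, Y'', hV⟩ := h.exists_local_field h' Y x
    refine (hV x hxV).1.trans (P'.stalkOp_field_congr (fun y hy => ?_) hxV)
    rw [← (hV y hy).2, hY]

lemma Corresponds.connections_unique (h : μ.Corresponds D P) (h' : μ.Corresponds D P') : P = P' := by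
  have hS : P.subbundle = P'.subbundle :=
    TangentSubbundle.ext (funext fun x => le_antisymm (h.fiber_le h' x) (h'.fiber_le h x))
  -- The sections form different types until the subbundles are identified, so the connections are
  -- first compared on pairs with the same underlying vector field.
  have hfield : ∀ (Y : P.subbundle.sections) (Y' : P'.subbundle.sections), Y.1 = Y'.1 → ∀ i η,
      (P.conn i).nabla Y η = (P'.conn i).nabla Y' η := fun Y Y' hY i η => ofSec_injective i <| by
    rw [← P.field_ofSec, h.field_eq h' hY, P'.field_ofSec]
  clear h h'
  obtain ⟨S, hS₁, c, hf, hc⟩ := P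
  obtain ⟨S', hS₁', c', hf', hc'⟩ := P'
  obtain rfl : S = S' := hS
  obtain rfl : c = c' := funext fun i => PartialConnection.ext <| funext fun Y => funext fun η =>
    hfield Y Y rfl i η
  rfl

end Uniqueness

end CoalgebraBundle

end Correspondence

end NMan

end

theorem mainTheorem7 {m n : ℕ} {M : Type*} [TopologicalSpace M] [T2Space M] [SigmaCompactSpace M]
    [ChartedSpace (EuclideanSpace ℝ (Fin m)) M] [IsManifold (𝓡 m) ∞ M]
    {Fib : Fin n → Type*} [∀ i, NormedAddCommGroup (Fib i)] [∀ i, NormedSpace ℝ (Fib i)]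
    [∀ i, FiniteDimensional ℝ (Fib i)]
    {E : Fin n → M → Type*} [∀ i, TopologicalSpace (TotalSpace (Fib i) (E i))]
    [∀ i x, AddCommGroup (E i x)] [∀ i x, Module ℝ (E i x)] [∀ i x, TopologicalSpace (E i x)]
    [∀ i, FiberBundle (Fib i) (E i)] [∀ i, VectorBundle ℝ (Fib i) (E i)]
    [∀ i, ContMDiffVectorBundle ∞ (Fib i) (E i) (𝓡 m)]
    (μ : NMan.CoalgebraBundle m Fib E) (hμ : μ.IsAdmissible) (d₀ : ℕ) :
    ∃ Φ : μ.InvolutiveDistribution (Pi.single 0 d₀) ≃ μ.CompatibleFlatConnections d₀,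
      ∀ D : μ.InvolutiveDistribution (Pi.single 0 d₀), μ.Corresponds D.1 (Φ D) := by
  refine ⟨
    { toFun := fun D => NMan.CoalgebraBundle.GradedSubsheaf.connections D.2.1 D.2.2
      invFun := fun P => ⟨P.distribution, P.hasRank_distribution, P.isInvolutive_distribution⟩
      -- Neither composite is computed: each is identified by the uniqueness half of the
      -- correspondence.
      left_inv := fun D => Subtype.ext (NMan.CoalgebraBundle.Corresponds.distribution_unique
        (NMan.CoalgebraBundle.CompatibleFlatConnections.hasRank_distribution _) D.2.1
        (NMan.CoalgebraBundle.CompatibleFlatConnections.corresponds_distribution _)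
        (NMan.CoalgebraBundle.GradedSubsheaf.corresponds_connections D.2.1 D.2.2))
      right_inv := fun P => NMan.CoalgebraBundle.Corresponds.connections_unique
        (NMan.CoalgebraBundle.GradedSubsheaf.corresponds_connections _ _) P.corresponds_distribution },
    fun D => NMan.CoalgebraBundle.GradedSubsheaf.corresponds_connections D.2.1 D.2.2⟩
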